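/- Let $\mathbb T$ be the unit circle, $\mathbb D$ the open unit disk, $m$ the normalized Lebesgue measure on $\mathbb T$. Let $a_{-1}\in\mathbb T$ and $a_0,a_1,\dots\in\mathbb D$ with $\sum_{k\ge0}|a_k|^2<\infty$ (the Szegő class), and let $\mathfrak A=\mathfrak A_1\mathfrak A_0$ be the associated CMV matrix, a unitary operator in $\ell^2(\mathbb Z_+)$, where $\mathfrak A_0=\mathrm{diag}(A_0,A_2,\dots)$, $\mathfrak A_1=\mathrm{diag}(-\bar a_{-1},A_1,A_3,\dots)$, $$A_k=\begin{bmatrix}a_k&\rho_k\\ \rho_k&-\bar a_k\end{bmatrix},\qquad \rho_k=\sqrt{1-|a_k|^2}.$$ Let $\sigma$ be its spectral measure, i.e. the probability measure on $\mathbb T$ with $\int_{\mathbb T}\frac{t+z}{t-z}\,d\sigma(t)=\langle(\mathfrak A+z)(\mathfrak A-z)^{-1}e_0,e_0\rangle$ for $|z|<1$, let $d\sigma=w\,dm+d\sigma_s$ be its Lebesgue decomposition, and put $$D(z)=\exp\Big(\tfrac12\int_{\mathbb T}\tfrac{t+z}{t-z}\log w(t)\,dm(t)\Big)\ (|z|<1),\qquad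 D_*(z)=\overline{D(1/\bar z)}\ (|z|>1).$$ Let $P_0,P_1,P_2,\dots$ be the orthonormal Laurent polynomials obtained by orthogonalization of $1,t^{-1},t,t^{-2},t^2,\dots$ in $L^2_{d\sigma}$, normalized so that the leading coefficient (at $t^n$) of $P_{2n}$ is positive and the leading coefficient (at $t^{-n-1}$) of $P_{2n+1}$ is $-\bar a_{-1}$ times a positive number. For each $n$ set $$F_1^{(n)}(z)=\frac1{D(z)}\int_{\mathbb T}\frac{t}{t-z}P_n(t)\,d\sigma(t)\ (|z|<1),\qquad F_2^{(n)}(z)=\frac{a_{-1}}{D_*(z)}\int_{\mathbb T}\frac{t}{t-z}P_n(t)\,d\sigma(t)\ (|z|>1).$$ The matrix $\mathcal M=(\mathcal M^n_i)_{i,n\ge0}$ ($i$ is the row, $n$ the column) of the Gelfand–Levitan–Marchenko (GLM) transformation is defined by $$F^{(n)}_1(z)=\sum_{k\ge0}\mathcal M^n_{2k}z^k,\qquad F^{(n)}_2(z)=\sum_{k\ge0}\mathcal M^n_{2k+1}z^{-k-1}.$$ Then $\mathcal M$ generates a bounded operator in $\ell^2(\mathbb Z_+)$ if and only if $\sigma$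 is absolutely continuous with respect to $m$ and the Riesz projections $P_+:\sum_n\hat g(n)t^n\mapsto\sum_{n\ge0}\hat g(n)t^n$ and $P_-:\sum_n\hat g(n)t^n\mapsto\sum_{n<0}\hat g(n)t^n$ are bounded operators in $L^2_{w^{-1}dm}$. (As $w\in L^1$, one has $L^2_{w^{-1}dm}\subset L^1$, so the Fourier coefficients $\hat g(n)$ are defined; boundedness means that $P_\pm g\in L^2_{w^{-1}dm}$ for every $g\in L^2_{w^{-1}dm}$, with norm at most a constant times the norm of $g$.) -/

import Mathlib

open MeasureTheory Complex AddCircle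
open scoped ComplexConjugate ENNReal

noncomputable section

namespace CMV

/-! ### The Hilbert space `ℓ²(ℤ₊)` and CMV matrices -/

/-- The Hilbert space `ℓ²(ℤ₊)`, with `ℤ₊ = {0, 1, 2, …}`. -/
abbrev Ell2 : Type := lp (fun _ : ℕ => ℂ) 2

/-- The vectors `e₀, e₁, …` of the standard basis of `ℓ²(ℤ₊)`. -/
def stdBasis (n : ℕ) : Ell2 := lp.single 2 n (1 : ℂ)

/-- `ρ = √(1 - |a|²)`. -/
def rho (a : UnitDisc) : ℝ := Real.sqrt (1 - ‖(a : ℂ)‖ ^ 2)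

theorem norm_rho_le (a : UnitDisc) : ‖(rho a : ℂ)‖ ≤ 1 := by
  rw [Complex.norm_real, rho, Real.norm_of_nonneg (Real.sqrt_nonneg _), Real.sqrt_le_one]
  nlinarith [sq_nonneg ‖(a : ℂ)‖]

/-- A sequence dominated entrywise by three neighbouring entries of an `ℓ²` sequence is in `ℓ²`. -/
theorem hasSum_aux (x : Ell2) (y : ℕ → ℂ)
    (h : ∀ n, ‖y n‖ ≤ ‖x (n - 1)‖ + ‖x n‖ + ‖x (n + 1)‖) :
    Summable (fun n => ‖y n‖ ^ 2) ∧ ∑' n, ‖y n‖ ^ 2 ≤ (4 * ‖x‖) ^ 2 := by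
  have hx : HasSum (fun n => ‖x n‖ ^ 2) (‖x‖ ^ 2) := by
    have := lp.hasSum_norm (p := 2) (by norm_num) x
    simpa using this
  have hs := hx.summable
  have hx1 : Summable (fun n => ‖x (n + 1)‖ ^ 2) := (summable_nat_add_iff 1).2 hs
  have hx2 : Summable (fun n => ‖x (n - 1)‖ ^ 2) :=
    (summable_nat_add_iff (f := fun n => ‖x (n - 1)‖ ^ 2) 1).1 (by simpa using hs)
  have hle : ∀ n, ‖y n‖ ^ 2 ≤
      3 * ‖x (n - 1)‖ ^ 2 + 3 * ‖x n‖ ^ 2 + 3 * ‖x (n + 1)‖ ^ 2 := by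
    intro n
    have h1 := h n
    have h0 := norm_nonneg (y n)
    have h2 : ‖y n‖ ^ 2 ≤ (‖x (n - 1)‖ + ‖x n‖ + ‖x (n + 1)‖) ^ 2 := by gcongr
    nlinarith [sq_nonneg (‖x (n - 1)‖ - ‖x n‖), sq_nonneg (‖x (n - 1)‖ - ‖x (n + 1)‖),
      sq_nonneg (‖x n‖ - ‖x (n + 1)‖)]
  have hS : Summable (fun n =>
      3 * ‖x (n - 1)‖ ^ 2 + 3 * ‖x n‖ ^ 2 + 3 * ‖x (n + 1)‖ ^ 2) :=
    ((hx2.mul_left 3).add (hs.mul_left 3)).add (hx1.mul_left 3)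
  have hy : Summable (fun n => ‖y n‖ ^ 2) :=
    Summable.of_nonneg_of_le (fun n => sq_nonneg _) hle hS
  refine ⟨hy, (hy.tsum_le_tsum hle hS).trans ?_⟩
  rw [((hx2.mul_left 3).add (hs.mul_left 3)).tsum_add (hx1.mul_left 3),
    (hx2.mul_left 3).tsum_add (hs.mul_left 3), tsum_mul_left, tsum_mul_left, tsum_mul_left,
    hx.tsum_eq]
  have e1 : ‖x 0‖ ^ 2 + ∑' n, ‖x (n + 1)‖ ^ 2 = ‖x‖ ^ 2 := by
    rw [← hx.tsum_eq, hs.tsum_eq_zero_add]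
  have e2 : ∑' n, ‖x (n - 1)‖ ^ 2 = ‖x 0‖ ^ 2 + ‖x‖ ^ 2 := by
    rw [hx2.tsum_eq_zero_add, ← hx.tsum_eq]
    simp
  have e3 : 0 ≤ ∑' n, ‖x (n + 1)‖ ^ 2 := tsum_nonneg fun n => sq_nonneg _
  rw [e2]
  nlinarith [sq_nonneg ‖x 0‖, sq_nonneg ‖x‖]

theorem memℓp_aux (x : Ell2) (y : ℕ → ℂ)
    (h : ∀ n, ‖y n‖ ≤ ‖x (n - 1)‖ + ‖x n‖ + ‖x (n + 1)‖) : Memℓp y 2 := by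
  refine memℓp_gen ?_
  simpa using (hasSum_aux x y h).1

theorem norm_aux (x y : Ell2)
    (h : ∀ n, ‖y n‖ ≤ ‖x (n - 1)‖ + ‖x n‖ + ‖x (n + 1)‖) : ‖y‖ ≤ 4 * ‖x‖ := by
  have hy : HasSum (fun n => ‖y n‖ ^ 2) (‖y‖ ^ 2) := by
    have := lp.hasSum_norm (p := 2) (by norm_num) y
    simpa using this
  have := (hasSum_aux x y h).2
  rw [hy.tsum_eq] at this
  exact le_of_sq_le_sq this (by positivity)

/-- Entries of `𝔄₀ x`, where `𝔄₀ = diag(A₀, A₂, A₄, …)` and `A_k = [a_k, ρ_k; ρ_k, -ā_k]`. -/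
def factorZeroFun (a : ℕ → UnitDisc) (x : ℕ → ℂ) (n : ℕ) : ℂ :=
  if Even n then a n * x n + rho (a n) * x (n + 1)
  else rho (a (n - 1)) * x (n - 1) - conj (a (n - 1) : ℂ) * x n

/-- Entries of `𝔄₁ x`, where `𝔄₁ = diag(-ā₋₁, A₁, A₃, …)` and `A_k = [a_k, ρ_k; ρ_k, -ā_k]`.
Here `b` stands for `a₋₁`. -/
def factorOneFun (b : Circle) (a : ℕ → UnitDisc) (x : ℕ → ℂ) (n : ℕ) : ℂ :=
  if n = 0 then -conj (b : ℂ) * x 0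
  else if Odd n then a n * x n + rho (a n) * x (n + 1)
  else rho (a (n - 1)) * x (n - 1) - conj (a (n - 1) : ℂ) * x n

theorem block_bound {p q u v : ℂ} (hp : ‖p‖ ≤ 1) (hq : ‖q‖ ≤ 1) :
    ‖p * u + q * v‖ ≤ ‖u‖ + ‖v‖ ∧ ‖p * u - q * v‖ ≤ ‖u‖ + ‖v‖ := by
  have h1 : ‖p * u‖ ≤ ‖u‖ := by
    rw [norm_mul]; exact mul_le_of_le_one_left (norm_nonneg _) hp
  have h2 : ‖q * v‖ ≤ ‖v‖ := by
    rw [norm_mul]; exact mul_le_of_le_one_left (norm_nonneg _) hq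
  exact ⟨(norm_add_le _ _).trans (add_le_add h1 h2), (norm_sub_le _ _).trans (add_le_add h1 h2)⟩

theorem norm_conj_le (a : UnitDisc) : ‖conj (a : ℂ)‖ ≤ 1 := by
  rw [RCLike.norm_conj]; exact a.norm_lt_one.le

theorem factorZeroFun_bound (a : ℕ → UnitDisc) (x : ℕ → ℂ) (n : ℕ) :
    ‖factorZeroFun a x n‖ ≤ ‖x (n - 1)‖ + ‖x n‖ + ‖x (n + 1)‖ := by
  unfold factorZeroFun
  split_ifs
  · have := (block_bound (u := x n) (v := x (n + 1)) (a n).norm_lt_one.le (norm_rho_le (a n))).1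
    linarith [norm_nonneg (x (n - 1))]
  · have := (block_bound (u := x (n - 1)) (v := x n) (norm_rho_le (a (n - 1)))
      (norm_conj_le (a (n - 1)))).2
    linarith [norm_nonneg (x (n + 1))]

theorem factorOneFun_bound (b : Circle) (a : ℕ → UnitDisc) (x : ℕ → ℂ) (n : ℕ) :
    ‖factorOneFun b a x n‖ ≤ ‖x (n - 1)‖ + ‖x n‖ + ‖x (n + 1)‖ := by
  unfold factorOneFun
  split_ifs with h0
  · subst h0
    have : ‖-conj (b : ℂ) * x 0‖ = ‖x 0‖ := by
      rw [norm_mul, norm_neg, RCLike.norm_conj, Circle.norm_coe, one_mul]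
    rw [this]
    linarith [norm_nonneg (x (0 - 1)), norm_nonneg (x (0 + 1))]
  · have := (block_bound (u := x n) (v := x (n + 1)) (a n).norm_lt_one.le (norm_rho_le (a n))).1
    linarith [norm_nonneg (x (n - 1))]
  · have := (block_bound (u := x (n - 1)) (v := x n) (norm_rho_le (a (n - 1)))
      (norm_conj_le (a (n - 1)))).2
    linarith [norm_nonneg (x (n + 1))]

/-- The factor `𝔄₀` as a bounded operator in `ℓ²(ℤ₊)`. -/
def factorZero (a : ℕ → UnitDisc) : Ell2 →L[ℂ] Ell2 :=
  LinearMap.mkContinuous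
    { toFun := fun x => ⟨factorZeroFun a x, memℓp_aux x _ (factorZeroFun_bound a x)⟩
      map_add' := fun x y => by
        ext n
        simp only [factorZeroFun, lp.coeFn_add, Pi.add_apply]
        split_ifs <;> ring
      map_smul' := fun c x => by
        ext n
        simp only [factorZeroFun, lp.coeFn_smul, Pi.smul_apply, smul_eq_mul, RingHom.id_apply]
        split_ifs <;> ring }
    4 fun x => norm_aux x _ (factorZeroFun_bound a x)

/-- The factor `𝔄₁` as a bounded operator in `ℓ²(ℤ₊)`. -/
def factorOne (b : Circle) (a : ℕ → UnitDisc) : Ell2 →L[ℂ] Ell2 :=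
  LinearMap.mkContinuous
    { toFun := fun x => ⟨factorOneFun b a x, memℓp_aux x _ (factorOneFun_bound b a x)⟩
      map_add' := fun x y => by
        ext n
        simp only [factorOneFun, lp.coeFn_add, Pi.add_apply]
        split_ifs <;> ring
      map_smul' := fun c x => by
        ext n
        simp only [factorOneFun, lp.coeFn_smul, Pi.smul_apply, smul_eq_mul, RingHom.id_apply]
        split_ifs <;> ring }
    4 fun x => norm_aux x _ (factorOneFun_bound b a x)

/-- The CMV matrix `𝔄 = 𝔄₁ 𝔄₀` of the coefficients `b = a₋₁ ∈ 𝕋` and `a₀, a₁, … ∈ 𝔻`, as an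
operator in `ℓ²(ℤ₊)`. -/
def cmvOperator (b : Circle) (a : ℕ → UnitDisc) : Ell2 →L[ℂ] Ell2 :=
  factorOne b a ∘L factorZero a

/-- The Szegő class: `∑ |a_k|² < ∞`. -/
def IsSzego (a : ℕ → UnitDisc) : Prop := Summable fun k => ‖(a k : ℂ)‖ ^ 2

/-! ### The unit circle and the spectral measure

The circle `𝕋` is parametrized by `ℝ/ℤ` through `x ↦ t = e^{2πix}`. -/

/-- The normalized Lebesgue measure `dm` of the circle. -/
abbrev m : Measure UnitAddCircle := haarAddCircle

/-- The point `t = e^{2πix}` of the unit circle in `ℂ` that corresponds to `x ∈ ℝ/ℤ`. -/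
def pt (x : UnitAddCircle) : ℂ := (toCircle x : ℂ)

/-- `σ` is the spectral measure of the unitary operator `U` with respect to the vector `v`:
`∫ (t + z) / (t - z) dσ(t) = ⟨(U + z) (U - z)⁻¹ v, v⟩` for `|z| < 1`. (The inner product of
Mathlib is linear in its second argument.) -/
def IsSpectralMeasure (U : Ell2 →L[ℂ] Ell2) (v : Ell2) (σ : Measure UnitAddCircle) : Prop :=
  ∀ z : ℂ, ‖z‖ < 1 →
    ∫ x, (pt x + z) / (pt x - z) ∂σ = inner ℂ v (((U + z • 1) * Ring.inverse (U - z • 1)) v)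

/-- The density `w` of the absolutely continuous part of `σ`: `dσ = w dm + dσ_s`. -/
def density (σ : Measure UnitAddCircle) (x : UnitAddCircle) : ℝ := (σ.rnDeriv m x).toReal

/-! ### The functions `D` and `D_*` -/

/-- The outer function `D(z) = exp (½ ∫ (t + z) / (t - z) log w(t) dm(t))`, `|z| < 1`. -/
def szegoD (σ : Measure UnitAddCircle) (z : ℂ) : ℂ :=
  Complex.exp (1 / 2 * ∫ x, (pt x + z) / (pt x - z) * (Real.log (density σ x) : ℂ) ∂m)

/-- `D_*(z)` is the complex conjugate of `D(1 / z̄)`, `|z| > 1`. -/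
def szegoDStar (σ : Measure UnitAddCircle) (z : ℂ) : ℂ := conj (szegoD σ (1 / conj z))

/-! ### The orthonormal Laurent polynomials -/

/-- The exponents `0, -1, 1, -2, 2, -3, …` of the system `1, t⁻¹, t, t⁻², t², t⁻³, …`. -/
def exponent (n : ℕ) : ℤ := if Even n then ((n / 2 : ℕ) : ℤ) else -(((n + 1) / 2 : ℕ) : ℤ)

/-- The system `1, t⁻¹, t, t⁻², t², t⁻³, …` in `L²(dσ)`. -/
def monomialSystem (σ : Measure UnitAddCircle) [IsFiniteMeasure σ] (n : ℕ) : Lp ℂ 2 σ :=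
  ContinuousMap.toLp 2 σ ℂ (fourier (exponent n))

/-- The orthonormal Laurent polynomials `P_n`, obtained by orthogonalization of the system
`1, t⁻¹, t, t⁻², …` in `L²(dσ)`; the leading coefficient of `P_n` (at `t ^ exponent n`) is positive
for even `n`, and is `-ā₋₁` times a positive number for odd `n`. -/
def laurentP (b : Circle) (σ : Measure UnitAddCircle) [IsFiniteMeasure σ] (n : ℕ) : Lp ℂ 2 σ :=
  (if Even n then (1 : ℂ) else -conj (b : ℂ)) •
    InnerProductSpace.gramSchmidtNormed ℂ (monomialSystem σ) n

/-! ### The scattering representation and the GLM transformation -/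

/-- `F₁(z; f) = D(z)⁻¹ ∫ t / (t - z) f(t) dσ(t)`, `|z| < 1`. -/
def scatF₁ (σ : Measure UnitAddCircle) (f : Lp ℂ 2 σ) (z : ℂ) : ℂ :=
  1 / szegoD σ z * ∫ x, pt x / (pt x - z) * f x ∂σ

/-- `F₂(z; f) = a₋₁ D_*(z)⁻¹ ∫ t / (t - z) f(t) dσ(t)`, `|z| > 1`. -/
def scatF₂ (b : Circle) (σ : Measure UnitAddCircle) (f : Lp ℂ 2 σ) (z : ℂ) : ℂ :=
  b / szegoDStar σ z * ∫ x, pt x / (pt x - z) * f x ∂σ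

/-- The function `F₂` near infinity in the variable `ζ = 1 / z`, with the value `F₂(∞) = 0`. -/
def scatF₂AtInfty (b : Circle) (σ : Measure UnitAddCircle) (f : Lp ℂ 2 σ) (ζ : ℂ) : ℂ :=
  if ζ = 0 then 0 else scatF₂ b σ f ζ⁻¹

/-- The `k`-th Taylor coefficient at `0`. -/
def taylorCoeff (F : ℂ → ℂ) (k : ℕ) : ℂ := iteratedDeriv k F 0 / (k.factorial : ℂ)

/-- The matrix `ℳ` of the Gelfand–Levitan–Marchenko transformation. With `𝔢_n = (F₁, F₂)` for
`f = P_n`, the column of index `n` lists the coefficients of `𝔢_n` in the system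
`(1, 0), (0, 1/z), (z, 0), (0, 1/z²), …`: the entry in row `2k` is the coefficient of `z ^ k`
in `F₁`, the entry in row `2k + 1` is the coefficient of `1 / z ^ (k + 1)` in `F₂`. -/
def glmMatrix (b : Circle) (σ : Measure UnitAddCircle) [IsFiniteMeasure σ] : Matrix ℕ ℕ ℂ :=
  fun i n =>
    if Even i then taylorCoeff (scatF₁ σ (laurentP b σ n)) (i / 2)
    else taylorCoeff (scatF₂AtInfty b σ (laurentP b σ n)) ((i + 1) / 2)

/-- The infinite matrix `A` generates a bounded operator in `ℓ²(ℤ₊)`. -/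
def GeneratesBoundedOperator (A : Matrix ℕ ℕ ℂ) : Prop :=
  ∃ T : Ell2 →L[ℂ] Ell2, ∀ i j, T (stdBasis j) i = A i j

/-! ### Riesz projections in the weighted space -/

/-- The measure `w⁻¹ dm`. -/
def invWeightMeasure (σ : Measure UnitAddCircle) : Measure UnitAddCircle :=
  m.withDensity fun x => (σ.rnDeriv m x)⁻¹

/-- The Fourier projection `∑ₙ ĝ(n) tⁿ ↦ ∑_{n ∈ S} ĝ(n) tⁿ` is a bounded operator in
`L²(w⁻¹ dm)`. (As `w` is integrable, functions in `L²(w⁻¹ dm)` are integrable with respect to `m`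
and have Fourier coefficients, which determine them.) -/
def FourierProjectionBounded (σ : Measure UnitAddCircle) (S : Set ℤ) : Prop :=
  ∃ T : Lp ℂ 2 (invWeightMeasure σ) →L[ℂ] Lp ℂ 2 (invWeightMeasure σ),
    ∀ (g : Lp ℂ 2 (invWeightMeasure σ)) (n : ℤ),
      (n ∈ S → fourierCoeff (T g : UnitAddCircle → ℂ) n = fourierCoeff (g : UnitAddCircle → ℂ) n) ∧
      (n ∉ S → fourierCoeff (T g : UnitAddCircle → ℂ) n = 0)

/-- The Riesz projection `P₊` (onto the frequencies `n ≥ 0`) is bounded in `L²(w⁻¹ dm)`. -/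
def RieszPlusBounded (σ : Measure UnitAddCircle) : Prop :=
  FourierProjectionBounded σ {n | 0 ≤ n}

/-- The Riesz projection `P₋` (onto the frequencies `n < 0`) is bounded in `L²(w⁻¹ dm)`. -/
def RieszMinusBounded (σ : Measure UnitAddCircle) : Prop :=
  FourierProjectionBounded σ {n | n < 0}

end CMV

end

/-!
Write `w` for the density of `σ` and `D` for its Szegő function.

*Szegő class.* The CMV operator is a product of two unitary operators with `2 × 2` blocks, and the
nonzero entry of `𝔄⁻ʲ e₀` of largest index has modulus `ρ₀ ⋯ ρ_{2j-2}`. As `∑ |a_k|² < ∞`, these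
products are bounded below, which gives `c |Q(0)|² ≤ ∫ |Q|² dσ` for all polynomials `Q`, with
`c > 0` (`exists_le_integral_norm_sq_eval`). Such an evaluation bound forces `w > 0` almost
everywhere and `log w ∈ L¹` (`IsEvalBound.ae_pos_and_integrable`): approximate exponentials of
trigonometric polynomials by squares `|Q|²`, then bounded functions by continuous ones. Hence `D`
is a nonvanishing analytic function, and it has boundary values `u` in the Hardy space `H²` with
`|u|² = w`, and `u` is outer (`exists_outer`).

*Hardy factors.* `D F₁` and `D_* F₂` are Cauchy integrals of `f dσ`. On the level of coefficients,
the GLM transformation of `f` divides by `u` the sequences of Fourier coefficients of `f dσ` of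
nonnegative and of negative index, that is, it finds `φ, ψ ∈ H²` such that `u φ` and the conjugate
of `u ψ` are the two parts of the Fourier series of `f dσ`. Since the `P_n` form an orthonormal
basis of `L²(dσ)`, boundedness of the matrix means that such `φ`, `ψ` exist for all `f ∈ L²(dσ)`,
with norms at most `C ‖f‖` (`HasHardyFactors`).

*Riesz projections.* Given Hardy factors for `f = 1`, the measure `σ` has the Fourier coefficients
of the integrable function `u φ` plus the conjugate of `u ψ`, so it is absolutely continuous
(`HasHardyFactors.absolutelyContinuous`). For `σ = w dm`, the map `f ↦ g = f w` is an isometry of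
`L²(w dm)` onto `L²(w⁻¹ dm)`, the function `P₊ g` is `u φ`, and `P₋ g` is the conjugate of `u ψ`;
as `|u|² = w`, the norms of `φ`, `ψ` in `L²(dm)` are the norms of `P₊ g`, `P₋ g` in `L²(w⁻¹ dm)`
(`HasHardyFactors.riesz`). Conversely, `P₊ g / u` belongs to `H²` because `u` is outer
(`IsOuter.isHardy_of_mul`, `hasHardyFactors_of_riesz`).
-/

noncomputable section

namespace CMV

/-! ### Unitarity of the CMV matrix -/

theorem rho_star (a : UnitDisc) : rho (star a) = rho a := by simp [rho]

theorem rho_mul_self (a : UnitDisc) : (rho a : ℂ) * rho a = 1 - a * conj (a : ℂ) := by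
  rw [← Complex.ofReal_mul, rho, Real.mul_self_sqrt (by nlinarith [a.norm_lt_one, norm_nonneg (a : ℂ)]),
    Complex.mul_conj, Complex.normSq_eq_norm_sq]
  push_cast; ring

theorem rho_pos (a : UnitDisc) : 0 < rho a :=
  Real.sqrt_pos.2 (by nlinarith [a.norm_lt_one, norm_nonneg (a : ℂ)])

@[simp] theorem factorZero_apply (a : ℕ → UnitDisc) (x : Ell2) (n : ℕ) :
    factorZero a x n = factorZeroFun a x n := rfl

@[simp] theorem factorOne_apply (b : Circle) (a : ℕ → UnitDisc) (x : Ell2) (n : ℕ) :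
    factorOne b a x n = factorOneFun b a x n := rfl

theorem stdBasis_apply (n i : ℕ) : stdBasis n i = if i = n then 1 else 0 := by
  simp [stdBasis, lp.single_apply, Pi.single_apply]

theorem inner_stdBasis (n : ℕ) (x : Ell2) : inner ℂ (stdBasis n) x = x n := by
  rw [stdBasis, lp.inner_single_left]; simp

theorem factorZero_star_comp (a : ℕ → UnitDisc) (x : Ell2) :
    factorZero (star a) (factorZero a x) = x := by
  ext n
  obtain ⟨k, rfl | rfl⟩ := n.even_or_odd'
  · have h := rho_mul_self (a (2 * k))
    simp [factorZeroFun, rho_star, parity_simps]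
    linear_combination (x (2 * k)) * h
  · have h := rho_mul_self (a (2 * k))
    simp [factorZeroFun, rho_star, parity_simps]
    linear_combination (x (2 * k + 1)) * h

theorem factorOne_star_comp (b : Circle) (a : ℕ → UnitDisc) (x : Ell2) :
    factorOne b⁻¹ (star a) (factorOne b a x) = x := by
  ext n
  rcases n with _ | n
  · have : (b : ℂ) * conj (b : ℂ) = 1 := by
      rw [Complex.mul_conj]; simp
    simp [factorOneFun, ← mul_assoc]
  obtain ⟨k, rfl | rfl⟩ := n.even_or_odd'
  · have h := rho_mul_self (a (2 * k + 1))
    simp [factorOneFun, rho_star, parity_simps]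
    linear_combination (x (2 * k + 1)) * h
  · have h := rho_mul_self (a (2 * k + 1))
    simp [factorOneFun, rho_star, parity_simps]
    linear_combination (x (2 * k + 1 + 1)) * h

theorem factorZero_inner (a : ℕ → UnitDisc) (x : Ell2) (n : ℕ) :
    inner ℂ (factorZero a (stdBasis n)) x = factorZero (star a) x n := by
  obtain ⟨k, rfl | rfl⟩ := n.even_or_odd'
  · have : factorZero a (stdBasis (2 * k)) =
      (a (2 * k) : ℂ) • stdBasis (2 * k) + (rho (a (2 * k)) : ℂ) • stdBasis (2 * k + 1) := by
      ext i
      simp only [factorZero_apply, factorZeroFun, stdBasis_apply, lp.coeFn_add, lp.coeFn_smul,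
        Pi.add_apply, Pi.smul_apply, smul_eq_mul]
      obtain ⟨l, rfl | rfl⟩ := i.even_or_odd' <;> simp [parity_simps] <;> grind
    rw [this, inner_add_left, inner_smul_left, inner_smul_left, inner_stdBasis, inner_stdBasis]
    simp [factorZeroFun, rho_star]
  · have : factorZero a (stdBasis (2 * k + 1)) =
      (rho (a (2 * k)) : ℂ) • stdBasis (2 * k) +
        (-conj (a (2 * k) : ℂ)) • stdBasis (2 * k + 1) := by
      ext i
      simp only [factorZero_apply, factorZeroFun, stdBasis_apply, lp.coeFn_add, lp.coeFn_smul,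
        Pi.add_apply, Pi.smul_apply, smul_eq_mul]
      obtain ⟨l, rfl | rfl⟩ := i.even_or_odd' <;> simp [parity_simps] <;> grind
    rw [this, inner_add_left, inner_smul_left, inner_smul_left, inner_stdBasis, inner_stdBasis]
    simp [factorZeroFun, rho_star, parity_simps, sub_eq_add_neg]

theorem factorOne_inner (b : Circle) (a : ℕ → UnitDisc) (x : Ell2) (n : ℕ) :
    inner ℂ (factorOne b a (stdBasis n)) x = factorOne b⁻¹ (star a) x n := by
  rcases n with _ | n
  · have : factorOne b a (stdBasis 0) = (-conj (b : ℂ)) • stdBasis 0 := by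
      ext i
      simp only [factorOne_apply, factorOneFun, stdBasis_apply, lp.coeFn_smul, Pi.smul_apply, smul_eq_mul]
      grind
    rw [this, inner_smul_left, inner_stdBasis]
    simp [factorOneFun, ← Circle.coe_inv_eq_conj]
  obtain ⟨k, rfl | rfl⟩ := n.even_or_odd'
  · have : factorOne b a (stdBasis (2 * k + 1)) =
      (a (2 * k + 1) : ℂ) • stdBasis (2 * k + 1) +
        (rho (a (2 * k + 1)) : ℂ) • stdBasis (2 * k + 2) := by
      ext i
      simp only [factorOne_apply, factorOneFun, stdBasis_apply, lp.coeFn_add, lp.coeFn_smul,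
        Pi.add_apply, Pi.smul_apply, smul_eq_mul]
      obtain ⟨l, rfl | rfl⟩ := i.even_or_odd' <;> simp [parity_simps] <;> grind
    rw [this, inner_add_left, inner_smul_left, inner_smul_left, inner_stdBasis, inner_stdBasis]
    simp [factorOneFun, rho_star, parity_simps]
  · have : factorOne b a (stdBasis (2 * k + 2)) =
      (rho (a (2 * k + 1)) : ℂ) • stdBasis (2 * k + 1) +
        (-conj (a (2 * k + 1) : ℂ)) • stdBasis (2 * k + 2) := by
      ext i
      simp only [factorOne_apply, factorOneFun, stdBasis_apply, lp.coeFn_add, lp.coeFn_smul,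
        Pi.add_apply, Pi.smul_apply, smul_eq_mul]
      obtain ⟨l, rfl | rfl⟩ := i.even_or_odd' <;> simp [parity_simps] <;> grind
    rw [this, inner_add_left, inner_smul_left, inner_smul_left, inner_stdBasis, inner_stdBasis]
    simp [factorOneFun, rho_star, parity_simps, sub_eq_add_neg]

theorem adjoint_factorZero (a : ℕ → UnitDisc) :
    ContinuousLinearMap.adjoint (factorZero a) = factorZero (star a) := by
  ext x n
  rw [← inner_stdBasis, ContinuousLinearMap.adjoint_inner_right, factorZero_inner]

theorem adjoint_factorOne (b : Circle) (a : ℕ → UnitDisc) :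
    ContinuousLinearMap.adjoint (factorOne b a) = factorOne b⁻¹ (star a) := by
  ext x n
  rw [← inner_stdBasis, ContinuousLinearMap.adjoint_inner_right, factorOne_inner]

theorem star_cmvOperator (b : Circle) (a : ℕ → UnitDisc) :
    star (cmvOperator b a) = factorZero (star a) ∘L factorOne b⁻¹ (star a) := by
  rw [ContinuousLinearMap.star_eq_adjoint, cmvOperator, ContinuousLinearMap.adjoint_comp,
    adjoint_factorZero, adjoint_factorOne]

theorem cmvOperator_mem_unitary (b : Circle) (a : ℕ → UnitDisc) :
    cmvOperator b a ∈ unitary (Ell2 →L[ℂ] Ell2) := by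
  rw [Unitary.mem_iff, star_cmvOperator]
  constructor
  · ext1 x
    simp [cmvOperator, factorOne_star_comp, factorZero_star_comp]
  · ext1 x
    have h0 := factorZero_star_comp (star a)
    have h1 := factorOne_star_comp b⁻¹ (star a)
    rw [star_star] at h0
    rw [star_star, inv_inv] at h1
    simp [cmvOperator, h0, h1]

/-! ### Taylor coefficients and Cauchy integrals -/

theorem hasSum_of_eq {ι α : Type*} [AddCommMonoid α] [TopologicalSpace α] {f g : ι → α} {s t : α}
    (h : HasSum f s) (hfg : ∀ n, g n = f n) (hst : t = s) : HasSum g t := by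
  rw [hst, funext hfg]
  exact h

theorem hasFPowerSeriesAt_of_hasSum {F : ℂ → ℂ} {c : ℕ → ℂ}
    (h : ∀ z, ‖z‖ < 1 → HasSum (fun n => c n * z ^ n) (F z)) :
    HasFPowerSeriesAt F (FormalMultilinearSeries.ofScalars ℂ c) 0 := by
  rw [hasFPowerSeriesAt_iff]
  filter_upwards [Metric.ball_mem_nhds (0 : ℂ) one_pos] with z hz
  have := h z (by simpa using hz)
  simpa [mul_comm] using this

theorem taylorCoeff_eq_of_hasFPowerSeriesAt {F : ℂ → ℂ} {p : FormalMultilinearSeries ℂ ℂ ℂ}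
    (h : HasFPowerSeriesAt F p 0) (n : ℕ) : taylorCoeff F n = p.coeff n := by
  have h1 := h.eq_formalMultilinearSeries h.analyticAt.hasFPowerSeriesAt
  rw [h1, taylorCoeff]
  simp [div_eq_mul_inv, mul_comm]

theorem taylorCoeff_eq_of_hasSum {F : ℂ → ℂ} {c : ℕ → ℂ}
    (h : ∀ z, ‖z‖ < 1 → HasSum (fun n => c n * z ^ n) (F z)) (n : ℕ) : taylorCoeff F n = c n := by
  rw [taylorCoeff_eq_of_hasFPowerSeriesAt (hasFPowerSeriesAt_of_hasSum h)]
  simp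

theorem analyticAt_of_hasSum {F : ℂ → ℂ} {c : ℕ → ℂ}
    (h : ∀ z, ‖z‖ < 1 → HasSum (fun n => c n * z ^ n) (F z)) : AnalyticAt ℂ F 0 :=
  (hasFPowerSeriesAt_of_hasSum h).analyticAt

theorem taylorCoeff_mul {F G : ℂ → ℂ} (hF : AnalyticAt ℂ F 0) (hG : AnalyticAt ℂ G 0) (n : ℕ) :
    taylorCoeff (fun z => F z * G z) n =
      ∑ p ∈ Finset.HasAntidiagonal.antidiagonal n, taylorCoeff F p.1 * taylorCoeff G p.2 := by
  rw [taylorCoeff, iteratedDeriv_fun_mul hF.contDiffAt hG.contDiffAt,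
    Finset.Nat.sum_antidiagonal_eq_sum_range_succ (fun i j => taylorCoeff F i * taylorCoeff G j),
    Finset.sum_div]
  refine Finset.sum_congr rfl fun i hi => ?_
  have hi' : i ≤ n := Finset.mem_range_succ_iff.1 hi
  rw [taylorCoeff, taylorCoeff, Nat.cast_choose ℂ hi']
  have := Nat.factorial_ne_zero
  field_simp [this]

theorem norm_pt (x : UnitAddCircle) : ‖pt x‖ = 1 := Circle.norm_coe _

theorem pt_ne_zero (x : UnitAddCircle) : pt x ≠ 0 := by simp [pt]

theorem continuous_pt : Continuous pt :=
  continuous_subtype_val.comp continuous_toCircle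

theorem fourier_eq_pt_zpow (n : ℤ) (x : UnitAddCircle) : fourier n x = pt x ^ n := by
  rw [fourier_apply, toCircle_zsmul]; simp [pt]

theorem fourier_eq_pt_pow (n : ℕ) (x : UnitAddCircle) : fourier (n : ℤ) x = pt x ^ n := by
  rw [fourier_eq_pt_zpow, zpow_natCast]

theorem fourier_neg_eq_inv_pt_pow (n : ℕ) (x : UnitAddCircle) :
    fourier (-n : ℤ) x = (pt x)⁻¹ ^ n := by
  rw [fourier_eq_pt_zpow, zpow_neg, zpow_natCast, inv_pow]

theorem conj_pt (x : UnitAddCircle) : conj (pt x) = (pt x)⁻¹ := by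
  rw [Complex.inv_def, Complex.normSq_eq_norm_sq, norm_pt]; simp

/-- The `n`-th Fourier coefficient `∫ t⁻ⁿ f(t) dμ(t)` of the complex measure `f dμ`. -/
def measureCoeff (μ : Measure UnitAddCircle) (f : UnitAddCircle → ℂ) (n : ℤ) : ℂ :=
  ∫ x, fourier (-n) x * f x ∂μ

theorem measureCoeff_haar (f : UnitAddCircle → ℂ) (n : ℤ) :
    measureCoeff m f n = fourierCoeff f n := rfl

theorem integrable_fourier_mul {μ : Measure UnitAddCircle} {f : UnitAddCircle → ℂ}
    (hf : Integrable f μ) (n : ℤ) : Integrable (fun x => fourier n x * f x) μ := by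
  refine hf.bdd_mul (c := 1) (fourier n).continuous.aestronglyMeasurable ?_
  exact Filter.Eventually.of_forall fun x => by rw [fourier_eq_pt_zpow, norm_zpow, norm_pt, one_zpow]

/-- The geometric series, integrated termwise against the complex measure `f dμ`. -/
theorem hasSum_integral_geometric {μ : Measure UnitAddCircle} {f : UnitAddCircle → ℂ}
    (hf : Integrable f μ) {z : ℂ} (hz : ‖z‖ < 1) (e : ℕ → ℤ)
    (g : UnitAddCircle → ℂ) (hg : ∀ x, HasSum (fun n => fourier (e n) x * z ^ n) (g x)) :
    HasSum (fun n : ℕ => (∫ x, fourier (e n) x * f x ∂μ) * z ^ n) (∫ x, g x * f x ∂μ) := by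
  have hint : ∀ n : ℕ, Integrable (fun x => fourier (e n) x * f x * z ^ n) μ :=
    fun n => (integrable_fourier_mul hf _).mul_const _
  have hn : ∀ n : ℕ, ∫ x, ‖fourier (e n) x * f x * z ^ n‖ ∂μ = (∫ x, ‖f x‖ ∂μ) * ‖z‖ ^ n := by
    intro n
    rw [← integral_mul_const]
    refine integral_congr_ae (Filter.Eventually.of_forall fun x => ?_)
    simp only [norm_mul, norm_pow, fourier_eq_pt_zpow, norm_zpow, norm_pt, one_zpow, one_mul]
  have := hasSum_integral_of_summable_integral_norm hint (by
    simp only [hn]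
    exact (summable_geometric_of_lt_one (norm_nonneg z) hz).mul_left _)
  simp only [integral_mul_const] at this
  refine hasSum_of_eq this (fun n => rfl) ?_
  refine integral_congr_ae (Filter.Eventually.of_forall fun x => ?_)
  have h2 := ((hg x).mul_right (f x)).tsum_eq
  simp only at h2 ⊢
  rw [← h2]
  exact tsum_congr fun n => by ring

theorem hasSum_cauchy_kernel (x : UnitAddCircle) {z : ℂ} (hz : ‖z‖ < 1) :
    HasSum (fun n : ℕ => fourier (-n : ℤ) x * z ^ n) (pt x / (pt x - z)) := by
  have hlt : ‖(pt x)⁻¹ * z‖ < 1 := by rwa [norm_mul, norm_inv, norm_pt, inv_one, one_mul]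
  have h := hasSum_geometric_of_norm_lt_one hlt
  refine hasSum_of_eq h (fun n => ?_) ?_
  · rw [fourier_neg_eq_inv_pt_pow, mul_pow]
  · have h0 := pt_ne_zero x
    rw [← inv_div, sub_div, div_self h0, inv_mul_eq_div]

theorem hasSum_cauchy {μ : Measure UnitAddCircle} {f : UnitAddCircle → ℂ}
    (hf : Integrable f μ) {z : ℂ} (hz : ‖z‖ < 1) :
    HasSum (fun n : ℕ => measureCoeff μ f n * z ^ n) (∫ x, pt x / (pt x - z) * f x ∂μ) :=
  hasSum_integral_geometric hf hz _ _ fun x => hasSum_cauchy_kernel x hz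

/-- Cauchy integral at the exterior point `1 / z`. -/
theorem hasSum_cauchy_exterior {μ : Measure UnitAddCircle} {f : UnitAddCircle → ℂ}
    (hf : Integrable f μ) {z : ℂ} (hz : ‖z‖ < 1) (hz0 : z ≠ 0) :
    HasSum (fun n : ℕ => (if n = 0 then 0 else -measureCoeff μ f (-n : ℤ)) * z ^ n)
      (∫ x, pt x / (pt x - z⁻¹) * f x ∂μ) := by
  have hx : ∀ x, HasSum (fun n : ℕ => fourier (n : ℤ) x * z ^ n) (1 / (1 - pt x * z)) := by
    intro x
    have hlt : ‖pt x * z‖ < 1 := by rwa [norm_mul, norm_pt, one_mul]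
    have h := hasSum_geometric_of_norm_lt_one hlt
    refine hasSum_of_eq h (fun n => ?_) ?_
    · rw [fourier_eq_pt_pow, mul_pow]
    · rw [one_div]
  have h1 := (hasSum_integral_geometric hf hz _ _ hx).neg
  have h2 := h1.update 0 0
  have hne : ∀ x, 1 - pt x * z ≠ 0 := by
    intro x hx0
    have : ‖pt x * z‖ < 1 := by rwa [norm_mul, norm_pt, one_mul]
    rw [← sub_eq_zero.1 hx0] at this
    simp at this
  have hi : Integrable (fun x => 1 / (1 - pt x * z) * f x) μ := by
    refine hf.bdd_mul (c := (1 - ‖z‖)⁻¹) ?_ (Filter.Eventually.of_forall fun x => ?_)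
    · refine Continuous.aestronglyMeasurable ?_
      exact continuous_const.div (continuous_const.sub (continuous_pt.mul continuous_const)) hne
    · rw [norm_div, norm_one, one_div]
      refine inv_anti₀ (by linarith) ?_
      calc 1 - ‖z‖ = ‖(1 : ℂ)‖ - ‖pt x * z‖ := by rw [norm_mul, norm_pt, one_mul, norm_one]
        _ ≤ _ := norm_sub_norm_le _ _
  refine hasSum_of_eq h2 (fun n => ?_) ?_
  · rcases n with _ | n
    · simp
    · rw [Function.update_of_ne (by omega), if_neg (by omega), measureCoeff, neg_neg, neg_mul]
  · simp only [CharP.cast_eq_zero, fourier_zero, one_mul, pow_zero, mul_one, zero_sub, neg_neg]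
    rw [← sub_eq_add_neg, ← integral_sub hf hi]
    refine integral_congr_ae (Filter.Eventually.of_forall fun x => ?_)
    have h3 : pt x - z⁻¹ ≠ 0 := by
      intro h0
      apply hne x
      rw [sub_eq_zero.1 h0, inv_mul_cancel₀ hz0, sub_self]
    have := hne x
    have e : pt x / (pt x - z⁻¹) = 1 - 1 / (1 - pt x * z) := by
      have e1 : pt x - z⁻¹ = -((1 - pt x * z) / z) := by field_simp; ring
      rw [e1]
      field_simp
      ring
    simp only [e]
    ring

/-! ### A lower bound for polynomials in the CMV matrix -/

theorem factorZero_eq_zero {a : ℕ → UnitDisc} {x : Ell2} {N : ℕ} (hx : ∀ i, N ≤ i → x i = 0)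
    {i : ℕ} (hi : N + 1 ≤ i) : factorZero a x i = 0 := by
  have := factorZeroFun_bound a x i
  rw [hx (i - 1) (by omega), hx i (by omega), hx (i + 1) (by omega)] at this
  simpa using this

theorem factorOne_eq_zero {b : Circle} {a : ℕ → UnitDisc} {x : Ell2} {N : ℕ}
    (hx : ∀ i, N ≤ i → x i = 0) {i : ℕ} (hi : N + 1 ≤ i) : factorOne b a x i = 0 := by
  have := factorOneFun_bound b a x i
  rw [hx (i - 1) (by omega), hx i (by omega), hx (i + 1) (by omega)] at this
  simpa using this

/-- `U⁻ʲ⁻¹ e₀` lies in the span of `e₀, …, e_{2j+1}`, and its last coordinate is `ρ₀ ⋯ ρ_{2j}` up to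
a unimodular factor. -/
theorem inv_cmvOperator_pow_stdBasis (b : Circle) (a : ℕ → UnitDisc) (j : ℕ) :
    (∀ i, 2 * j + 2 ≤ i → (star (cmvOperator b a) ^ (j + 1)) (stdBasis 0) i = 0) ∧
      ‖(star (cmvOperator b a) ^ (j + 1)) (stdBasis 0) (2 * j + 1)‖ =
        ∏ i ∈ Finset.range (2 * j + 1), rho (a i) := by
  induction j with
  | zero =>
    have h1 : factorOne b⁻¹ (star a) (stdBasis 0) = (-(b : ℂ)) • stdBasis 0 := by
      ext i
      simp only [factorOne_apply, factorOneFun, stdBasis_apply, lp.coeFn_smul, Pi.smul_apply,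
        smul_eq_mul]
      obtain ⟨l, rfl | rfl⟩ := i.even_or_odd' <;>
        simp [parity_simps, ← Circle.coe_inv_eq_conj] <;> grind
    have h2 : ∀ i, 1 ≤ i → ((-(b : ℂ)) • stdBasis 0 : Ell2) i = 0 := fun i hi => by
      rw [lp.coeFn_smul, Pi.smul_apply, stdBasis_apply, if_neg (by omega), smul_zero]
    rw [star_cmvOperator, zero_add, pow_one, ContinuousLinearMap.comp_apply, h1]
    refine ⟨fun i hi => factorZero_eq_zero h2 hi, ?_⟩
    have h3 : ((-(b : ℂ)) • stdBasis 0 : Ell2) 0 = -(b : ℂ) := by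
      rw [lp.coeFn_smul, Pi.smul_apply, stdBasis_apply, if_pos rfl, smul_eq_mul, mul_one]
    rw [factorZero_apply, factorZeroFun, if_neg (by decide), h2 _ le_rfl,
      show 2 * 0 + 1 - 1 = 0 from rfl, h3]
    simp [rho_star, abs_of_pos (rho_pos _), Circle.norm_coe]
  | succ j ih =>
    obtain ⟨ih1, ih2⟩ := ih
    rw [pow_succ' _ (j + 1), mul_apply_eq_comp]
    set x := (star (cmvOperator b a) ^ (j + 1)) (stdBasis 0)
    rw [star_cmvOperator, ContinuousLinearMap.comp_apply]
    have hy : ∀ i, 2 * j + 3 ≤ i → factorOne b⁻¹ (star a) x i = 0 :=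
      fun i hi => factorOne_eq_zero ih1 hi
    refine ⟨fun i hi => factorZero_eq_zero hy hi, ?_⟩
    have e1 : factorZero (star a) (factorOne b⁻¹ (star a) x) (2 * (j + 1) + 1) =
        rho (a (2 * j + 2)) * (rho (a (2 * j + 1)) * x (2 * j + 1)) := by
      rw [factorZero_apply, factorZeroFun, if_neg (by simp [parity_simps]),
        hy (2 * (j + 1) + 1) (by omega)]
      have e2 : factorOne b⁻¹ (star a) x (2 * j + 2) = rho (a (2 * j + 1)) * x (2 * j + 1) := by
        rw [factorOne_apply, factorOneFun, if_neg (by omega), if_neg (by simp [parity_simps]),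
          ih1 _ le_rfl]
        simp [rho_star]
      have : 2 * (j + 1) + 1 - 1 = 2 * j + 2 := by omega
      rw [this, e2]
      simp [rho_star]
    rw [e1, norm_mul, norm_mul, ih2, show 2 * (j + 1) + 1 = 2 * j + 1 + 1 + 1 by ring,
      Finset.prod_range_succ _ (2 * j + 1 + 1), Finset.prod_range_succ _ (2 * j + 1)]
    simp only [Complex.norm_real, Real.norm_of_nonneg (rho_pos _).le]
    ring

/-- In the Szegő class the products `ρ₀ ⋯ ρₙ` are bounded away from zero. -/
theorem exists_prod_rho_lower_bound {a : ℕ → UnitDisc} (ha : IsSzego a) :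
    ∃ c : ℝ, 0 < c ∧ ∀ n, c ≤ ∏ i ∈ Finset.range n, rho (a i) := by
  have h1 : Summable fun i => Real.log (1 + -‖(a i : ℂ)‖ ^ 2) :=
    Real.summable_log_one_add_of_summable ha.neg
  have hpos : ∀ i, 0 < 1 - ‖(a i : ℂ)‖ ^ 2 := fun i => by
    nlinarith [(a i).norm_lt_one, norm_nonneg (a i : ℂ)]
  have h2 : ∀ i, Real.log (rho (a i)) = Real.log (1 + -‖(a i : ℂ)‖ ^ 2) / 2 := fun i => by
    rw [rho, Real.log_sqrt (hpos i).le, sub_eq_add_neg]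
  have h3 : Summable fun i => -Real.log (rho (a i)) := by
    simp only [h2]; exact (h1.div_const 2).neg
  have h4 : ∀ i, 0 ≤ -Real.log (rho (a i)) := fun i => by
    have h := norm_rho_le (a i)
    rw [Complex.norm_real, Real.norm_of_nonneg (rho_pos _).le] at h
    have := Real.log_nonpos (rho_pos (a i)).le h
    linarith
  refine ⟨Real.exp (-∑' i, -Real.log (rho (a i))), Real.exp_pos _, fun n => ?_⟩
  have h5 := h3.sum_le_tsum (Finset.range n) (fun i _ => h4 i)
  rw [Finset.sum_neg_distrib] at h5
  calc _ ≤ Real.exp (∑ i ∈ Finset.range n, Real.log (rho (a i))) :=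
        Real.exp_le_exp.2 (by linarith)
    _ = _ := by
      rw [Real.exp_sum]
      exact Finset.prod_congr rfl fun i _ => Real.exp_log (rho_pos _)

theorem star_mul_pow {A : Type*} [Monoid A] [StarMul A] {u : A} (hu : u ∈ unitary A) (n i : ℕ) :
    star u ^ (n + i) * u ^ i = star u ^ n := by
  induction i with
  | zero => simp
  | succ i ih =>
    rw [← add_assoc, pow_succ (star u) (n + i), pow_succ' u i, mul_assoc, ← mul_assoc (star u) u,
      Unitary.star_mul_self_of_mem hu, one_mul, ih]

theorem norm_apply_of_mem_unitary {u : Ell2 →L[ℂ] Ell2} (hu : u ∈ unitary (Ell2 →L[ℂ] Ell2))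
    (x : Ell2) : ‖u x‖ = ‖x‖ := by
  have : inner ℂ (u x) (u x) = inner ℂ x x := by
    rw [← ContinuousLinearMap.adjoint_inner_right, ← ContinuousLinearMap.star_eq_adjoint,
      ← mul_apply_eq_comp, Unitary.star_mul_self_of_mem hu,
      one_apply_eq_self]
  rw [inner_self_eq_norm_sq_to_K, inner_self_eq_norm_sq_to_K] at this
  have h2 : ‖u x‖ ^ 2 = ‖x‖ ^ 2 := by exact_mod_cast this
  exact (sq_eq_sq₀ (norm_nonneg _) (norm_nonneg _)).1 h2

/-- Applying `U⁻ʲ` with `j` larger than the degree, only the constant term of `Q` contributes to the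
coordinate `2j - 1`. -/
theorem norm_aeval_cmvOperator_ge (b : Circle) (a : ℕ → UnitDisc) (Q : Polynomial ℂ) :
    ∃ n, ‖Q.coeff 0‖ * ∏ i ∈ Finset.range n, rho (a i) ≤
      ‖(Polynomial.aeval (cmvOperator b a) Q) (stdBasis 0)‖ := by
  set U := cmvOperator b a
  have hU : U ∈ unitary (Ell2 →L[ℂ] Ell2) := cmvOperator_mem_unitary b a
  set N := Q.natDegree
  refine ⟨2 * N + 1, ?_⟩
  have hV : star U ^ (N + 1) ∈ unitary (Ell2 →L[ℂ] Ell2) := pow_mem (Unitary.star_mem hU) _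
  rw [← norm_apply_of_mem_unitary hV, ← mul_apply_eq_comp,
    Polynomial.aeval_eq_sum_range, Finset.mul_sum]
  refine le_trans (le_of_eq ?_) (lp.norm_apply_le_norm (by norm_num) _ (2 * N + 1))
  rw [sum_apply, lp.coeFn_sum, Finset.sum_apply, Finset.sum_range_succ',
    Finset.sum_eq_zero, zero_add, pow_zero, mul_smul_comm, mul_one,
    smul_apply, lp.coeFn_smul, Pi.smul_apply, norm_smul,
    (inv_cmvOperator_pow_stdBasis b a N).2]
  intro i hi
  have hi' : i < N := Finset.mem_range.1 hi
  obtain ⟨k, hk⟩ : ∃ k, N = k + i + 1 := ⟨N - i - 1, by omega⟩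
  have e : star U ^ (N + 1) * U ^ (i + 1) = star U ^ (k + 1) := by
    rw [← star_mul_pow hU (k + 1) (i + 1)]
    congr 2; omega
  rw [mul_smul_comm, e, smul_apply, lp.coeFn_smul, Pi.smul_apply,
    (inv_cmvOperator_pow_stdBasis b a k).1 _ (by omega), smul_zero]

/-! ### Moments of the spectral measure -/

theorem measureCoeff_of_isSpectralMeasure {U : Ell2 →L[ℂ] Ell2}
    (hU : U ∈ unitary (Ell2 →L[ℂ] Ell2)) {v : Ell2} (hv : ‖v‖ = 1) {σ : Measure UnitAddCircle}
    [IsProbabilityMeasure σ] (hσ : IsSpectralMeasure U v σ) (n : ℕ) :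
    measureCoeff σ 1 n = inner ℂ v ((star U ^ n) v) := by
  have hleft : ∀ z : ℂ, ‖z‖ < 1 → HasSum (fun n : ℕ => measureCoeff σ 1 n * z ^ n)
      ((∫ x, (pt x + z) / (pt x - z) ∂σ + 1) / 2) := by
    intro z hz
    have h1 : Integrable (1 : UnitAddCircle → ℂ) σ := integrable_const 1
    have hne : ∀ x, pt x - z ≠ 0 := fun x h => by
      rw [← sub_eq_zero.1 h, norm_pt] at hz
      exact lt_irrefl _ hz
    have hi : Integrable (fun x => (pt x + z) / (pt x - z)) σ := by
      refine Continuous.integrable_of_hasCompactSupport ?_ (HasCompactSupport.of_compactSpace _)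
      exact (continuous_pt.add continuous_const).div (continuous_pt.sub continuous_const) hne
    refine hasSum_of_eq (hasSum_cauchy h1 hz) (fun n => rfl) ?_
    have e : ∫ x, ((pt x + z) / (pt x - z) + 1) ∂σ = ∫ x, (pt x + z) / (pt x - z) ∂σ + 1 := by
      rw [integral_add hi (integrable_const 1)]; simp
    rw [← e, ← integral_div]
    refine integral_congr_ae (Filter.Eventually.of_forall fun x => ?_)
    have := hne x
    simp only [Pi.one_apply]
    field_simp
    ring
  have hright : ∀ z : ℂ, ‖z‖ < 1 → HasSum (fun n : ℕ => inner ℂ v ((star U ^ n) v) * z ^ n)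
      ((∫ x, (pt x + z) / (pt x - z) ∂σ + 1) / 2) := by
    intro z hz
    have hVn : ‖z • star U‖ < 1 := by
      have hle : ‖star U‖ ≤ 1 := ContinuousLinearMap.opNorm_le_bound _ zero_le_one fun x => by
        rw [norm_apply_of_mem_unitary (Unitary.star_mem hU), one_mul]
      rw [norm_smul]
      calc ‖z‖ * ‖star U‖ ≤ ‖z‖ * 1 := by gcongr
        _ < 1 := by linarith
    set S : Ell2 →L[ℂ] Ell2 := ∑' n : ℕ, (z • star U) ^ n
    have hsum : HasSum (fun n : ℕ => (z • star U) ^ n) S :=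
      (summable_geometric_of_norm_lt_one hVn).hasSum
    have hS1 : S * (1 - z • star U) = 1 := geom_series_mul_neg _ hVn
    have hS2 : (1 - z • star U) * S = 1 := mul_neg_geom_series _ hVn
    have hUU : star U * U = 1 := Unitary.star_mul_self_of_mem hU
    have hUU' : U * star U = 1 := Unitary.mul_star_self_of_mem hU
    have hfac : U - z • 1 = (1 - z • star U) * U := by
      rw [sub_mul, one_mul, smul_mul_assoc, hUU]
    have hinv : Ring.inverse (U - z • 1) = star U * S := by
      let w : (Ell2 →L[ℂ] Ell2)ˣ := ⟨U - z • 1, star U * S, by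
        rw [hfac, mul_assoc, ← mul_assoc U, hUU', one_mul, hS2], by
        rw [hfac, mul_assoc, ← mul_assoc S, hS1, one_mul, hUU]⟩
      exact Ring.inverse_unit w
    have hprod : (U + z • 1) * Ring.inverse (U - z • 1) = S + S - 1 := by
      rw [hinv, ← mul_assoc, add_mul, hUU', smul_mul_assoc, one_mul, add_mul, one_mul]
      rw [sub_mul, one_mul] at hS2
      rw [← hS2]; abel
    have hval : inner ℂ v (S v) = (∫ x, (pt x + z) / (pt x - z) ∂σ + 1) / 2 := by
      rw [hσ z hz, hprod, sub_apply, add_apply,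
        one_apply_eq_self, inner_sub_right, inner_add_right,
        inner_self_eq_norm_sq_to_K, hv]
      simp
    have h3 := (hsum.mapL (ContinuousLinearMap.apply ℂ Ell2 v)).mapL (innerSL ℂ v)
    refine hasSum_of_eq h3 (fun n => ?_) hval.symm
    simp [smul_pow, mul_comm]
  rw [← taylorCoeff_eq_of_hasSum hleft, taylorCoeff_eq_of_hasSum hright]

theorem measureCoeff_neg_one (σ : Measure UnitAddCircle) (n : ℤ) :
    measureCoeff σ 1 (-n) = conj (measureCoeff σ 1 n) := by
  simp only [measureCoeff, Pi.one_apply, mul_one, ← integral_conj, neg_neg]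
  refine integral_congr_ae (Filter.Eventually.of_forall fun x => ?_)
  simp only
  rw [← fourier_neg, neg_neg]

theorem inner_pow_eq_measureCoeff {U : Ell2 →L[ℂ] Ell2}
    (hU : U ∈ unitary (Ell2 →L[ℂ] Ell2)) {v : Ell2} (hv : ‖v‖ = 1) {σ : Measure UnitAddCircle}
    [IsProbabilityMeasure σ] (hσ : IsSpectralMeasure U v σ) (i j : ℕ) :
    inner ℂ ((U ^ i) v) ((U ^ j) v) = measureCoeff σ 1 ((i : ℤ) - j) := by
  have key : ∀ i k : ℕ, inner ℂ ((U ^ (k + i)) v) ((U ^ i) v) = measureCoeff σ 1 k := by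
    intro i k
    rw [← ContinuousLinearMap.adjoint_inner_right, ← ContinuousLinearMap.star_eq_adjoint, star_pow,
      ← mul_apply_eq_comp, star_mul_pow hU,
      measureCoeff_of_isSpectralMeasure hU hv hσ]
  rcases le_total j i with h | h
  · obtain ⟨k, rfl⟩ := Nat.exists_eq_add_of_le' h
    rw [key]; congr 1; push_cast; ring
  · obtain ⟨k, rfl⟩ := Nat.exists_eq_add_of_le' h
    rw [← inner_conj_symm, key, ← measureCoeff_neg_one]; congr 1; push_cast; ring

theorem norm_aeval_sq_eq_integral {U : Ell2 →L[ℂ] Ell2}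
    (hU : U ∈ unitary (Ell2 →L[ℂ] Ell2)) {v : Ell2} (hv : ‖v‖ = 1) {σ : Measure UnitAddCircle}
    [IsProbabilityMeasure σ] (hσ : IsSpectralMeasure U v σ) (Q : Polynomial ℂ) :
    ‖(Polynomial.aeval U Q) v‖ ^ 2 = ∫ x, ‖Q.eval (pt x)‖ ^ 2 ∂σ := by
  have h1 : ((‖(Polynomial.aeval U Q) v‖ ^ 2 : ℝ) : ℂ) = ((∫ x, ‖Q.eval (pt x)‖ ^ 2 ∂σ : ℝ) : ℂ) := by
    rw [← integral_complex_ofReal]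
    have e : ∀ x, ((‖Q.eval (pt x)‖ ^ 2 : ℝ) : ℂ) = ∑ i ∈ Finset.range (Q.natDegree + 1),
        ∑ j ∈ Finset.range (Q.natDegree + 1),
          conj (Q.coeff i) * Q.coeff j * (fourier (-((i : ℤ) - j)) x * (1 : UnitAddCircle → ℂ) x) := by
      intro x
      rw [← Complex.normSq_eq_norm_sq, Complex.normSq_eq_conj_mul_self,
        Polynomial.eval_eq_sum_range, map_sum, Finset.sum_mul_sum]
      refine Finset.sum_congr rfl fun i _ => Finset.sum_congr rfl fun j _ => ?_
      rw [map_mul, map_pow, conj_pt, neg_sub, sub_eq_neg_add, fourier_add,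
        fourier_neg_eq_inv_pt_pow, fourier_eq_pt_pow, Pi.one_apply]
      ring
    have hi : ∀ i j : ℕ, Integrable (fun x => conj (Q.coeff i) * Q.coeff j *
        (fourier (-((i : ℤ) - j)) x * (1 : UnitAddCircle → ℂ) x)) σ :=
      fun i j => (integrable_fourier_mul (integrable_const 1) _).const_mul _
    simp only [e]
    rw [integral_finsetSum _ fun i _ => integrable_finsetSum _ fun j _ => hi i j]
    simp_rw [integral_finsetSum _ fun j _ => hi _ j, integral_const_mul]
    have e2 : ((‖(Polynomial.aeval U Q) v‖ ^ 2 : ℝ) : ℂ) =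
        inner ℂ ((Polynomial.aeval U Q) v) ((Polynomial.aeval U Q) v) := by
      rw [inner_self_eq_norm_sq_to_K]; push_cast; rfl
    rw [e2, Polynomial.aeval_eq_sum_range, sum_apply, sum_inner]
    refine Finset.sum_congr rfl fun i _ => ?_
    rw [inner_sum]
    refine Finset.sum_congr rfl fun j _ => ?_
    rw [smul_apply, smul_apply, inner_smul_left,
      inner_smul_right, inner_pow_eq_measureCoeff hU hv hσ, measureCoeff, mul_assoc]
  exact_mod_cast h1

theorem norm_stdBasis (n : ℕ) : ‖stdBasis n‖ = 1 := by
  rw [stdBasis, lp.norm_single (by norm_num)]; simp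

/-- For the spectral measure of a CMV matrix in the Szegő class, evaluation of polynomials at the
origin is bounded in the norm of `L²(σ)`. -/
theorem exists_le_integral_norm_sq_eval {b : Circle} {a : ℕ → UnitDisc} (ha : IsSzego a)
    {σ : Measure UnitAddCircle} [IsProbabilityMeasure σ]
    (hσ : IsSpectralMeasure (cmvOperator b a) (stdBasis 0) σ) :
    ∃ c : ℝ, 0 < c ∧ ∀ Q : Polynomial ℂ, c * ‖Q.eval 0‖ ^ 2 ≤ ∫ x, ‖Q.eval (pt x)‖ ^ 2 ∂σ := by
  obtain ⟨c, hc, hprod⟩ := exists_prod_rho_lower_bound ha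
  refine ⟨c ^ 2, by positivity, fun Q => ?_⟩
  obtain ⟨n, hn⟩ := norm_aeval_cmvOperator_ge b a Q
  rw [← norm_aeval_sq_eq_integral (cmvOperator_mem_unitary b a) (norm_stdBasis 0) hσ,
    ← Polynomial.coeff_zero_eq_eval_zero, ← mul_pow]
  gcongr
  refine le_trans ?_ hn
  rw [mul_comm]
  exact mul_le_mul_of_nonneg_left (hprod n) (norm_nonneg _)

/-! ### Szegő's inequality -/

/-- Evaluation of polynomials at the origin is bounded in `L²(μ)`: `c |Q(0)|² ≤ ‖Q‖²`. -/
def IsEvalBound (μ : Measure UnitAddCircle) (c : ℝ) : Prop :=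
  ∀ Q : Polynomial ℂ, c * ‖Q.eval 0‖ ^ 2 ≤ ∫ x, ‖Q.eval (pt x)‖ ^ 2 ∂μ

theorem continuous_eval_pt (Q : Polynomial ℂ) : Continuous fun x => Q.eval (pt x) :=
  Q.continuous.comp continuous_pt

theorem exists_norm_eval_pt_le (Q : Polynomial ℂ) : ∃ M, ∀ x, ‖Q.eval (pt x)‖ ≤ M := by
  obtain ⟨M, hM⟩ := isCompact_univ.exists_bound_of_continuousOn (continuous_eval_pt Q).continuousOn
  exact ⟨M, fun x => hM x (Set.mem_univ x)⟩

theorem integrable_of_continuous {E : Type*} [NormedAddCommGroup E] {μ : Measure UnitAddCircle}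
    [IsFiniteMeasure μ] {f : UnitAddCircle → E} (hf : Continuous f) : Integrable f μ :=
  hf.integrable_of_hasCompactSupport (HasCompactSupport.of_compactSpace _)

/-- The evaluation bound extends from polynomials `Q` to the entire functions `exp q`. -/
theorem IsEvalBound.exp_polynomial {μ : Measure UnitAddCircle} [IsFiniteMeasure μ] {c : ℝ}
    (h : IsEvalBound μ c) (q : Polynomial ℂ) :
    c * Real.exp (2 * (q.eval 0).re) ≤ ∫ x, Real.exp (2 * (q.eval (pt x)).re) ∂μ := by
  let Q : ℕ → Polynomial ℂ := fun N =>
    ∑ j ∈ Finset.range N, Polynomial.C ((j.factorial : ℂ)⁻¹) * q ^ j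
  have hQ : ∀ N z, (Q N).eval z = ∑ j ∈ Finset.range N, (q.eval z) ^ j / (j.factorial : ℂ) := by
    intro N z
    simp [Q, Polynomial.eval_finsetSum, div_eq_inv_mul]
  have hlim : ∀ z, Filter.Tendsto (fun N => ‖(Q N).eval z‖ ^ 2) Filter.atTop
      (nhds (Real.exp (2 * (q.eval z).re))) := by
    intro z
    have h1 : HasSum (fun j : ℕ => (q.eval z) ^ j / (j.factorial : ℂ)) (Complex.exp (q.eval z)) := by
      rw [Complex.exp_eq_exp_ℂ]
      exact NormedSpace.expSeries_div_hasSum_exp (q.eval z)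
    have h2 := (h1.tendsto_sum_nat.norm).pow 2
    rw [Complex.norm_exp, ← Real.exp_nat_mul] at h2
    simp only [hQ]
    exact_mod_cast h2
  obtain ⟨M, hM⟩ := exists_norm_eval_pt_le q
  have hbd : ∀ N x, ‖(Q N).eval (pt x)‖ ≤ Real.exp M := by
    intro N x
    rw [hQ]
    calc _ ≤ ∑ j ∈ Finset.range N, ‖q.eval (pt x)‖ ^ j / (j.factorial : ℝ) := by
          refine (norm_sum_le _ _).trans (Finset.sum_le_sum fun j _ => ?_)
          simp
      _ ≤ Real.exp ‖q.eval (pt x)‖ := Real.sum_le_exp_of_nonneg (norm_nonneg _) N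
      _ ≤ Real.exp M := Real.exp_le_exp.2 (hM x)
  refine le_of_tendsto_of_tendsto' ((hlim 0).const_mul c)
    (tendsto_integral_of_dominated_convergence (fun _ => Real.exp M ^ 2) ?_ (integrable_const _)
      ?_ (Filter.Eventually.of_forall fun x => hlim (pt x))) fun N => h (Q N)
  · exact fun N => ((continuous_eval_pt (Q N)).norm.pow 2).aestronglyMeasurable
  · refine fun N => Filter.Eventually.of_forall fun x => ?_
    rw [norm_pow, norm_norm]
    gcongr
    exact hbd N x

theorem integral_fourier (n : ℤ) : ∫ x, fourier n x ∂m = if n = 0 then 1 else 0 := by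
  have h := congrFun (fourierCoeff_fourier (T := 1) n) 0
  rw [fourierCoeff] at h
  simp only [neg_zero, fourier_zero, one_smul, Pi.single_apply] at h
  rw [h]
  simp [eq_comm]

theorem integral_eval_pt (q : Polynomial ℂ) : ∫ x, q.eval (pt x) ∂m = q.eval 0 := by
  simp only [Polynomial.eval_eq_sum_range]
  rw [integral_finsetSum _ fun i _ => integrable_of_continuous (by
    exact continuous_const.mul (continuous_pt.pow i))]
  refine Finset.sum_congr rfl fun i _ => ?_
  rw [integral_const_mul]
  congr 1
  simp only [← fourier_eq_pt_pow, integral_fourier]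
  rcases i with _ | i
  · simp
  · simp; omega

/-- The real part of a trigonometric polynomial is the real part of an analytic polynomial. -/
theorem exists_polynomial_re_eq {f : C(UnitAddCircle, ℂ)}
    (hf : f ∈ Submodule.span ℂ (Set.range (@fourier (1 : ℝ)))) :
    ∃ q : Polynomial ℂ, ∀ x, (f x).re = (q.eval (pt x)).re := by
  suffices h : ∀ c : ℂ, ∃ q : Polynomial ℂ, ∀ x, (c * f x).re = (q.eval (pt x)).re by
    simpa using h 1
  induction hf using Submodule.span_induction with
  | mem f hf =>
    obtain ⟨n, rfl⟩ := hf
    intro c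
    obtain ⟨k, rfl | rfl⟩ := n.eq_nat_or_neg
    · exact ⟨Polynomial.C c * Polynomial.X ^ k, fun x => by simp [← fourier_eq_pt_pow]⟩
    · refine ⟨Polynomial.C (conj c) * Polynomial.X ^ k, fun x => ?_⟩
      rw [Polynomial.eval_mul, Polynomial.eval_C, Polynomial.eval_pow, Polynomial.eval_X,
        ← fourier_eq_pt_pow, fourier_neg, ← Complex.conj_re, map_mul, Complex.conj_conj]
  | zero => exact fun c => ⟨0, fun x => by simp⟩
  | add f g _ _ hf hg =>
    intro c
    obtain ⟨p, hp⟩ := hf c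
    obtain ⟨q, hq⟩ := hg c
    refine ⟨p + q, fun x => ?_⟩
    rw [ContinuousMap.add_apply, mul_add, add_re, hp, hq, Polynomial.eval_add, add_re]
  | smul d f _ hf =>
    intro c
    obtain ⟨q, hq⟩ := hf (c * d)
    refine ⟨q, fun x => ?_⟩
    rw [ContinuousMap.smul_apply, smul_eq_mul, ← mul_assoc, hq]

/-- The bound for continuous `g`, which is a uniform limit of functions `2 Re q` on the circle. -/
theorem IsEvalBound.exp_continuous {μ : Measure UnitAddCircle} [IsFiniteMeasure μ] {c : ℝ}
    (hc : 0 ≤ c) (h : IsEvalBound μ c) {g : UnitAddCircle → ℝ} (hg : Continuous g) :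
    c * Real.exp (∫ x, g x ∂m) ≤ ∫ x, Real.exp (g x) ∂μ := by
  have key : ∀ ε > 0, c * Real.exp (∫ x, g x ∂m) * Real.exp (-ε) ≤
      Real.exp ε * ∫ x, Real.exp (g x) ∂μ := by
    intro ε hε
    let G : C(UnitAddCircle, ℂ) := ⟨fun x => (g x : ℂ) / 2, by fun_prop⟩
    have hG : G ∈ (Submodule.span ℂ (Set.range (@fourier (1 : ℝ)))).topologicalClosure := by
      rw [span_fourier_closure_eq_top]; trivial
    obtain ⟨f, hf, hfG⟩ := Metric.mem_closure_iff.1 hG (ε / 2) (by positivity)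
    obtain ⟨q, hq⟩ := exists_polynomial_re_eq hf
    have hdist : ∀ x, |g x - 2 * (q.eval (pt x)).re| ≤ ε := by
      intro x
      have h1 : ‖G x - f x‖ < ε / 2 := by
        rw [← dist_eq_norm]; exact lt_of_le_of_lt (ContinuousMap.dist_apply_le_dist x) hfG
      have h2 := (Complex.abs_re_le_norm (G x - f x)).trans h1.le
      rw [sub_re, hq] at h2
      have h3 : (G x).re = g x / 2 := by simp [G]
      rw [h3] at h2
      rw [abs_le] at h2 ⊢
      constructor <;> linarith
    have hint : ∫ x, 2 * (q.eval (pt x)).re ∂m = 2 * (q.eval 0).re := by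
      rw [integral_const_mul, ← integral_eval_pt q]
      congr 1
      exact integral_re (integrable_of_continuous (continuous_eval_pt q))
    have hcont : Continuous fun x => 2 * (q.eval (pt x)).re :=
      continuous_const.mul (Complex.continuous_re.comp (continuous_eval_pt q))
    have h4 : (∫ x, g x ∂m) - ε ≤ 2 * (q.eval 0).re := by
      rw [← hint]
      have : ∫ x, (g x - ε) ∂m ≤ ∫ x, 2 * (q.eval (pt x)).re ∂m :=
        integral_mono ((integrable_of_continuous hg).sub (integrable_const _))
          (integrable_of_continuous hcont) fun x => by
            have := abs_le.1 (hdist x)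
            simp only
            linarith
      rwa [integral_sub (integrable_of_continuous hg) (integrable_const _), integral_const,
        probReal_univ, one_smul] at this
    calc c * Real.exp (∫ x, g x ∂m) * Real.exp (-ε)
        = c * Real.exp ((∫ x, g x ∂m) - ε) := by rw [mul_assoc, ← Real.exp_add]; rfl
      _ ≤ c * Real.exp (2 * (q.eval 0).re) := by gcongr
      _ ≤ ∫ x, Real.exp (2 * (q.eval (pt x)).re) ∂μ := h.exp_polynomial q
      _ ≤ ∫ x, Real.exp ε * Real.exp (g x) ∂μ := by
          refine integral_mono (integrable_of_continuous (Real.continuous_exp.comp hcont))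
            (integrable_of_continuous (continuous_const.mul (Real.continuous_exp.comp hg)))
            fun x => ?_
          rw [← Real.exp_add]
          refine Real.exp_le_exp.2 ?_
          have := abs_le.1 (hdist x)
          linarith
      _ = _ := integral_const_mul _ _
  have hl : Filter.Tendsto (fun ε : ℝ => c * Real.exp (∫ x, g x ∂m) * Real.exp (-ε))
      (nhdsWithin 0 (Set.Ioi 0)) (nhds (c * Real.exp (∫ x, g x ∂m))) := by
    have : Continuous (fun ε : ℝ => c * Real.exp (∫ x, g x ∂m) * Real.exp (-ε)) := by fun_prop
    simpa using (this.tendsto 0).mono_left nhdsWithin_le_nhds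
  have hr : Filter.Tendsto (fun ε : ℝ => Real.exp ε * ∫ x, Real.exp (g x) ∂μ)
      (nhdsWithin 0 (Set.Ioi 0)) (nhds (∫ x, Real.exp (g x) ∂μ)) := by
    have : Continuous (fun ε : ℝ => Real.exp ε * ∫ x, Real.exp (g x) ∂μ) := by fun_prop
    simpa using (this.tendsto 0).mono_left nhdsWithin_le_nhds
  exact le_of_tendsto_of_tendsto hl hr (by
    filter_upwards [self_mem_nhdsWithin] with ε hε using key ε hε)

theorem abs_exp_sub_exp_le {R s t : ℝ} (hs : s ≤ R) (ht : t ≤ R) :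
    |Real.exp s - Real.exp t| ≤ Real.exp R * |s - t| := by
  wlog hst : t ≤ s generalizing s t
  · rw [abs_sub_comm, abs_sub_comm s]; exact this ht hs (le_of_not_ge hst)
  rw [abs_of_nonneg (by linarith [Real.exp_le_exp.2 hst]), abs_of_nonneg (by linarith)]
  have h1 := Real.add_one_le_exp (t - s)
  have h2 : Real.exp t = Real.exp s * Real.exp (t - s) := by rw [← Real.exp_add]; ring_nf
  have h3 := Real.exp_le_exp.2 hs
  nlinarith [Real.exp_pos s]

/-- The bound for bounded measurable `g`, by approximation in `L¹(μ + m)`: the integral of `g` is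
taken with respect to `m`, that of `exp g` with respect to `μ`. -/
theorem IsEvalBound.exp_bounded {μ : Measure UnitAddCircle} [IsFiniteMeasure μ] {c : ℝ}
    (hc : 0 ≤ c) (h : IsEvalBound μ c) {g : UnitAddCircle → ℝ} (hg : Measurable g) {R : ℝ}
    (hR : ∀ x, |g x| ≤ R) :
    c * Real.exp (∫ x, g x ∂m) ≤ ∫ x, Real.exp (g x) ∂μ := by
  have hbint : ∀ (ν : Measure UnitAddCircle) [IsFiniteMeasure ν], Integrable g ν := fun ν _ =>
    Integrable.of_bound hg.aestronglyMeasurable R (Filter.Eventually.of_forall hR)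
  have hR0 : 0 ≤ R := (abs_nonneg _).trans (hR 0)
  have key : ∀ ε > 0, c * Real.exp ((∫ x, g x ∂m) - ε) ≤
      (∫ x, Real.exp (g x) ∂μ) + Real.exp R * ε := by
    intro ε hε
    obtain ⟨f, hf, -⟩ := (hbint (μ + m)).exists_boundedContinuous_integral_sub_le hε
    -- truncating the approximant to `[-R, R]` does not increase its distance to `g`
    let k : UnitAddCircle → ℝ := fun x => max (-R) (min R (f x))
    have hk : Continuous k := continuous_const.max (continuous_const.min f.continuous)
    have hkR : ∀ x, k x ≤ R := fun x => max_le (by linarith) (min_le_left _ _)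
    have hgk : ∀ x, |g x - k x| ≤ ‖g x - f x‖ := by
      intro x
      have h1 := abs_le.1 (hR x)
      have h2 : g x = max (-R) (min R (g x)) := by rw [min_eq_right h1.2, max_eq_right h1.1]
      calc |g x - k x| = |max (-R) (min R (g x)) - max (-R) (min R (f x))| := by rw [← h2]
        _ ≤ |min R (g x) - min R (f x)| := (abs_max_sub_max_le_max _ _ _ _).trans (by simp)
        _ ≤ |g x - f x| := (abs_min_sub_min_le_max _ _ _ _).trans (by simp)
    have hfi : Integrable (fun x => g x - f x) (μ + m) :=
      (hbint _).sub (integrable_of_continuous f.continuous)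
    have hd : ∀ ν : Measure UnitAddCircle, IsFiniteMeasure ν → ν ≤ μ + m →
        ∫ x, |g x - k x| ∂ν ≤ ε := by
      intro ν _ hν
      have hgki : Integrable (fun x => |g x - k x|) ν :=
        ((hbint ν).sub (integrable_of_continuous hk)).abs
      calc ∫ x, |g x - k x| ∂ν ≤ ∫ x, ‖g x - f x‖ ∂ν :=
            integral_mono hgki (hfi.mono_measure hν).norm hgk
        _ ≤ ∫ x, ‖g x - f x‖ ∂(μ + m) := integral_mono_measure hν
            (Filter.Eventually.of_forall fun x => norm_nonneg _) hfi.norm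
        _ ≤ ε := hf
    have hm : (∫ x, g x ∂m) - ε ≤ ∫ x, k x ∂m := by
      have h1 := hd m inferInstance (Measure.le_add_left le_rfl)
      have h2 : ∫ x, (g x - k x) ∂m ≤ ∫ x, |g x - k x| ∂m :=
        integral_mono ((hbint m).sub (integrable_of_continuous hk))
          ((hbint m).sub (integrable_of_continuous hk)).abs fun x => le_abs_self _
      rw [integral_sub (hbint m) (integrable_of_continuous hk)] at h2
      linarith
    have hμ : ∫ x, Real.exp (k x) ∂μ ≤ (∫ x, Real.exp (g x) ∂μ) + Real.exp R * ε := by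
      have h1 := hd μ inferInstance (Measure.le_add_right le_rfl)
      have hexpg : Integrable (fun x => Real.exp (g x)) μ :=
        Integrable.of_bound (Real.measurable_exp.comp hg).aestronglyMeasurable (Real.exp R)
          (Filter.Eventually.of_forall fun x => by
            rw [Real.norm_of_nonneg (Real.exp_pos _).le]
            exact Real.exp_le_exp.2 (abs_le.1 (hR x)).2)
      have hgki : Integrable (fun x => |g x - k x|) μ :=
        ((hbint μ).sub (integrable_of_continuous hk)).abs
      calc ∫ x, Real.exp (k x) ∂μ ≤ ∫ x, (Real.exp (g x) + Real.exp R * |g x - k x|) ∂μ := by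
            refine integral_mono (integrable_of_continuous (Real.continuous_exp.comp hk))
              (hexpg.add (hgki.const_mul _)) fun x => ?_
            have := abs_exp_sub_exp_le (abs_le.1 (hR x)).2 (hkR x)
            have := (abs_le.1 this).1
            simp only
            linarith
        _ = (∫ x, Real.exp (g x) ∂μ) + Real.exp R * ∫ x, |g x - k x| ∂μ := by
            rw [integral_add hexpg (hgki.const_mul _), integral_const_mul]
        _ ≤ _ := by gcongr
    calc c * Real.exp ((∫ x, g x ∂m) - ε) ≤ c * Real.exp (∫ x, k x ∂m) := by gcongr
      _ ≤ ∫ x, Real.exp (k x) ∂μ := h.exp_continuous hc hk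
      _ ≤ _ := hμ
  have hl : Filter.Tendsto (fun ε : ℝ => c * Real.exp ((∫ x, g x ∂m) - ε))
      (nhdsWithin 0 (Set.Ioi 0)) (nhds (c * Real.exp (∫ x, g x ∂m))) := by
    have : Continuous (fun ε : ℝ => c * Real.exp ((∫ x, g x ∂m) - ε)) := by fun_prop
    simpa using (this.tendsto 0).mono_left nhdsWithin_le_nhds
  have hr : Filter.Tendsto (fun ε : ℝ => (∫ x, Real.exp (g x) ∂μ) + Real.exp R * ε)
      (nhdsWithin 0 (Set.Ioi 0)) (nhds (∫ x, Real.exp (g x) ∂μ)) := by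
    have : Continuous (fun ε : ℝ => (∫ x, Real.exp (g x) ∂μ) + Real.exp R * ε) := by fun_prop
    simpa using (this.tendsto 0).mono_left nhdsWithin_le_nhds
  exact le_of_tendsto_of_tendsto hl hr (by
    filter_upwards [self_mem_nhdsWithin] with ε hε using key ε hε)

theorem density_nonneg (μ : Measure UnitAddCircle) (x : UnitAddCircle) : 0 ≤ density μ x :=
  ENNReal.toReal_nonneg

theorem measurable_density (μ : Measure UnitAddCircle) : Measurable (density μ) :=
  (Measure.measurable_rnDeriv μ m).ennreal_toReal

theorem integrable_density (μ : Measure UnitAddCircle) [IsFiniteMeasure μ] :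
    Integrable (density μ) m :=
  Measure.integrable_toReal_rnDeriv

/-- The density, truncated to the interval `[1 / K, K]`. -/
def clipDensity (μ : Measure UnitAddCircle) (K : ℝ) (x : UnitAddCircle) : ℝ :=
  max K⁻¹ (min (density μ x) K)

theorem measurable_clipDensity (μ : Measure UnitAddCircle) (K : ℝ) :
    Measurable (clipDensity μ K) :=
  measurable_const.max ((measurable_density μ).min measurable_const)

theorem clipDensity_le {μ : Measure UnitAddCircle} {K : ℝ} (hK : 1 ≤ K) (x : UnitAddCircle) :
    clipDensity μ K x ≤ K :=
  max_le ((inv_le_one_of_one_le₀ hK).trans hK) (min_le_right _ _)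

theorem le_clipDensity {μ : Measure UnitAddCircle} {K : ℝ} (x : UnitAddCircle) :
    K⁻¹ ≤ clipDensity μ K x :=
  le_max_left _ _

theorem abs_log_le_log {K v : ℝ} (hK : 1 ≤ K) (h1 : K⁻¹ ≤ v) (h2 : v ≤ K) :
    |Real.log v| ≤ Real.log K := by
  have hK0 : 0 < K⁻¹ := by positivity
  rw [abs_le, ← Real.log_inv]
  exact ⟨Real.log_le_log hK0 h1, Real.log_le_log (by linarith) h2⟩

theorem density_div_clipDensity_le {μ : Measure UnitAddCircle} {K : ℝ} (hK : 1 ≤ K)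
    (x : UnitAddCircle) : density μ x * (clipDensity μ K x)⁻¹ ≤ 1 + K⁻¹ * density μ x := by
  have hK0 : 0 < K⁻¹ := by positivity
  have hv : 0 < clipDensity μ K x := lt_of_lt_of_le hK0 (le_clipDensity x)
  have hw := density_nonneg μ x
  rw [← div_eq_mul_inv, div_le_iff₀ hv]
  rcases le_total (density μ x) K with h | h
  · have : density μ x ≤ clipDensity μ K x := by
      rw [clipDensity, min_eq_left h]; exact le_max_right _ _
    nlinarith [mul_nonneg (mul_nonneg hK0.le hw) hv.le]
  · have : K ≤ clipDensity μ K x := by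
      rw [clipDensity, min_eq_right h]; exact le_max_right _ _
    have h3 : K⁻¹ * K = 1 := inv_mul_cancel₀ (by linarith)
    nlinarith [mul_le_mul_of_nonneg_left this (mul_nonneg hK0.le hw)]

/-- Szegő's inequality for the truncated density. -/
theorem IsEvalBound.clipDensity {μ : Measure UnitAddCircle} [IsFiniteMeasure μ] {c : ℝ}
    (hc : 0 ≤ c) (h : IsEvalBound μ c) {K : ℝ} (hK : 1 ≤ K) :
    c * Real.exp (-∫ x, Real.log (CMV.clipDensity μ K x) ∂m) ≤
      1 + K⁻¹ * (∫ x, density μ x ∂m + μ.real Set.univ) := by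
  have hK0 : 0 < K⁻¹ := by positivity
  obtain ⟨s, hs, hs1, hs2⟩ := Measure.mutuallySingular_singularPart μ m
  classical
  -- on the support of the singular part the weight is as small as the truncation permits
  let v : UnitAddCircle → ℝ := s.piecewise (CMV.clipDensity μ K) (fun _ => K)
  have hv : Measurable v := (measurable_clipDensity μ K).piecewise hs measurable_const
  have hv1 : ∀ x, K⁻¹ ≤ v x := fun x => by
    by_cases hx : x ∈ s
    · simp only [v, Set.piecewise_eq_of_mem _ _ _ hx]; exact le_clipDensity x
    · simp only [v, Set.piecewise_eq_of_notMem _ _ _ hx]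
      exact (inv_le_one_of_one_le₀ hK).trans hK
  have hv2 : ∀ x, v x ≤ K := fun x => by
    by_cases hx : x ∈ s
    · simp only [v, Set.piecewise_eq_of_mem _ _ _ hx]; exact clipDensity_le hK x
    · simp only [v, Set.piecewise_eq_of_notMem _ _ _ hx]; exact le_rfl
  have hv0 : ∀ x, 0 < v x := fun x => lt_of_lt_of_le hK0 (hv1 x)
  have hvm : v =ᵐ[m] CMV.clipDensity μ K := by
    have : ∀ᵐ x ∂m, x ∈ s := by
      rw [ae_iff]; exact hs2
    filter_upwards [this] with x hx
    simp only [v, Set.piecewise_eq_of_mem _ _ _ hx]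
  have hvs : v =ᵐ[μ.singularPart m] fun _ => K := by
    have : ∀ᵐ x ∂(μ.singularPart m), x ∉ s := by
      rw [ae_iff]; simpa using hs1
    filter_upwards [this] with x hx
    simp only [v, Set.piecewise_eq_of_notMem _ _ _ hx]
  have key := h.exp_bounded hc (g := fun x => -Real.log (v x)) (Real.measurable_log.comp hv).neg
    (R := Real.log K) fun x => by rw [abs_neg]; exact abs_log_le_log hK (hv1 x) (hv2 x)
  have e1 : ∫ x, -Real.log (v x) ∂m = -∫ x, Real.log (CMV.clipDensity μ K x) ∂m := by
    rw [integral_neg]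
    congr 1
    refine integral_congr_ae ?_
    filter_upwards [hvm] with x hx
    rw [hx]
  have e2 : ∀ x, Real.exp (-Real.log (v x)) = (v x)⁻¹ := fun x => by
    rw [Real.exp_neg, Real.exp_log (hv0 x)]
  have hvi : ∀ (ν : Measure UnitAddCircle) [IsFiniteMeasure ν], Integrable (fun x => (v x)⁻¹) ν :=
    fun ν _ => Integrable.of_bound hv.inv.aestronglyMeasurable K
      (Filter.Eventually.of_forall fun x => by
        rw [Real.norm_of_nonneg (inv_nonneg.2 (hv0 x).le), inv_le_comm₀ (hv0 x) (by linarith)]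
        exact hv1 x)
  rw [e1] at key
  refine key.trans ?_
  simp only [e2]
  have hdec := Measure.haveLebesgueDecomposition_add μ m
  have e3 : ∫ x, (v x)⁻¹ ∂μ = ∫ x, (v x)⁻¹ ∂(μ.singularPart m) +
      ∫ x, (v x)⁻¹ ∂(m.withDensity (μ.rnDeriv m)) := by
    conv_lhs => rw [hdec]
    have : IsFiniteMeasure (m.withDensity (μ.rnDeriv m)) :=
      isFiniteMeasure_of_le μ (Measure.withDensity_rnDeriv_le μ m)
    rw [integral_add_measure (hvi _) (hvi _)]
  have e4 : ∫ x, (v x)⁻¹ ∂(μ.singularPart m) ≤ K⁻¹ * μ.real Set.univ := by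
    have : ∫ x, (v x)⁻¹ ∂(μ.singularPart m) = ∫ x, K⁻¹ ∂(μ.singularPart m) := by
      refine integral_congr_ae ?_
      filter_upwards [hvs] with x hx
      rw [hx]
    rw [this, integral_const, smul_eq_mul, mul_comm]
    refine mul_le_mul_of_nonneg_left ?_ hK0.le
    exact ENNReal.toReal_mono (measure_ne_top _ _) (Measure.singularPart_le μ m _)
  have e5 : ∫ x, (v x)⁻¹ ∂(m.withDensity (μ.rnDeriv m)) ≤ 1 + K⁻¹ * ∫ x, density μ x ∂m := by
    rw [integral_withDensity_eq_integral_toReal_smul (Measure.measurable_rnDeriv μ m)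
      (Measure.rnDeriv_lt_top μ m)]
    have : 1 + K⁻¹ * ∫ x, density μ x ∂m = ∫ x, (1 + K⁻¹ * density μ x) ∂m := by
      rw [integral_add (integrable_const _) ((integrable_density μ).const_mul _),
        integral_const_mul]
      simp
    rw [this]
    refine integral_mono_of_nonneg (Filter.Eventually.of_forall fun x => ?_)
      ((integrable_const _).add ((integrable_density μ).const_mul _)) ?_
    · exact mul_nonneg ENNReal.toReal_nonneg (inv_nonneg.2 (hv0 x).le)
    · filter_upwards [hvm] with x hx
      simp only [smul_eq_mul, hx]
      exact density_div_clipDensity_le hK x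
  rw [e3]
  linarith

theorem integrable_log_clipDensity (μ : Measure UnitAddCircle) {K : ℝ} (hK : 1 ≤ K) :
    Integrable (fun x => Real.log (clipDensity μ K x)) m :=
  Integrable.of_bound (Real.measurable_log.comp (measurable_clipDensity μ K)).aestronglyMeasurable
    (Real.log K) (Filter.Eventually.of_forall fun x =>
      abs_log_le_log hK (le_clipDensity x) (clipDensity_le hK x))

theorem abs_log_clipDensity_le {μ : Measure UnitAddCircle} {K : ℝ} (hK : 1 ≤ K)
    (x : UnitAddCircle) :
    |Real.log (clipDensity μ K x)| ≤ -Real.log (clipDensity μ K x) + 2 * density μ x := by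
  have hw := density_nonneg μ x
  have hK0 : 0 < K⁻¹ := by positivity
  have hv : 0 < clipDensity μ K x := lt_of_lt_of_le hK0 (le_clipDensity x)
  rcases le_total (clipDensity μ K x) 1 with h | h
  · rw [abs_of_nonpos (Real.log_nonpos hv.le h)]; linarith
  · rw [abs_of_nonneg (Real.log_nonneg h)]
    have h1 := Real.log_le_sub_one_of_pos hv
    have h2 : clipDensity μ K x - 1 ≤ density μ x := by
      rw [sub_le_iff_le_add, clipDensity]
      refine max_le ?_ ((min_le_left _ _).trans (by linarith))
      linarith [inv_le_one_of_one_le₀ hK]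
    linarith

theorem clipDensity_eventually_eq {μ : Measure UnitAddCircle} {x : UnitAddCircle}
    (hx : 0 < density μ x) : ∀ᶠ n : ℕ in Filter.atTop, clipDensity μ (n + 1) x = density μ x := by
  obtain ⟨N, hN⟩ := exists_nat_ge (density μ x + (density μ x)⁻¹)
  filter_upwards [Filter.eventually_ge_atTop N] with n hn
  have hn' : (N : ℝ) ≤ n := by exact_mod_cast hn
  have := inv_pos.2 hx
  rw [clipDensity, min_eq_left (by linarith), max_eq_right]
  rw [inv_le_comm₀ (by linarith) hx]
  linarith

theorem clipDensity_of_density_eq_zero {μ : Measure UnitAddCircle} {x : UnitAddCircle} {K : ℝ}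
    (hK : 1 ≤ K) (hx : density μ x = 0) : clipDensity μ K x = K⁻¹ := by
  rw [clipDensity, hx, min_eq_left (by linarith), max_eq_left (by positivity)]

theorem abs_log_clipDensity_le_abs_log {μ : Measure UnitAddCircle} {x : UnitAddCircle} {K : ℝ}
    (hK : 1 ≤ K) (hx : 0 < density μ x) :
    |Real.log (clipDensity μ K x)| ≤ |Real.log (density μ x)| := by
  have hKi := inv_le_one_of_one_le₀ hK
  have hK0 : 0 < K⁻¹ := by positivity
  rcases le_total (density μ x) 1 with h | h
  · have h1 : density μ x ≤ clipDensity μ K x := by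
      rw [clipDensity, min_eq_left (h.trans hK)]; exact le_max_right _ _
    have h2 : clipDensity μ K x ≤ 1 := max_le hKi ((min_le_left _ _).trans h)
    rw [abs_of_nonpos (Real.log_nonpos hx.le h),
      abs_of_nonpos (Real.log_nonpos (hx.le.trans h1) h2)]
    exact neg_le_neg (Real.log_le_log hx h1)
  · have h1 : 1 ≤ clipDensity μ K x := (le_min h hK).trans (le_max_right _ _)
    have h2 : clipDensity μ K x ≤ density μ x := max_le (hKi.trans h) (min_le_left _ _)
    rw [abs_of_nonneg (Real.log_nonneg h), abs_of_nonneg (Real.log_nonneg h1)]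
    exact Real.log_le_log (by linarith) h2

/-- The logarithms of the truncated densities are bounded in `L¹`, by Szegő's inequality for the
negative parts and `log v ≤ v` for the positive ones; Fatou's lemma gives the limit. -/
theorem IsEvalBound.ae_pos_and_integrable {μ : Measure UnitAddCircle} [IsFiniteMeasure μ] {c : ℝ}
    (hc : 0 < c) (h : IsEvalBound μ c) :
    (∀ᵐ x ∂m, 0 < density μ x) ∧ Integrable (fun x => Real.log (density μ x)) m := by
  set A : ℝ := ∫ x, density μ x ∂m + μ.real Set.univ
  have hA : 0 ≤ A := add_nonneg (integral_nonneg (density_nonneg μ)) measureReal_nonneg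
  have hK : ∀ n : ℕ, (1 : ℝ) ≤ n + 1 := fun n => by linarith [n.cast_nonneg (α := ℝ)]
  set L : ℕ → UnitAddCircle → ℝ := fun n x => Real.log (CMV.clipDensity μ (n + 1) x)
  have hLm : ∀ n, Measurable (L n) := fun n => Real.measurable_log.comp (measurable_clipDensity _ _)
  set B : ℝ := Real.log ((1 + A) / c) + 2 * ∫ x, density μ x ∂m
  have hbound : ∀ n, ∫⁻ x, ‖L n x‖ₑ ∂m ≤ ENNReal.ofReal B := by
    intro n
    rw [← ofReal_integral_norm_eq_lintegral_enorm (integrable_log_clipDensity μ (hK n))]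
    refine ENNReal.ofReal_le_ofReal ?_
    have h1 := h.clipDensity hc.le (hK n)
    have h2 : ((n : ℝ) + 1)⁻¹ * A ≤ A := mul_le_of_le_one_left hA (inv_le_one_of_one_le₀ (hK n))
    have h3 : -∫ x, L n x ∂m ≤ Real.log ((1 + A) / c) := by
      rw [Real.le_log_iff_exp_le (by positivity), le_div_iff₀ hc, mul_comm]
      exact h1.trans (by linarith)
    calc ∫ x, ‖L n x‖ ∂m ≤ ∫ x, (-L n x + 2 * density μ x) ∂m :=
          integral_mono (integrable_log_clipDensity μ (hK n)).norm
            ((integrable_log_clipDensity μ (hK n)).neg.add ((integrable_density μ).const_mul 2))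
            fun x => abs_log_clipDensity_le (hK n) x
      _ = -∫ x, L n x ∂m + 2 * ∫ x, density μ x ∂m := by
          have hi : Integrable (fun x => -L n x) m := (integrable_log_clipDensity μ (hK n)).neg
          rw [integral_add hi ((integrable_density μ).const_mul 2), integral_neg,
            integral_const_mul]
      _ ≤ B := by simp only [B]; linarith
  have hfatou : ∫⁻ x, Filter.liminf (fun n => ‖L n x‖ₑ) Filter.atTop ∂m ≤ ENNReal.ofReal B := by
    refine (lintegral_liminf_le fun n => (hLm n).enorm).trans ?_
    refine Filter.liminf_le_of_frequently_le' (Filter.Frequently.of_forall hbound)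
  have hfin := ae_lt_top (Measurable.liminf fun n => (hLm n).enorm)
    (ne_top_of_le_ne_top ENNReal.ofReal_ne_top hfatou)
  have hpos : ∀ᵐ x ∂m, 0 < density μ x := by
    filter_upwards [hfin] with x hx
    by_contra hx0
    have hx0' : density μ x = 0 := le_antisymm (not_lt.1 hx0) (density_nonneg μ x)
    have hlim : Filter.Tendsto (fun n => ‖L n x‖ₑ) Filter.atTop (nhds ⊤) := by
      have : ∀ n, ‖L n x‖ₑ = ENNReal.ofReal (Real.log (n + 1)) := fun n => by
        simp only [L]
        rw [clipDensity_of_density_eq_zero (hK n) hx0', Real.log_inv, enorm_neg,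
          Real.enorm_of_nonneg (Real.log_nonneg (hK n))]
      simp only [this]
      refine ENNReal.tendsto_ofReal_nhds_top.2 ?_
      exact Real.tendsto_log_atTop.comp
        (Filter.tendsto_atTop_add_const_right _ _ tendsto_natCast_atTop_atTop)
    rw [hlim.liminf_eq] at hx
    exact lt_irrefl _ hx
  refine ⟨hpos, (Real.measurable_log.comp (measurable_density μ)).aestronglyMeasurable, ?_⟩
  refine lt_of_le_of_lt (le_trans (le_of_eq ?_) hfatou) ENNReal.ofReal_lt_top
  refine lintegral_congr_ae ?_
  filter_upwards [hpos] with x hx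
  have : Filter.Tendsto (fun n => ‖L n x‖ₑ) Filter.atTop (nhds ‖Real.log (density μ x)‖ₑ) := by
    refine tendsto_const_nhds.congr' ?_
    filter_upwards [clipDensity_eventually_eq hx] with n hn
    simp only [L, hn]
  exact this.liminf_eq.symm

/-- Szegő's inequality. -/
theorem IsEvalBound.le_exp_integral_log {μ : Measure UnitAddCircle} [IsFiniteMeasure μ] {c : ℝ}
    (hc : 0 < c) (h : IsEvalBound μ c) : c ≤ Real.exp (∫ x, Real.log (density μ x) ∂m) := by
  obtain ⟨hpos, hint⟩ := h.ae_pos_and_integrable hc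
  have hK : ∀ n : ℕ, (1 : ℝ) ≤ n + 1 := fun n => by linarith [n.cast_nonneg (α := ℝ)]
  have hlim : Filter.Tendsto (fun n : ℕ => ∫ x, Real.log (CMV.clipDensity μ (n + 1) x) ∂m)
      Filter.atTop (nhds (∫ x, Real.log (density μ x) ∂m)) := by
    refine tendsto_integral_of_dominated_convergence (fun x => |Real.log (density μ x)|)
      (fun n => (integrable_log_clipDensity μ (hK n)).aestronglyMeasurable) hint.abs ?_ ?_
    · intro n
      filter_upwards [hpos] with x hx using abs_log_clipDensity_le_abs_log (hK n) hx
    · filter_upwards [hpos] with x hx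
      refine tendsto_const_nhds.congr' ?_
      filter_upwards [clipDensity_eventually_eq hx] with n hn
      rw [hn]
  have hl := (Real.continuous_exp.tendsto _).comp hlim.neg
  have hr : Filter.Tendsto (fun n : ℕ => 1 + ((n : ℝ) + 1)⁻¹ *
      (∫ x, density μ x ∂m + μ.real Set.univ)) Filter.atTop (nhds 1) := by
    have : Filter.Tendsto (fun n : ℕ => ((n : ℝ) + 1)⁻¹) Filter.atTop (nhds 0) :=
      tendsto_inv_atTop_zero.comp
        (Filter.tendsto_atTop_add_const_right _ _ tendsto_natCast_atTop_atTop)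
    simpa using (this.mul_const _).const_add 1
  have := le_of_tendsto_of_tendsto' (hl.const_mul c) hr fun n => h.clipDensity hc.le (hK n)
  rwa [Real.exp_neg, ← div_eq_mul_inv, div_le_one (Real.exp_pos _)] at this

/-! ### The Hardy space of the circle -/

/-- The Fourier coefficients of `f` of negative index vanish. -/
def IsHardy (f : UnitAddCircle → ℂ) : Prop := ∀ n : ℤ, n < 0 → fourierCoeff f n = 0

theorem integral_norm_sq_eq (f : Lp ℂ 2 m) : ∫ x, ‖f x‖ ^ 2 ∂m = ‖f‖ ^ 2 := by
  rw [← (hasSum_sq_fourierCoeff f).tsum_eq, (hasSum_sq_fourierCoeff f).tsum_eq]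
  have h1 : ((‖f‖ ^ 2 : ℝ) : ℂ) = inner ℂ f f := by
    rw [inner_self_eq_norm_sq_to_K]; push_cast; rfl
  have h2 : inner ℂ f f = ((∫ x, ‖f x‖ ^ 2 ∂m : ℝ) : ℂ) := by
    rw [L2.inner_def, ← integral_complex_ofReal]
    refine integral_congr_ae (Filter.Eventually.of_forall fun x => ?_)
    simp only [RCLike.inner_apply']
    rw [← Complex.normSq_eq_norm_sq, ← Complex.normSq_eq_conj_mul_self]
  rw [h2] at h1
  exact_mod_cast h1.symm

theorem hasSum_sq_fourierCoeff_of_memLp {f : UnitAddCircle → ℂ} (hf : MemLp f 2 m) :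
    HasSum (fun i : ℤ => ‖fourierCoeff f i‖ ^ 2) (∫ x, ‖f x‖ ^ 2 ∂m) := by
  have h := hasSum_sq_fourierCoeff (hf.toLp f)
  have e : ∫ x, ‖hf.toLp f x‖ ^ 2 ∂m = ∫ x, ‖f x‖ ^ 2 ∂m :=
    integral_congr_ae (by filter_upwards [hf.coeFn_toLp] with x hx; rw [hx])
  rw [← e]
  simpa only [fourierCoeff_congr_ae hf.coeFn_toLp] using h

theorem IsHardy.hasSum_sq {f : UnitAddCircle → ℂ} (hf : MemLp f 2 m) (h : IsHardy f) :
    HasSum (fun i : ℕ => ‖fourierCoeff f i‖ ^ 2) (∫ x, ‖f x‖ ^ 2 ∂m) := by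
  refine (Function.Injective.hasSum_iff (g := fun i : ℕ => (i : ℤ)) Nat.cast_injective ?_).2
    (hasSum_sq_fourierCoeff_of_memLp hf)
  intro i hi
  have : i < 0 := by
    by_contra h0
    exact hi ⟨i.toNat, Int.toNat_of_nonneg (not_lt.1 h0)⟩
  rw [h i this]; simp

/-- Riesz–Fischer for the Hardy space. -/
theorem exists_hardy_of_summable {c : ℕ → ℂ} (hc : Summable fun n => ‖c n‖ ^ 2) :
    ∃ u : Lp ℂ 2 m, IsHardy u ∧ (∀ n : ℕ, fourierCoeff u n = c n) ∧
      ‖u‖ ^ 2 = ∑' n, ‖c n‖ ^ 2 := by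
  let e : ℤ → ℂ := Function.extend (fun n : ℕ => (n : ℤ)) c 0
  have he : ∀ n : ℕ, e n = c n := fun n => Nat.cast_injective.extend_apply c 0 n
  have he' : ∀ n : ℤ, n < 0 → e n = 0 := fun n hn => by
    refine Function.extend_apply' _ _ _ ?_
    rintro ⟨k, hk⟩
    omega
  have hmem : Memℓp e 2 := by
    refine memℓp_gen ?_
    have h1 : Summable fun i : ℤ => ‖e i‖ ^ 2 := by
      refine (Function.Injective.summable_iff (g := fun i : ℕ => (i : ℤ)) Nat.cast_injective ?_).1 ?_
      · intro i hi
        have : i < 0 := by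
          by_contra h0
          exact hi ⟨i.toNat, Int.toNat_of_nonneg (not_lt.1 h0)⟩
        rw [he' i this]; simp
      · simpa only [Function.comp_def, he] using hc
    simpa using h1
  let u : Lp ℂ 2 m := fourierBasis.repr.symm ⟨e, hmem⟩
  have hu : ∀ n, fourierCoeff u n = e n := fun n => by
    rw [← fourierBasis_repr]; simp [u]
  have hH : IsHardy u := fun n hn => by rw [hu, he' n hn]
  refine ⟨u, hH, fun n => by rw [hu, he], ?_⟩
  rw [← integral_norm_sq_eq, ← (hH.hasSum_sq (Lp.memLp u)).tsum_eq]
  exact tsum_congr fun n => by rw [hu, he]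

theorem memLp_conj {μ : Measure UnitAddCircle} {f : UnitAddCircle → ℂ} (hf : MemLp f 2 μ) :
    MemLp (fun x => conj (f x)) 2 μ := hf.star

theorem memLp_fourier_mul {μ : Measure UnitAddCircle} {f : UnitAddCircle → ℂ} (hf : MemLp f 2 μ)
    (n : ℤ) : MemLp (fun x => fourier n x * f x) 2 μ := by
  refine hf.of_le ((fourier n).continuous.aestronglyMeasurable.mul hf.1)
    (Filter.Eventually.of_forall fun x => ?_)
  rw [norm_mul, fourier_eq_pt_zpow, norm_zpow, norm_pt, one_zpow, one_mul]

theorem integrable_mul_of_memLp {μ : Measure UnitAddCircle} {f g : UnitAddCircle → ℂ}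
    (hf : MemLp f 2 μ) (hg : MemLp g 2 μ) : Integrable (fun x => f x * g x) μ :=
  hf.integrable_mul hg

/-- Fourier coefficients turn products into convolutions. -/
theorem hasSum_fourierCoeff_mul {f g : UnitAddCircle → ℂ} (hf : MemLp f 2 m) (hg : MemLp g 2 m)
    (n : ℤ) : HasSum (fun i : ℤ => fourierCoeff f (n - i) * fourierCoeff g i)
      (fourierCoeff (fun x => f x * g x) n) := by
  have hv := memLp_fourier_mul (memLp_conj hf) n
  have h := fourierBasis.hasSum_inner_mul_inner (hv.toLp _) (hg.toLp _)
  refine hasSum_of_eq h (fun i => ?_) ?_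
  · rw [← HilbertBasis.repr_apply_apply, fourierBasis_repr, fourierCoeff_congr_ae hg.coeFn_toLp,
      coe_fourierBasis, L2.inner_def]
    congr 1
    refine integral_congr_ae ?_
    filter_upwards [hv.coeFn_toLp, coeFn_fourierLp 2 i] with x h1 h2
    rw [h1, h2, RCLike.inner_apply', map_mul, Complex.conj_conj, ← fourier_neg, smul_eq_mul,
      neg_sub, sub_eq_add_neg, fourier_add]
    ring
  · rw [L2.inner_def]
    refine integral_congr_ae ?_
    filter_upwards [hv.coeFn_toLp, hg.coeFn_toLp] with x h1 h2
    rw [h1, h2, RCLike.inner_apply', map_mul, Complex.conj_conj, ← fourier_neg, smul_eq_mul]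
    ring

theorem IsHardy.mul {f g : UnitAddCircle → ℂ} (hf : MemLp f 2 m) (hg : MemLp g 2 m)
    (hfH : IsHardy f) (hgH : IsHardy g) : IsHardy fun x => f x * g x := by
  intro n hn
  rw [← (hasSum_fourierCoeff_mul hf hg n).tsum_eq]
  refine (tsum_congr fun i => ?_).trans tsum_zero
  rcases lt_or_ge i 0 with hi | hi
  · rw [hgH i hi, mul_zero]
  · rw [hfH (n - i) (by omega), zero_mul]

theorem IsHardy.fourierCoeff_mul {f g : UnitAddCircle → ℂ} (hf : MemLp f 2 m) (hg : MemLp g 2 m)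
    (hfH : IsHardy f) (hgH : IsHardy g) (n : ℕ) :
    fourierCoeff (fun x => f x * g x) n =
      ∑ p ∈ Finset.HasAntidiagonal.antidiagonal n, fourierCoeff f p.1 * fourierCoeff g p.2 := by
  rw [← (hasSum_fourierCoeff_mul hf hg n).tsum_eq,
    tsum_eq_sum (s := (Finset.range (n + 1)).map ⟨fun i : ℕ => (i : ℤ), Nat.cast_injective⟩),
    Finset.sum_map, ← Finset.Nat.sum_antidiagonal_swap,
    Finset.Nat.sum_antidiagonal_eq_sum_range_succ_mk]
  · refine Finset.sum_congr rfl fun i hi => ?_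
    have hi' : i ≤ n := Finset.mem_range_succ_iff.1 hi
    simp [Int.ofNat_sub hi']
  · intro i hi
    rcases lt_or_ge i 0 with h0 | h0
    · rw [hgH i h0, mul_zero]
    · rw [hfH ((n : ℤ) - i) ?_, zero_mul]
      by_contra h1
      refine hi (Finset.mem_map.2 ⟨i.toNat, Finset.mem_range_succ_iff.2 ?_, ?_⟩)
      · omega
      · exact Int.toNat_of_nonneg h0

/-! ### Outer functions -/

/-- `u` is an outer function of the Hardy class `H²`: the inequality of Szegő
`|u(0)|² ≤ exp ∫ log |u|² dm` is an equality. -/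
structure IsOuter (u : UnitAddCircle → ℂ) : Prop where
  memLp : MemLp u 2 m
  isHardy : IsHardy u
  norm_sq_eq : ‖fourierCoeff u 0‖ ^ 2 = Real.exp (∫ x, Real.log (‖u x‖ ^ 2) ∂m)

theorem IsHardy.integral_pow_mul {u : UnitAddCircle → ℂ} (h : IsHardy u) {k : ℕ} (hk : 0 < k) :
    ∫ x, pt x ^ k * u x ∂m = 0 := by
  have := h (-k : ℤ) (by omega)
  rw [fourierCoeff] at this
  simpa only [neg_neg, fourier_eq_pt_pow, smul_eq_mul] using this

theorem integrable_pow_mul {u : UnitAddCircle → ℂ} (h : Integrable u m) (k : ℕ) :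
    Integrable (fun x => pt x ^ k * u x) m := by
  simpa only [fourier_eq_pt_pow] using integrable_fourier_mul h (k : ℤ)

theorem IsHardy.integral_eval_mul {u : UnitAddCircle → ℂ} (hu : Integrable u m) (h : IsHardy u)
    (Q : Polynomial ℂ) : ∫ x, Q.eval (pt x) * u x ∂m = Q.eval 0 * fourierCoeff u 0 := by
  simp only [Polynomial.eval_eq_sum_range (p := Q) (pt _), Finset.sum_mul, mul_assoc]
  rw [integral_finsetSum _ fun i _ => (integrable_pow_mul hu i).const_mul _,
    Finset.sum_range_succ', Finset.sum_eq_zero, zero_add, integral_const_mul,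
    Polynomial.coeff_zero_eq_eval_zero]
  · simp [fourierCoeff]
  · intro i _
    rw [integral_const_mul, h.integral_pow_mul (Nat.succ_pos i), mul_zero]

theorem memLp_eval_mul {u : UnitAddCircle → ℂ} (hu : MemLp u 2 m) (Q : Polynomial ℂ) :
    MemLp (fun x => Q.eval (pt x) * u x) 2 m := by
  obtain ⟨M, hM⟩ := exists_norm_eval_pt_le Q
  refine hu.of_le_mul (c := M) ((continuous_eval_pt Q).aestronglyMeasurable.mul hu.1)
    (Filter.Eventually.of_forall fun x => ?_)
  rw [norm_mul]
  exact mul_le_mul_of_nonneg_right (hM x) (norm_nonneg _)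

theorem fourierCoeff_zero_eq (f : UnitAddCircle → ℂ) : fourierCoeff f 0 = ∫ x, f x ∂m := by
  simp [fourierCoeff]

theorem integral_norm_sub_const_sq {f : UnitAddCircle → ℂ} (hf : MemLp f 2 m) {d : ℂ}
    (hd : ∫ x, f x ∂m = d) : ∫ x, ‖f x - d‖ ^ 2 ∂m = ∫ x, ‖f x‖ ^ 2 ∂m - ‖d‖ ^ 2 := by
  have h1 := hasSum_sq_fourierCoeff_of_memLp hf
  have h2 := hasSum_sq_fourierCoeff_of_memLp (f := fun x => f x - d) (hf.sub (memLp_const d))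
  have hi : Integrable f m := hf.integrable (by norm_num)
  have hc : ∀ n : ℤ, n ≠ 0 → fourierCoeff (fun x => f x - d) n = fourierCoeff f n := by
    intro n hn
    simp only [fourierCoeff, smul_eq_mul, mul_sub]
    rw [integral_sub (integrable_fourier_mul hi _) ((integrable_fourier_mul (integrable_const d) _)),
      integral_mul_const, integral_fourier, if_neg (by omega), zero_mul, sub_zero]
  have hc0 : fourierCoeff (fun x => f x - d) 0 = 0 := by
    rw [fourierCoeff_zero_eq, integral_sub hi (integrable_const _), hd]; simp
  have h3 := h1.update 0 0
  rw [fourierCoeff_zero_eq, hd] at h3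
  refine (h2.unique (hasSum_of_eq h3 (fun n => ?_) rfl)).trans (by ring)
  by_cases hn : n = 0
  · subst hn; simp [hc0]
  · rw [Function.update_of_ne hn, hc n hn]

theorem IsOuter.coeff_zero_ne_zero {u : UnitAddCircle → ℂ} (h : IsOuter u) :
    fourierCoeff u 0 ≠ 0 := by
  intro h0
  have := h.norm_sq_eq
  rw [h0] at this
  have h1 := Real.exp_pos (∫ x, Real.log (‖u x‖ ^ 2) ∂m)
  simp only [norm_zero] at this
  linarith

theorem integrable_norm_sq {u : UnitAddCircle → ℂ} (hu : MemLp u 2 m) :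
    Integrable (fun x => ‖u x‖ ^ 2) m := by
  simpa using hu.integrable_norm_pow (by norm_num)

/-- Some multiples `Q u` of an outer function by polynomials are close to a constant. -/
theorem IsOuter.exists_polynomial {u : UnitAddCircle → ℂ} (h : IsOuter u) {ε : ℝ} (hε : 0 < ε) :
    ∃ Q : Polynomial ℂ,
      ∫ x, ‖Q.eval (pt x) * u x - fourierCoeff u 0‖ ^ 2 ∂m ≤ ε := by
  set d := fourierCoeff u 0
  have hui : Integrable u m := h.memLp.integrable (by norm_num)
  have hsq := integrable_norm_sq h.memLp
  let μ : Measure UnitAddCircle := m.withDensity fun x => ENNReal.ofReal (‖u x‖ ^ 2)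
  have hmeas : AEMeasurable (fun x => ENNReal.ofReal (‖u x‖ ^ 2)) m :=
    hsq.aestronglyMeasurable.aemeasurable.ennreal_ofReal
  have : IsFiniteMeasure μ := isFiniteMeasure_withDensity_ofReal hsq.2
  have hdens : density μ =ᵐ[m] fun x => ‖u x‖ ^ 2 := by
    filter_upwards [Measure.rnDeriv_withDensity₀ m hmeas] with x hx
    rw [density, hx, ENNReal.toReal_ofReal (sq_nonneg _)]
  have hint : ∀ Q : Polynomial ℂ, ∫ x, ‖Q.eval (pt x)‖ ^ 2 ∂μ =
      ∫ x, ‖Q.eval (pt x) * u x‖ ^ 2 ∂m := by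
    intro Q
    rw [integral_withDensity_eq_integral_toReal_smul₀ hmeas
      (Filter.Eventually.of_forall fun x => ENNReal.ofReal_lt_top)]
    refine integral_congr_ae (Filter.Eventually.of_forall fun x => ?_)
    simp only
    rw [ENNReal.toReal_ofReal (sq_nonneg _), smul_eq_mul, norm_mul, mul_pow, mul_comm]
  -- otherwise the evaluation bound with `|d|² + ε` would contradict Szegő's inequality
  obtain ⟨Q, hQ⟩ : ∃ Q : Polynomial ℂ,
      ∫ x, ‖Q.eval (pt x) * u x‖ ^ 2 ∂m < (‖d‖ ^ 2 + ε) * ‖Q.eval 0‖ ^ 2 := by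
    by_contra hcon
    push Not at hcon
    have hb : IsEvalBound μ (‖d‖ ^ 2 + ε) := fun Q => by rw [hint]; exact hcon Q
    have h1 := hb.le_exp_integral_log (by positivity)
    have h2 : ∫ x, Real.log (density μ x) ∂m = ∫ x, Real.log (‖u x‖ ^ 2) ∂m :=
      integral_congr_ae (by filter_upwards [hdens] with x hx; rw [hx])
    rw [h2, ← h.norm_sq_eq] at h1
    linarith
  have hQ0 : Q.eval 0 ≠ 0 := by
    intro h0
    rw [h0] at hQ
    have : 0 ≤ ∫ x, ‖Q.eval (pt x) * u x‖ ^ 2 ∂m := integral_nonneg fun x => by positivity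
    simp only [norm_zero] at hQ
    linarith
  set q := (Q.eval 0)⁻¹
  refine ⟨Polynomial.C q * Q, ?_⟩
  have hmean : ∫ x, (Polynomial.C q * Q).eval (pt x) * u x ∂m = d := by
    rw [h.isHardy.integral_eval_mul hui]
    simp [q, hQ0, d]
  rw [integral_norm_sub_const_sq (memLp_eval_mul h.memLp _) hmean]
  have e : ∀ x, ‖(Polynomial.C q * Q).eval (pt x) * u x‖ ^ 2 =
      ‖q‖ ^ 2 * ‖Q.eval (pt x) * u x‖ ^ 2 := fun x => by
    rw [Polynomial.eval_mul, Polynomial.eval_C, mul_assoc, norm_mul, mul_pow]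
  simp only [e]
  rw [integral_const_mul]
  have hq : ‖q‖ ^ 2 * ‖Q.eval 0‖ ^ 2 = 1 := by
    rw [← mul_pow, ← norm_mul, inv_mul_cancel₀ hQ0]; simp
  have hqpos : 0 ≤ ‖q‖ ^ 2 := by positivity
  nlinarith [mul_le_mul_of_nonneg_left hQ.le hqpos]

theorem norm_integral_mul_sq_le {f g : UnitAddCircle → ℂ} (hf : MemLp f 2 m) (hg : MemLp g 2 m) :
    ‖∫ x, f x * g x ∂m‖ ^ 2 ≤ (∫ x, ‖f x‖ ^ 2 ∂m) * ∫ x, ‖g x‖ ^ 2 ∂m := by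
  have hc := memLp_conj hf
  have h := norm_inner_le_norm (𝕜 := ℂ) (hc.toLp _) (hg.toLp _)
  have e1 : inner ℂ (hc.toLp _) (hg.toLp _) = ∫ x, f x * g x ∂m := by
    rw [L2.inner_def]
    refine integral_congr_ae ?_
    filter_upwards [hc.coeFn_toLp, hg.coeFn_toLp] with x h1 h2
    rw [h1, h2, RCLike.inner_apply', Complex.conj_conj]
  have e2 : ‖hc.toLp _‖ ^ 2 = ∫ x, ‖f x‖ ^ 2 ∂m := by
    rw [← integral_norm_sq_eq]
    exact integral_congr_ae (by filter_upwards [hc.coeFn_toLp] with x h1; simp [h1])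
  have e3 : ‖hg.toLp _‖ ^ 2 = ∫ x, ‖g x‖ ^ 2 ∂m := by
    rw [← integral_norm_sq_eq]
    exact integral_congr_ae (by filter_upwards [hg.coeFn_toLp] with x h1; simp [h1])
  rw [e1] at h
  rw [← e2, ← e3, ← mul_pow]
  gcongr

/-- Division by an outer function preserves analyticity. -/
theorem IsOuter.isHardy_of_mul {u f : UnitAddCircle → ℂ} (hu : IsOuter u) (hf : MemLp f 2 m)
    (h : IsHardy fun x => u x * f x) : IsHardy f := by
  intro n hn
  obtain ⟨k, hk, rfl⟩ : ∃ k : ℕ, 0 < k ∧ n = -k := ⟨n.natAbs, by omega, by omega⟩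
  set d := fourierCoeff u 0
  have hd : d ≠ 0 := hu.coeff_zero_ne_zero
  have hfk : MemLp (fun x => pt x ^ k * f x) 2 m := by
    simpa only [fourier_eq_pt_pow] using memLp_fourier_mul hf (k : ℤ)
  have huf := integrable_mul_of_memLp hu.memLp hf
  set A := ∫ x, ‖pt x ^ k * f x‖ ^ 2 ∂m
  have hA : 0 ≤ A := integral_nonneg fun x => by positivity
  have key : ∀ ε > 0, ‖∫ x, pt x ^ k * f x ∂m‖ ^ 2 * ‖d‖ ^ 2 ≤ A * ε := by
    intro ε hε
    obtain ⟨Q, hQ⟩ := hu.exists_polynomial hε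
    have hg : MemLp (fun x => Q.eval (pt x) * u x - d) 2 m :=
      (memLp_eval_mul hu.memLp Q).sub (memLp_const d)
    have h1 := norm_integral_mul_sq_le hfk hg
    have hz : ∫ x, (Polynomial.X ^ k * Q).eval (pt x) * (u x * f x) ∂m = 0 := by
      rw [h.integral_eval_mul huf]
      simp [hk.ne']
    have e : ∫ x, pt x ^ k * f x * (Q.eval (pt x) * u x - d) ∂m =
        -((∫ x, pt x ^ k * f x ∂m) * d) := by
      have e1 : ∀ x, pt x ^ k * f x * (Q.eval (pt x) * u x - d) =
          (Polynomial.X ^ k * Q).eval (pt x) * (u x * f x) - pt x ^ k * f x * d := fun x => by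
        simp only [Polynomial.eval_mul, Polynomial.eval_pow, Polynomial.eval_X]; ring
      simp only [e1]
      obtain ⟨M, hM⟩ := exists_norm_eval_pt_le (Polynomial.X ^ k * Q)
      rw [integral_sub (huf.bdd_mul (c := M) (continuous_eval_pt _).aestronglyMeasurable
        (Filter.Eventually.of_forall hM)) ((hfk.integrable (by norm_num)).mul_const d), hz,
        integral_mul_const, zero_sub]
    rw [e, norm_neg, norm_mul, mul_pow] at h1
    exact h1.trans (mul_le_mul_of_nonneg_left hQ hA)
  have hlim : Filter.Tendsto (fun ε : ℝ => A * ε) (nhdsWithin 0 (Set.Ioi 0)) (nhds 0) := by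
    have : Continuous fun ε : ℝ => A * ε := by fun_prop
    simpa using (this.tendsto 0).mono_left nhdsWithin_le_nhds
  have h0 := ge_of_tendsto hlim (by
    filter_upwards [self_mem_nhdsWithin] with ε hε using key ε hε)
  have h2 : ‖∫ x, pt x ^ k * f x ∂m‖ ^ 2 * ‖d‖ ^ 2 = 0 := le_antisymm h0 (by positivity)
  rw [mul_eq_zero] at h2
  have h3 : ∫ x, pt x ^ k * f x ∂m = 0 := by
    rcases h2 with h2 | h2
    · exact norm_eq_zero.1 (pow_eq_zero_iff (by norm_num) |>.1 h2)
    · exact absurd (norm_eq_zero.1 (pow_eq_zero_iff (by norm_num) |>.1 h2)) hd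
  rw [fourierCoeff]
  simpa only [neg_neg, fourier_eq_pt_pow, smul_eq_mul] using h3

/-! ### Poisson integrals -/

theorem pt_add (x y : UnitAddCircle) : pt (x + y) = pt x * pt y := by
  simp [pt, toCircle_add]

theorem pt_sub (x y : UnitAddCircle) : pt (x - y) = pt x / pt y := by
  have h := pt_add (x - y) y
  rw [sub_add_cancel] at h
  rw [h, mul_div_cancel_right₀ _ (pt_ne_zero y)]

theorem pt_sub_ne_zero {r : ℝ} (hr : |r| < 1) (u : UnitAddCircle) : pt u - r ≠ 0 := by
  intro h
  have := norm_pt u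
  rw [sub_eq_zero.1 h, Complex.norm_real, Real.norm_eq_abs] at this
  linarith

/-- The Poisson kernel of the disc at the point `r` of the radius `[0, 1)`. -/
def diskPoissonKernel (r : ℝ) (u : UnitAddCircle) : ℝ := ((pt u + r) / (pt u - r)).re

theorem diskPoissonKernel_nonneg {r : ℝ} (hr : |r| < 1) (u : UnitAddCircle) :
    0 ≤ diskPoissonKernel r u := by
  rw [diskPoissonKernel, Complex.div_re, ← add_div]
  refine div_nonneg ?_ (Complex.normSq_nonneg _)
  have h1 : (pt u).re * (pt u).re + (pt u).im * (pt u).im = 1 := by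
    rw [← Complex.normSq_apply, Complex.normSq_eq_norm_sq, norm_pt]; norm_num
  have h2 : r ^ 2 < 1 := (sq_lt_one_iff_abs_lt_one r).2 hr
  simp only [add_re, sub_re, ofReal_re, add_im, sub_im, ofReal_im, add_zero, sub_zero]
  nlinarith

theorem continuous_diskPoissonKernel {r : ℝ} (hr : |r| < 1) :
    Continuous (diskPoissonKernel r) :=
  Complex.continuous_re.comp ((continuous_pt.add continuous_const).div
    (continuous_pt.sub continuous_const) (pt_sub_ne_zero hr))

theorem integral_cauchy_fourier {r : ℝ} (hr : |r| < 1) (k : ℤ) :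
    ∫ x, pt x / (pt x - r) * fourier k x ∂m = if 0 ≤ k then (r : ℂ) ^ k.toNat else 0 := by
  have hz : ‖(r : ℂ)‖ < 1 := by rwa [Complex.norm_real, Real.norm_eq_abs]
  have h := hasSum_cauchy (μ := m) (integrable_of_continuous (fourier k).continuous) hz
  simp only [measureCoeff_haar, fourierCoeff_fourier] at h
  split_ifs with hk
  · have h2 := hasSum_single (f := fun n : ℕ => (Pi.single k (1 : ℂ) : ℤ → ℂ) n * (r : ℂ) ^ n) k.toNat
      fun n hn => by
        rw [Pi.single_apply, if_neg (by omega), zero_mul]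
    rw [h.unique h2, Pi.single_apply, if_pos (by omega), one_mul]
  · refine h.unique ?_
    convert hasSum_zero (α := ℂ) (β := ℕ) using 1
    funext n
    rw [Pi.single_apply, if_neg (by omega), zero_mul]

theorem integral_diskPoissonKernel_fourier {r : ℝ} (hr : |r| < 1) (k : ℤ) :
    ∫ x, (diskPoissonKernel r x : ℂ) * fourier k x ∂m = (r : ℂ) ^ k.natAbs := by
  have hcont : Continuous fun x => pt x / (pt x - r) :=
    continuous_pt.div (continuous_pt.sub continuous_const) (pt_sub_ne_zero hr)
  have e : ∀ x, (diskPoissonKernel r x : ℂ) * fourier k x =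
      pt x / (pt x - r) * fourier k x + conj (pt x / (pt x - r) * fourier (-k) x) - fourier k x := by
    intro x
    have h1 : (pt x + r) / (pt x - r) = 2 * (pt x / (pt x - r)) - 1 := by
      have := pt_sub_ne_zero hr x
      field_simp; ring
    rw [diskPoissonKernel, h1, Complex.re_eq_add_conj, map_sub, map_mul, map_one, map_ofNat,
      map_mul, ← fourier_neg, neg_neg]
    ring
  have i1 : ∀ k : ℤ, Integrable (fun x => pt x / (pt x - r) * fourier k x) m := fun k =>
    integrable_of_continuous (hcont.mul (fourier k).continuous)
  have i2 : Integrable (fun x => conj (pt x / (pt x - r) * fourier (-k) x)) m :=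
    integrable_of_continuous (Complex.continuous_conj.comp (hcont.mul (fourier (-k)).continuous))
  simp only [e]
  have i3 : Integrable (fun x => pt x / (pt x - r) * fourier k x +
      conj (pt x / (pt x - r) * fourier (-k) x)) m := (i1 k).add i2
  rw [integral_sub i3 (integrable_of_continuous (fourier k).continuous),
    integral_add (i1 k) i2, integral_conj, integral_cauchy_fourier hr, integral_cauchy_fourier hr,
    integral_fourier]
  rcases lt_trichotomy k 0 with hk | rfl | hk
  · rw [if_neg (by omega), if_pos (by omega), if_neg (by omega), show (-k).toNat = k.natAbs by omega]
    simp
  · simp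
  · rw [if_pos (by omega), if_neg (by omega), if_neg (by omega), show k.toNat = k.natAbs by omega]
    simp

theorem integral_diskPoissonKernel {r : ℝ} (hr : |r| < 1) :
    ∫ x, diskPoissonKernel r x ∂m = 1 := by
  have h := integral_diskPoissonKernel_fourier hr 0
  simp only [fourier_zero, mul_one, Int.natAbs_zero, pow_zero] at h
  rw [integral_complex_ofReal] at h
  exact_mod_cast h

theorem lintegral_diskPoissonKernel {r : ℝ} (hr : |r| < 1) :
    ∫⁻ x, ENNReal.ofReal (diskPoissonKernel r x) ∂m = 1 := by
  rw [← ofReal_integral_eq_lintegral_ofReal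
    (integrable_of_continuous (continuous_diskPoissonKernel hr))
    (Filter.Eventually.of_forall (diskPoissonKernel_nonneg hr)), integral_diskPoissonKernel hr,
    ENNReal.ofReal_one]

theorem lintegral_lintegral_diskPoissonKernel {r : ℝ} (hr : |r| < 1) {g : UnitAddCircle → ℝ≥0∞}
    (hg : Measurable g) :
    ∫⁻ x, ∫⁻ y, ENNReal.ofReal (diskPoissonKernel r (y - x)) * g y ∂m ∂m = ∫⁻ y, g y ∂m := by
  have hP : Measurable (diskPoissonKernel r) := (continuous_diskPoissonKernel hr).measurable
  rw [lintegral_lintegral_swap (Measurable.aemeasurable (by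
    refine Measurable.mul ?_ (hg.comp measurable_snd)
    exact (hP.comp (measurable_snd.sub measurable_fst)).ennreal_ofReal))]
  refine lintegral_congr fun y => ?_
  have hPy : Measurable fun x => ENNReal.ofReal (diskPoissonKernel r (y - x)) :=
    (hP.comp (measurable_const.sub measurable_id)).ennreal_ofReal
  rw [lintegral_mul_const _ hPy,
    lintegral_sub_left_eq_self (fun u => ENNReal.ofReal (diskPoissonKernel r u)) y,
    lintegral_diskPoissonKernel hr, one_mul]

/-- The Poisson integral of `f` at the point `r e^{2πix}`. -/
def poissonIntegral (r : ℝ) (f : UnitAddCircle → ℂ) (x : UnitAddCircle) : ℂ :=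
  ∫ y, (diskPoissonKernel r (y - x) : ℂ) * f y ∂m

theorem integrable_diskPoissonKernel_mul {r : ℝ} (hr : |r| < 1) {f : UnitAddCircle → ℂ}
    (hf : Integrable f m) (x : UnitAddCircle) :
    Integrable (fun y => (diskPoissonKernel r (y - x) : ℂ) * f y) m := by
  have hc : Continuous fun y => (diskPoissonKernel r (y - x) : ℂ) :=
    Complex.continuous_ofReal.comp
      ((continuous_diskPoissonKernel hr).comp (continuous_id.sub continuous_const))
  obtain ⟨M, hM⟩ := isCompact_univ.exists_bound_of_continuousOn hc.continuousOn
  exact hf.bdd_mul (c := M) hc.aestronglyMeasurable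
    (Filter.Eventually.of_forall fun y => hM y (Set.mem_univ y))

theorem lintegral_poissonIntegral_le {r : ℝ} (hr : |r| < 1) {f : UnitAddCircle → ℂ}
    (hf : Measurable f) : ∫⁻ x, ‖poissonIntegral r f x‖ₑ ∂m ≤ ∫⁻ x, ‖f x‖ₑ ∂m := by
  rw [← lintegral_lintegral_diskPoissonKernel hr hf.enorm]
  refine lintegral_mono fun x => (enorm_integral_le_lintegral_enorm _).trans (le_of_eq ?_)
  refine lintegral_congr fun y => ?_
  rw [enorm_mul, ← ofReal_norm, Complex.norm_real,
    Real.norm_of_nonneg (diskPoissonKernel_nonneg hr _)]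

theorem poissonIntegral_fourier {r : ℝ} (hr : |r| < 1) (k : ℤ) (x : UnitAddCircle) :
    poissonIntegral r (fourier k) x = (r : ℂ) ^ k.natAbs * fourier k x := by
  rw [poissonIntegral, ← integral_diskPoissonKernel_fourier hr, ← integral_mul_const,
    ← integral_sub_right_eq_self
      (fun u => (diskPoissonKernel r u : ℂ) * fourier k u * fourier k x) x]
  refine integral_congr_ae (Filter.Eventually.of_forall fun y => ?_)
  simp only [fourier_eq_pt_zpow, pt_sub, div_zpow]
  have := zpow_ne_zero k (pt_ne_zero x)
  field_simp

theorem tendstoUniformly_poissonIntegral {r : ℕ → ℝ} (hr : ∀ n, |r n| < 1)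
    (hlim : Filter.Tendsto r Filter.atTop (nhds 1)) {g : C(UnitAddCircle, ℂ)}
    (hg : g ∈ Submodule.span ℂ (Set.range (@fourier (1 : ℝ)))) :
    TendstoUniformly (fun n x => poissonIntegral (r n) g x) g Filter.atTop := by
  induction hg using Submodule.span_induction with
  | mem g hg =>
    obtain ⟨k, rfl⟩ := hg
    rw [Metric.tendstoUniformly_iff]
    intro ε hε
    have h1 : Filter.Tendsto (fun n => ((r n : ℂ)) ^ k.natAbs) Filter.atTop (nhds 1) := by
      have := ((Complex.continuous_ofReal.tendsto 1).comp hlim).pow k.natAbs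
      simpa using this
    filter_upwards [Metric.tendsto_nhds.1 h1 ε hε] with n hn x
    rw [poissonIntegral_fourier (hr n), dist_comm, dist_eq_norm]
    rw [dist_eq_norm] at hn
    rwa [← sub_one_mul, norm_mul, fourier_eq_pt_zpow, norm_zpow, norm_pt, one_zpow, mul_one]
  | zero =>
    have : (fun n x => poissonIntegral (r n) (0 : C(UnitAddCircle, ℂ)) x) = fun _ _ => 0 := by
      funext n x; simp [poissonIntegral]
    rw [this]
    exact tendsto_const_nhds.tendstoUniformly_const
  | add f g _ _ hf hg =>
    have : (fun n x => poissonIntegral (r n) (f + g : C(UnitAddCircle, ℂ)) x) =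
        (fun n x => poissonIntegral (r n) f x) + fun n x => poissonIntegral (r n) g x := by
      funext n x
      simp only [poissonIntegral, Pi.add_apply, ContinuousMap.add_apply, mul_add]
      exact integral_add
        (integrable_diskPoissonKernel_mul (hr n) (integrable_of_continuous f.continuous) x)
        (integrable_diskPoissonKernel_mul (hr n) (integrable_of_continuous g.continuous) x)
    rw [this]
    exact hf.add hg
  | smul c g _ hg =>
    have : (fun n x => poissonIntegral (r n) (c • g : C(UnitAddCircle, ℂ)) x) =
        fun n => (fun z => c * z) ∘ fun x => poissonIntegral (r n) g x := by
      funext n x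
      simp only [poissonIntegral, ContinuousMap.smul_apply, smul_eq_mul, Function.comp_apply,
        ← integral_const_mul]
      congr 1
      funext y
      ring
    rw [this]
    exact (uniformContinuous_const_smul c).comp_tendstoUniformly hg

theorem exists_span_fourier_lintegral_le {f : UnitAddCircle → ℂ} (hf : Integrable f m) {ε : ℝ≥0∞}
    (hε : ε ≠ 0) : ∃ g ∈ Submodule.span ℂ (Set.range (@fourier (1 : ℝ))),
      ∫⁻ x, ‖f x - g x‖ₑ ∂m ≤ ε := by
  have hε2 : ε / 2 ≠ 0 := by simpa using hε
  obtain ⟨h, hh, -⟩ := hf.exists_boundedContinuous_lintegral_sub_le hε2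
  have hG : h.toContinuousMap ∈
      (Submodule.span ℂ (Set.range (@fourier (1 : ℝ)))).topologicalClosure := by
    rw [span_fourier_closure_eq_top]; trivial
  obtain ⟨g, hg, hgh⟩ := EMetric.mem_closure_iff.1 hG (ε / 2) (pos_iff_ne_zero.2 hε2)
  refine ⟨g, hg, ?_⟩
  calc ∫⁻ x, ‖f x - g x‖ₑ ∂m ≤ ∫⁻ x, (‖f x - h x‖ₑ + ε / 2) ∂m := by
        refine lintegral_mono fun x => ?_
        have h1 : ‖h x - g x‖ₑ ≤ ε / 2 := by
          rw [← edist_eq_enorm_sub]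
          refine le_trans ?_ hgh.le
          rw [edist_dist, edist_dist]
          exact ENNReal.ofReal_le_ofReal (ContinuousMap.dist_apply_le_dist x)
        calc ‖f x - g x‖ₑ = ‖(f x - h x) + (h x - g x)‖ₑ := by rw [sub_add_sub_cancel]
          _ ≤ ‖f x - h x‖ₑ + ‖h x - g x‖ₑ := enorm_add_le _ _
          _ ≤ _ := by gcongr
    _ = ∫⁻ x, ‖f x - h x‖ₑ ∂m + ε / 2 := by
        rw [lintegral_add_right _ measurable_const, lintegral_const, measure_univ, mul_one]
    _ ≤ ε / 2 + ε / 2 := by gcongr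
    _ = ε := ENNReal.add_halves ε

/-- Poisson integrals of an integrable function converge to it in `L¹`. -/
theorem tendsto_lintegral_poissonIntegral_sub {r : ℕ → ℝ} (hr : ∀ n, |r n| < 1)
    (hlim : Filter.Tendsto r Filter.atTop (nhds 1)) {f : UnitAddCircle → ℂ} (hfm : Measurable f)
    (hf : Integrable f m) :
    Filter.Tendsto (fun n => ∫⁻ x, ‖poissonIntegral (r n) f x - f x‖ₑ ∂m) Filter.atTop
      (nhds 0) := by
  rw [ENNReal.tendsto_nhds_zero]
  intro ε hε
  have hε3 : ε / 3 ≠ 0 := by simpa using hε.ne'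
  obtain ⟨g, hg, hfg⟩ := exists_span_fourier_lintegral_le hf hε3
  have hgi : Integrable g m := integrable_of_continuous g.continuous
  have hu := tendstoUniformly_poissonIntegral hr hlim hg
  rw [EMetric.tendstoUniformly_iff] at hu
  filter_upwards [hu (ε / 3) (pos_iff_ne_zero.2 hε3)] with n hn
  have hmeas : Measurable fun x => f x - g x := hfm.sub g.continuous.measurable
  have e : ∀ x, poissonIntegral (r n) f x - f x =
      poissonIntegral (r n) (fun y => f y - g y) x +
        ((poissonIntegral (r n) g x - g x) + -(f x - g x)) := by
    intro x
    have : poissonIntegral (r n) (fun y => f y - g y) x =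
        poissonIntegral (r n) f x - poissonIntegral (r n) g x := by
      simp only [poissonIntegral, mul_sub]
      exact integral_sub (integrable_diskPoissonKernel_mul (hr n) hf x)
        (integrable_diskPoissonKernel_mul (hr n) hgi x)
    rw [this]; ring
  calc ∫⁻ x, ‖poissonIntegral (r n) f x - f x‖ₑ ∂m
      ≤ ∫⁻ x, (‖poissonIntegral (r n) (fun y => f y - g y) x‖ₑ + (ε / 3 + ‖f x - g x‖ₑ)) ∂m := by
        refine lintegral_mono fun x => ?_
        rw [e x]
        refine (enorm_add_le _ _).trans (add_le_add le_rfl ((enorm_add_le _ _).trans ?_))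
        rw [enorm_neg, ← edist_eq_enorm_sub, edist_comm]
        exact add_le_add (hn x).le le_rfl
    _ = ∫⁻ x, ‖poissonIntegral (r n) (fun y => f y - g y) x‖ₑ ∂m +
        (ε / 3 + ∫⁻ x, ‖f x - g x‖ₑ ∂m) := by
        have hmeas' : Measurable fun x => ε / 3 + ‖f x - g x‖ₑ :=
          measurable_const.add hmeas.enorm
        rw [lintegral_add_right _ hmeas',
          lintegral_add_left measurable_const, lintegral_const, measure_univ, mul_one]
    _ ≤ ε / 3 + (ε / 3 + ε / 3) := by
        gcongr
        exact (lintegral_poissonIntegral_le (hr n) hmeas).trans hfg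
    _ = ε := by rw [← add_assoc]; exact ENNReal.add_thirds ε

/-- Jensen's inequality for the Poisson kernel. -/
theorem ofReal_exp_poisson_le {r : ℝ} (hr : |r| < 1) {l : UnitAddCircle → ℝ} (hl : Integrable l m)
    (hexp : Integrable (fun x => Real.exp (l x)) m) (x : UnitAddCircle) :
    ENNReal.ofReal (Real.exp (∫ y, diskPoissonKernel r (y - x) * l y ∂m)) ≤
      ∫⁻ y, ENNReal.ofReal (diskPoissonKernel r (y - x)) * ENNReal.ofReal (Real.exp (l y)) ∂m := by
  have hPc : Continuous fun y => diskPoissonKernel r (y - x) :=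
    (continuous_diskPoissonKernel hr).comp (continuous_id.sub continuous_const)
  have hPm : Measurable fun y => ENNReal.ofReal (diskPoissonKernel r (y - x)) :=
    hPc.measurable.ennreal_ofReal
  let ν : Measure UnitAddCircle :=
    m.withDensity fun y => ENNReal.ofReal (diskPoissonKernel r (y - x))
  have : IsProbabilityMeasure ν := ⟨by
    rw [withDensity_apply _ MeasurableSet.univ, Measure.restrict_univ,
      lintegral_sub_right_eq_self (fun u => ENNReal.ofReal (diskPoissonKernel r u)) x,
      lintegral_diskPoissonKernel hr]⟩
  have hν : ∀ f : UnitAddCircle → ℝ, ∫ y, f y ∂ν = ∫ y, diskPoissonKernel r (y - x) * f y ∂m := by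
    intro f
    rw [integral_withDensity_eq_integral_toReal_smul hPm
      (Filter.Eventually.of_forall fun y => ENNReal.ofReal_lt_top)]
    refine integral_congr_ae (Filter.Eventually.of_forall fun y => ?_)
    simp only
    rw [ENNReal.toReal_ofReal (diskPoissonKernel_nonneg hr _), smul_eq_mul]
  obtain ⟨M, hM⟩ := isCompact_univ.exists_bound_of_continuousOn hPc.continuousOn
  have hint : ∀ f : UnitAddCircle → ℝ, Integrable f m → Integrable f ν ∧
      Integrable (fun y => diskPoissonKernel r (y - x) * f y) m := by
    intro f hf
    have h1 : Integrable (fun y => diskPoissonKernel r (y - x) * f y) m :=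
      hf.bdd_mul (c := M) hPc.aestronglyMeasurable
        (Filter.Eventually.of_forall fun y => hM y (Set.mem_univ y))
    refine ⟨?_, h1⟩
    rw [integrable_withDensity_iff_integrable_smul' hPm
      (Filter.Eventually.of_forall fun y => ENNReal.ofReal_lt_top)]
    refine h1.congr (Filter.Eventually.of_forall fun y => ?_)
    simp only
    rw [ENNReal.toReal_ofReal (diskPoissonKernel_nonneg hr _), smul_eq_mul]
  have hJ := convexOn_exp.map_integral_le (μ := ν) Real.continuous_exp.continuousOn isClosed_univ
    (Filter.Eventually.of_forall fun _ => Set.mem_univ _) (hint l hl).1 (hint _ hexp).1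
  rw [hν, hν] at hJ
  refine (ENNReal.ofReal_le_ofReal hJ).trans (le_of_eq ?_)
  rw [ofReal_integral_eq_lintegral_ofReal (hint _ hexp).2 (Filter.Eventually.of_forall fun y =>
    mul_nonneg (diskPoissonKernel_nonneg hr _) (Real.exp_pos _).le)]
  refine lintegral_congr fun y => ?_
  rw [ENNReal.ofReal_mul (diskPoissonKernel_nonneg hr _)]

/-! ### The Szegő function -/

theorem hasFPowerSeriesOnBall_of_hasSum {F : ℂ → ℂ} {c : ℕ → ℂ}
    (h : ∀ z, ‖z‖ < 1 → HasSum (fun n => c n * z ^ n) (F z)) :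
    HasFPowerSeriesOnBall F (FormalMultilinearSeries.ofScalars ℂ c) 0 1 where
  r_le := by
    refine ENNReal.le_of_forall_nnreal_lt fun r hr => ?_
    have hr1 : ‖((r : ℝ) : ℂ)‖ < 1 := by
      rw [Complex.norm_real, Real.norm_of_nonneg r.coe_nonneg]; exact_mod_cast hr
    refine FormalMultilinearSeries.le_radius_of_summable _ ?_
    have := (h _ hr1).summable.norm
    simpa [FormalMultilinearSeries.ofScalars_norm] using this
  r_pos := one_pos
  hasSum {y} hy := by
    have hy' : ‖y‖ < 1 := by simpa [← ofReal_norm] using hy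
    simpa [mul_comm] using h y hy'

theorem differentiableOn_of_hasSum {F : ℂ → ℂ} {c : ℕ → ℂ}
    (h : ∀ z, ‖z‖ < 1 → HasSum (fun n => c n * z ^ n) (F z)) :
    DifferentiableOn ℂ F (Metric.ball 0 1) := by
  have := (hasFPowerSeriesOnBall_of_hasSum h).differentiableOn
  rwa [← ENNReal.ofReal_one, Metric.eball_ofReal] at this

theorem hasSum_taylorCoeff {F : ℂ → ℂ} (h : DifferentiableOn ℂ F (Metric.ball 0 1)) {z : ℂ}
    (hz : ‖z‖ < 1) : HasSum (fun n => taylorCoeff F n * z ^ n) (F z) := by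
  refine hasSum_of_eq (Complex.hasSum_taylorSeries_on_ball h (by simpa using hz)) (fun n => ?_) rfl
  rw [taylorCoeff, sub_zero, smul_eq_mul, smul_eq_mul]
  ring

theorem herglotz_eq {l : UnitAddCircle → ℝ} (hl : Integrable l m) {z : ℂ} (hz : ‖z‖ < 1) :
    ∫ x, (pt x + z) / (pt x - z) * (l x : ℂ) ∂m =
      2 * ∫ x, pt x / (pt x - z) * (l x : ℂ) ∂m - ∫ x, (l x : ℂ) ∂m := by
  have hne : ∀ x, pt x - z ≠ 0 := fun x h => by
    rw [← sub_eq_zero.1 h, norm_pt] at hz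
    exact lt_irrefl _ hz
  have hc : Continuous fun x => pt x / (pt x - z) :=
    continuous_pt.div (continuous_pt.sub continuous_const) hne
  obtain ⟨M, hM⟩ := isCompact_univ.exists_bound_of_continuousOn hc.continuousOn
  have hi : Integrable (fun x => pt x / (pt x - z) * (l x : ℂ)) m :=
    hl.ofReal.bdd_mul (c := M) hc.aestronglyMeasurable
      (Filter.Eventually.of_forall fun y => hM y (Set.mem_univ y))
  have hlc : Integrable (fun x => (l x : ℂ)) m := hl.ofReal
  rw [← integral_const_mul, ← integral_sub (hi.const_mul 2) hlc]
  refine integral_congr_ae (Filter.Eventually.of_forall fun x => ?_)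
  have := hne x
  simp only
  field_simp
  ring

theorem differentiableOn_szegoD {σ : Measure UnitAddCircle}
    (hl : Integrable (fun x => Real.log (density σ x)) m) :
    DifferentiableOn ℂ (szegoD σ) (Metric.ball 0 1) := by
  have h1 := differentiableOn_of_hasSum fun z hz => hasSum_cauchy (μ := m) hl.ofReal hz
  have h2 : DifferentiableOn ℂ (fun z => Complex.exp (1 / 2 * (2 *
      (∫ x, pt x / (pt x - z) * (Real.log (density σ x) : ℂ) ∂m) -
        ∫ x, (Real.log (density σ x) : ℂ) ∂m))) (Metric.ball 0 1) :=
    (((h1.const_mul 2).sub_const _).const_mul _).cexp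
  refine h2.congr fun z hz => ?_
  rw [szegoD, herglotz_eq hl (by simpa using hz)]

theorem szegoD_ne_zero (σ : Measure UnitAddCircle) (z : ℂ) : szegoD σ z ≠ 0 := Complex.exp_ne_zero _

theorem norm_szegoD_sq {σ : Measure UnitAddCircle}
    (hl : Integrable (fun x => Real.log (density σ x)) m) {r : ℝ} (hr : |r| < 1)
    (x : UnitAddCircle) : ‖szegoD σ (r * pt x)‖ ^ 2 =
      Real.exp (∫ y, diskPoissonKernel r (y - x) * Real.log (density σ y) ∂m) := by
  rw [szegoD, Complex.norm_exp, ← Real.exp_nat_mul]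
  congr 1
  have hz : ‖(r : ℂ) * pt x‖ < 1 := by
    rwa [norm_mul, norm_pt, mul_one, Complex.norm_real, Real.norm_eq_abs]
  have hne : ∀ y, pt y - r * pt x ≠ 0 := fun y h => by
    rw [← sub_eq_zero.1 h, norm_pt] at hz
    exact lt_irrefl _ hz
  have hc : Continuous fun y => (pt y + r * pt x) / (pt y - r * pt x) :=
    (continuous_pt.add continuous_const).div (continuous_pt.sub continuous_const) hne
  obtain ⟨M, hM⟩ := isCompact_univ.exists_bound_of_continuousOn hc.continuousOn
  have hi : Integrable (fun y => (pt y + r * pt x) / (pt y - r * pt x) *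
      (Real.log (density σ y) : ℂ)) m :=
    hl.ofReal.bdd_mul (c := M) hc.aestronglyMeasurable
      (Filter.Eventually.of_forall fun y => hM y (Set.mem_univ y))
  have h1 : (1 / 2 * ∫ y, (pt y + r * pt x) / (pt y - r * pt x) *
      (Real.log (density σ y) : ℂ) ∂m).re = 1 / 2 * (∫ y, (pt y + r * pt x) / (pt y - r * pt x) *
      (Real.log (density σ y) : ℂ) ∂m).re := by
    rw [show (1 / 2 : ℂ) = ((1 / 2 : ℝ) : ℂ) by push_cast; ring, Complex.re_ofReal_mul]
  rw [h1, ← RCLike.re_eq_complex_re, ← integral_re hi]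
  have h2 : ∀ y, RCLike.re ((pt y + r * pt x) / (pt y - r * pt x) * (Real.log (density σ y) : ℂ)) =
      diskPoissonKernel r (y - x) * Real.log (density σ y) := fun y => by
    rw [RCLike.re_eq_complex_re, Complex.re_mul_ofReal, diskPoissonKernel, pt_sub]
    congr 2
    have := pt_ne_zero x
    have h3 : pt y / pt x + r = (pt y + r * pt x) / pt x := by field_simp
    have h4 : pt y / pt x - r = (pt y - r * pt x) / pt x := by field_simp
    rw [h3, h4, div_div_div_cancel_right₀ this]
  simp only [h2]
  push_cast
  ring

theorem norm_mul_pt_lt {r : ℝ} (hr : |r| < 1) (x : UnitAddCircle) : ‖(r : ℂ) * pt x‖ < 1 := by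
  rwa [norm_mul, norm_pt, mul_one, Complex.norm_real, Real.norm_eq_abs]

theorem continuous_dilation {F : ℂ → ℂ} (h : DifferentiableOn ℂ F (Metric.ball 0 1)) {r : ℝ}
    (hr : |r| < 1) : Continuous fun x => F (r * pt x) :=
  h.continuousOn.comp_continuous (continuous_const.mul continuous_pt)
    fun x => by simpa using norm_mul_pt_lt hr x

/-- Fourier coefficients of the dilation `x ↦ F(r e^{2πix})` of an analytic function. -/
theorem fourierCoeff_dilation {F : ℂ → ℂ} (h : DifferentiableOn ℂ F (Metric.ball 0 1)) {r : ℝ}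
    (hr : |r| < 1) (n : ℤ) : fourierCoeff (fun x => F (r * pt x)) n =
      if 0 ≤ n then taylorCoeff F n.toNat * (r : ℂ) ^ n.toNat else 0 := by
  have hz : ‖(r : ℂ)‖ < 1 := by rwa [Complex.norm_real, Real.norm_eq_abs]
  let G : ℕ → UnitAddCircle → ℂ := fun k x =>
    taylorCoeff F k * (r : ℂ) ^ k * fourier ((k : ℤ) - n) x
  have hG : ∀ k, Integrable (G k) m := fun k =>
    integrable_of_continuous (continuous_const.mul (fourier _).continuous)
  have hn : ∀ k, ∫ x, ‖G k x‖ ∂m = ‖taylorCoeff F k * (r : ℂ) ^ k‖ := fun k => by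
    simp only [G, norm_mul, fourier_eq_pt_zpow, norm_zpow, norm_pt, one_zpow, mul_one]
    simp
  have h1 := hasSum_integral_of_summable_integral_norm hG (by
    simp only [hn]
    exact (hasSum_taylorCoeff h hz).summable.norm)
  have h2 : ∫ x, ∑' k, G k x ∂m = fourierCoeff (fun x => F (r * pt x)) n := by
    rw [fourierCoeff]
    refine integral_congr_ae (Filter.Eventually.of_forall fun x => ?_)
    have h3 := (hasSum_taylorCoeff h (norm_mul_pt_lt hr x)).mul_left (fourier (-n) x)
    simp only [smul_eq_mul]
    rw [← h3.tsum_eq]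
    refine tsum_congr fun k => ?_
    simp only [G]
    rw [sub_eq_add_neg, fourier_add, fourier_eq_pt_pow, mul_pow]
    ring
  rw [h2] at h1
  have h4 : ∀ k, ∫ x, G k x ∂m = if (k : ℤ) - n = 0 then taylorCoeff F k * (r : ℂ) ^ k else 0 :=
    fun k => by
      simp only [G]
      rw [integral_const_mul, integral_fourier, mul_ite, mul_one, mul_zero]
  simp only [h4] at h1
  split_ifs with hn0
  · refine h1.unique ?_
    have := hasSum_single (f := fun k : ℕ => if (k : ℤ) - n = 0 then
      taylorCoeff F k * (r : ℂ) ^ k else 0) n.toNat fun k hk => if_neg (by omega)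
    rwa [if_pos (by omega)] at this
  · refine h1.unique (hasSum_of_eq hasSum_zero (fun k => ?_) rfl)
    rw [if_neg (by omega)]

theorem integral_norm_szegoD_dilation_le {σ : Measure UnitAddCircle} [IsFiniteMeasure σ]
    (hpos : ∀ᵐ x ∂m, 0 < density σ x) (hl : Integrable (fun x => Real.log (density σ x)) m)
    {r : ℝ} (hr : |r| < 1) :
    ∫ x, ‖szegoD σ (r * pt x)‖ ^ 2 ∂m ≤ ∫ x, density σ x ∂m := by
  have hexp : (fun x => Real.exp (Real.log (density σ x))) =ᵐ[m] density σ := by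
    filter_upwards [hpos] with x hx using Real.exp_log hx
  have hexpi : Integrable (fun x => Real.exp (Real.log (density σ x))) m :=
    (integrable_density σ).congr hexp.symm
  have hcont : Continuous fun x => ‖szegoD σ (r * pt x)‖ ^ 2 :=
    (continuous_dilation (differentiableOn_szegoD hl) hr).norm.pow 2
  have h0 : 0 ≤ ∫ x, density σ x ∂m := integral_nonneg (density_nonneg σ)
  rw [← ENNReal.ofReal_le_ofReal_iff h0, ofReal_integral_eq_lintegral_ofReal
    (integrable_of_continuous hcont) (Filter.Eventually.of_forall fun x => by positivity),
    ofReal_integral_eq_lintegral_ofReal (integrable_density σ)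
      (Filter.Eventually.of_forall (density_nonneg σ))]
  calc ∫⁻ x, ENNReal.ofReal (‖szegoD σ (r * pt x)‖ ^ 2) ∂m
      ≤ ∫⁻ x, ∫⁻ y, ENNReal.ofReal (diskPoissonKernel r (y - x)) *
          ENNReal.ofReal (Real.exp (Real.log (density σ y))) ∂m ∂m := by
        refine lintegral_mono fun x => ?_
        rw [norm_szegoD_sq hl hr]
        exact ofReal_exp_poisson_le hr hl hexpi x
    _ = ∫⁻ y, ENNReal.ofReal (Real.exp (Real.log (density σ y))) ∂m :=
        lintegral_lintegral_diskPoissonKernel hr (Real.measurable_exp.comp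
          (Real.measurable_log.comp (measurable_density σ))).ennreal_ofReal
    _ = _ := lintegral_congr_ae (by filter_upwards [hexp] with x hx; rw [hx])

theorem summable_taylorCoeff_szegoD {σ : Measure UnitAddCircle} [IsFiniteMeasure σ]
    (hpos : ∀ᵐ x ∂m, 0 < density σ x) (hl : Integrable (fun x => Real.log (density σ x)) m) :
    Summable fun n => ‖taylorCoeff (szegoD σ) n‖ ^ 2 := by
  refine summable_of_sum_range_le (c := ∫ x, density σ x ∂m) (fun n => by positivity) fun N => ?_
  have hD := differentiableOn_szegoD hl
  have h1 : ∀ r : ℝ, |r| < 1 → ∑ k ∈ Finset.range N, ‖taylorCoeff (szegoD σ) k‖ ^ 2 * (r ^ 2) ^ k ≤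
      ∫ x, density σ x ∂m := by
    intro r hr
    have hmem : MemLp (fun x => szegoD σ (r * pt x)) 2 m :=
      (continuous_dilation hD hr).memLp_of_hasCompactSupport (HasCompactSupport.of_compactSpace _)
    have hH : IsHardy fun x => szegoD σ (r * pt x) := fun n hn => by
      rw [fourierCoeff_dilation hD hr, if_neg (by omega)]
    have h2 := hH.hasSum_sq hmem
    refine le_trans ?_ (integral_norm_szegoD_dilation_le hpos hl hr)
    rw [← h2.tsum_eq]
    refine le_trans (le_of_eq ?_) (h2.summable.sum_le_tsum (Finset.range N) fun i _ => by positivity)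
    refine Finset.sum_congr rfl fun k _ => ?_
    rw [fourierCoeff_dilation hD hr, if_pos (by omega), Int.toNat_natCast, norm_mul, mul_pow,
      norm_pow, Complex.norm_real, ← pow_mul, ← pow_mul, mul_comm k 2, pow_mul ‖r‖,
      Real.norm_eq_abs, sq_abs, ← pow_mul]
  have hlim : Filter.Tendsto
      (fun r : ℝ => ∑ k ∈ Finset.range N, ‖taylorCoeff (szegoD σ) k‖ ^ 2 * (r ^ 2) ^ k)
      (nhdsWithin 1 (Set.Iio 1)) (nhds (∑ k ∈ Finset.range N, ‖taylorCoeff (szegoD σ) k‖ ^ 2)) := by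
    have hc : Continuous
        (fun r : ℝ => ∑ k ∈ Finset.range N, ‖taylorCoeff (szegoD σ) k‖ ^ 2 * (r ^ 2) ^ k) := by
      fun_prop
    have := (hc.tendsto 1).mono_left (nhdsWithin_le_nhds (s := Set.Iio 1))
    simpa using this
  refine le_of_tendsto hlim ?_
  filter_upwards [Ioo_mem_nhdsLT (show (-1 : ℝ) < 1 by norm_num)] with r hr
  exact h1 r (abs_lt.2 hr)

/-- The boundary values of the Szegő function: an outer function `u` with `|u|² = w`. -/
theorem exists_outer {σ : Measure UnitAddCircle} [IsFiniteMeasure σ]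
    (hpos : ∀ᵐ x ∂m, 0 < density σ x) (hl : Integrable (fun x => Real.log (density σ x)) m) :
    ∃ u : Lp ℂ 2 m, IsOuter u ∧ (∀ᵐ x ∂m, ‖u x‖ ^ 2 = density σ x) ∧
      ∀ n : ℕ, fourierCoeff u n = taylorCoeff (szegoD σ) n := by
  have hD := differentiableOn_szegoD hl
  have hd := summable_taylorCoeff_szegoD hpos hl
  obtain ⟨u, huH, hu, -⟩ := exists_hardy_of_summable hd
  let r : ℕ → ℝ := fun n => 1 - 1 / ((n : ℝ) + 1)
  have hr0 : ∀ n, 0 ≤ r n ∧ r n < 1 := fun n => by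
    have h1 : (0 : ℝ) < 1 / ((n : ℝ) + 1) := by positivity
    have h2 : 1 / ((n : ℝ) + 1) ≤ 1 := by
      rw [div_le_one (by positivity)]; linarith [n.cast_nonneg (α := ℝ)]
    simp only [r]
    constructor <;> linarith
  have hr : ∀ n, |r n| < 1 := fun n => by rw [abs_of_nonneg (hr0 n).1]; exact (hr0 n).2
  have hlim : Filter.Tendsto r Filter.atTop (nhds 1) := by
    simpa [r] using tendsto_one_div_add_atTop_nhds_zero_nat.const_sub (1 : ℝ)
  have hmem : ∀ n, MemLp (fun x => szegoD σ (r n * pt x)) 2 m := fun n =>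
    (continuous_dilation hD (hr n)).memLp_of_hasCompactSupport (HasCompactSupport.of_compactSpace _)
  have hnorm : ∀ n, ‖(hmem n).toLp _ - u‖ ^ 2 =
      ∑' k, ‖taylorCoeff (szegoD σ) k‖ ^ 2 * (1 - r n ^ k) ^ 2 := by
    intro n
    have hsub : MemLp (fun x => szegoD σ (r n * pt x) - u x) 2 m := (hmem n).sub (Lp.memLp u)
    have hcoef : ∀ k, fourierCoeff (fun x => szegoD σ (r n * pt x) - u x) k =
        fourierCoeff (fun x => szegoD σ (r n * pt x)) k - fourierCoeff u k := by
      intro k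
      simp only [fourierCoeff, smul_eq_mul, mul_sub]
      exact integral_sub (integrable_fourier_mul ((hmem n).integrable (by norm_num)) _)
        (integrable_fourier_mul ((Lp.memLp u).integrable (by norm_num)) _)
    have hsubH : IsHardy fun x => szegoD σ (r n * pt x) - u x := fun k hk => by
      rw [hcoef, fourierCoeff_dilation hD (hr n), if_neg (by omega), huH k hk, sub_zero]
    have e : ∫ x, ‖((hmem n).toLp _ - u : Lp ℂ 2 m) x‖ ^ 2 ∂m =
        ∫ x, ‖szegoD σ (r n * pt x) - u x‖ ^ 2 ∂m := by
      refine integral_congr_ae ?_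
      filter_upwards [Lp.coeFn_sub ((hmem n).toLp _) u, (hmem n).coeFn_toLp] with x h1 h2
      rw [h1, Pi.sub_apply, h2]
    rw [← integral_norm_sq_eq, e, ← (hsubH.hasSum_sq hsub).tsum_eq]
    refine tsum_congr fun k => ?_
    rw [hcoef, fourierCoeff_dilation hD (hr n), if_pos (by omega), hu, Int.toNat_natCast,
      ← mul_sub_one, norm_mul, mul_pow, norm_sub_rev]
    congr 2
    rw [← Complex.ofReal_pow, ← Complex.ofReal_one, ← Complex.ofReal_sub, Complex.norm_real,
      Real.norm_of_nonneg]
    linarith [pow_le_one₀ (hr0 n).1 (hr0 n).2.le (n := k)]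
  have hnorm0 : Filter.Tendsto (fun n => ‖(hmem n).toLp _ - u‖ ^ 2) Filter.atTop (nhds 0) := by
    simp only [hnorm]
    have := tendsto_tsum_of_dominated_convergence (𝓕 := Filter.atTop)
      (f := fun n k => ‖taylorCoeff (szegoD σ) k‖ ^ 2 * (1 - r n ^ k) ^ 2) (g := fun _ => 0) hd
      (fun k => by
        have := (((hlim.pow k).const_sub 1).pow 2).const_mul (‖taylorCoeff (szegoD σ) k‖ ^ 2)
        simpa using this)
      (Filter.Eventually.of_forall fun n k => by
        have h1 := pow_nonneg (hr0 n).1 k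
        have h2 := pow_le_one₀ (hr0 n).1 (hr0 n).2.le (n := k)
        rw [Real.norm_of_nonneg (by positivity)]
        refine mul_le_of_le_one_right (by positivity) ?_
        nlinarith)
    simpa using this
  have hconv : Filter.Tendsto (fun n => (hmem n).toLp (fun x => szegoD σ (r n * pt x)))
      Filter.atTop (nhds u) := by
    rw [tendsto_iff_norm_sub_tendsto_zero]
    have := (Real.continuous_sqrt.tendsto 0).comp hnorm0
    simpa [Function.comp_def, Real.sqrt_sq (norm_nonneg _)] using this
  -- a subsequence of the dilations converges almost everywhere
  have hmeasure1 := tendstoInMeasure_of_tendsto_Lp hconv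
  obtain ⟨φ, hφ, hφae⟩ := hmeasure1.exists_seq_tendsto_ae
  let l : UnitAddCircle → ℂ := fun x => (Real.log (density σ x) : ℂ)
  have hlm : Measurable l :=
    Complex.measurable_ofReal.comp (Real.measurable_log.comp (measurable_density σ))
  have hpoisson := tendsto_lintegral_poissonIntegral_sub (r := fun n => r (φ n)) (fun n => hr _)
    (hlim.comp hφ.tendsto_atTop) hlm hl.ofReal
  have hpm : ∀ n, StronglyMeasurable (poissonIntegral (r (φ n)) l) := fun n => by
    refine StronglyMeasurable.integral_prod_right' (f := fun p : UnitAddCircle × UnitAddCircle =>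
      (diskPoissonKernel (r (φ n)) (p.2 - p.1) : ℂ) * l p.2) ?_
    refine Measurable.stronglyMeasurable (Measurable.mul ?_ (hlm.comp measurable_snd))
    exact Complex.measurable_ofReal.comp ((continuous_diskPoissonKernel (hr _)).measurable.comp
      (measurable_snd.sub measurable_fst))
  have hmeasure2 : TendstoInMeasure m (fun n => poissonIntegral (r (φ n)) l) Filter.atTop l := by
    refine tendstoInMeasure_of_tendsto_eLpNorm (p := 1) one_ne_zero
      (fun n => (hpm n).aestronglyMeasurable) hlm.aestronglyMeasurable ?_
    simpa only [eLpNorm_one_eq_lintegral_enorm, Pi.sub_apply] using hpoisson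
  obtain ⟨ψ, hψ, hψae⟩ := hmeasure2.exists_seq_tendsto_ae
  have hw : ∀ᵐ x ∂m, ‖u x‖ ^ 2 = density σ x := by
    have hall : ∀ᵐ x ∂m, ∀ n, (hmem n).toLp (fun x => szegoD σ (r n * pt x)) x =
        szegoD σ (r n * pt x) := ae_all_iff.2 fun n => (hmem n).coeFn_toLp
    filter_upwards [hφae, hψae, hall, hpos] with x h1 h2 h3 h4
    have h5 := ((h1.comp hψ.tendsto_atTop).norm).pow 2
    have h6 := (Real.continuous_exp.tendsto _).comp
      ((Complex.continuous_re.tendsto _).comp h2)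
    have h7 : (l x).re = Real.log (density σ x) := Complex.ofReal_re _
    rw [h7, Real.exp_log h4] at h6
    refine tendsto_nhds_unique h5 (h6.congr fun n => ?_)
    simp only [Function.comp_apply]
    rw [h3, norm_szegoD_sq hl (hr _)]
    congr 1
    have h8 : poissonIntegral (r (φ (ψ n))) l x = ((∫ y, diskPoissonKernel (r (φ (ψ n))) (y - x) *
        Real.log (density σ y) ∂m : ℝ) : ℂ) := by
      rw [poissonIntegral, ← integral_complex_ofReal]
      simp only [l, Complex.ofReal_mul]
    rw [h8, Complex.ofReal_re]
  refine ⟨u, ⟨Lp.memLp u, huH, ?_⟩, hw, hu⟩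
  have h0 := hu 0
  rw [Nat.cast_zero] at h0
  have h1 : taylorCoeff (szegoD σ) 0 = szegoD σ ((0 : ℝ) * pt 0) := by
    simp [taylorCoeff]
  rw [h0, h1, norm_szegoD_sq hl (by simp)]
  congr 1
  have h2 : ∀ y, diskPoissonKernel 0 y = 1 := fun y => by
    simp [diskPoissonKernel, div_self (pt_ne_zero y)]
  simp only [h2, one_mul]
  exact integral_congr_ae (by filter_upwards [hw] with x hx; rw [hx])

/-! ### Taylor coefficients of the scattering functions -/

theorem analyticAt_szegoD {σ : Measure UnitAddCircle}
    (hl : Integrable (fun x => Real.log (density σ x)) m) : AnalyticAt ℂ (szegoD σ) 0 :=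
  (differentiableOn_szegoD hl).analyticAt (Metric.ball_mem_nhds 0 one_pos)

theorem integrable_of_Lp {σ : Measure UnitAddCircle} [IsFiniteMeasure σ] (f : Lp ℂ 2 σ) :
    Integrable f σ := (Lp.memLp f).integrable (by norm_num)

/-- `D F₁` is the Cauchy integral of `f dσ`. -/
theorem sum_szegoD_mul_scatF₁ {σ : Measure UnitAddCircle} [IsFiniteMeasure σ]
    (hl : Integrable (fun x => Real.log (density σ x)) m) (f : Lp ℂ 2 σ) (k : ℕ) :
    ∑ p ∈ Finset.HasAntidiagonal.antidiagonal k,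
      taylorCoeff (szegoD σ) p.1 * taylorCoeff (scatF₁ σ f) p.2 = measureCoeff σ f k := by
  have hC := fun z hz => hasSum_cauchy (integrable_of_Lp f) (z := z) hz
  have hD := analyticAt_szegoD hl
  have hF : AnalyticAt ℂ (scatF₁ σ f) 0 :=
    (analyticAt_const.div hD (szegoD_ne_zero σ 0)).mul (analyticAt_of_hasSum hC)
  rw [← taylorCoeff_mul hD hF]
  refine taylorCoeff_eq_of_hasSum (fun z hz => hasSum_of_eq (hC z hz) (fun n => rfl) ?_) k
  rw [scatF₁, ← mul_assoc, mul_one_div_cancel (szegoD_ne_zero σ z), one_mul]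

/-- `D_* F₂` is `a₋₁` times the exterior Cauchy integral of `f dσ`; this is the conjugate form of
the relation between the coefficients, with the Taylor coefficients of `D` itself. -/
theorem sum_szegoD_mul_scatF₂ (b : Circle) {σ : Measure UnitAddCircle} [IsFiniteMeasure σ]
    (hl : Integrable (fun x => Real.log (density σ x)) m) (f : Lp ℂ 2 σ) (k : ℕ) :
    ∑ p ∈ Finset.HasAntidiagonal.antidiagonal k,
      taylorCoeff (szegoD σ) p.1 * (-b * conj (taylorCoeff (scatF₂AtInfty b σ f) p.2)) =
        if k = 0 then 0 else conj (measureCoeff σ f (-k : ℤ)) := by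
  have hE : ∀ z : ℂ, ‖z‖ < 1 → HasSum (fun n => conj (taylorCoeff (szegoD σ) n) * z ^ n)
      (conj (szegoD σ (conj z))) := fun z hz => by
    have := (hasSum_taylorCoeff (differentiableOn_szegoD hl) (z := conj z)
      (by rwa [RCLike.norm_conj])).map (starRingEnd ℂ) Complex.continuous_conj
    exact hasSum_of_eq this (fun n => by simp) rfl
  let H : ℂ → ℂ := fun z => if z = 0 then 0 else ∫ x, pt x / (pt x - z⁻¹) * f x ∂σ
  have hH : ∀ z : ℂ, ‖z‖ < 1 → HasSum
      (fun n : ℕ => (if n = 0 then 0 else -measureCoeff σ f (-n : ℤ)) * z ^ n) (H z) :=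
    fun z hz => by
      by_cases h0 : z = 0
      · subst h0
        refine hasSum_of_eq (hasSum_zero (α := ℂ) (β := ℕ)) (fun n => ?_) (by simp [H])
        rcases n with _ | n <;> simp
      · refine hasSum_of_eq (hasSum_cauchy_exterior (integrable_of_Lp f) hz h0) (fun n => rfl) ?_
        simp [H, h0]
  have hne : ∀ z, conj (szegoD σ (conj z)) ≠ 0 := fun z => by
    simpa using szegoD_ne_zero σ (conj z)
  have hF : ∀ z, scatF₂AtInfty b σ f z = b / conj (szegoD σ (conj z)) * H z := fun z => by
    by_cases h0 : z = 0
    · simp [scatF₂AtInfty, H, h0]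
    · simp [scatF₂AtInfty, H, h0, scatF₂, szegoDStar]
  have hEa := analyticAt_of_hasSum hE
  have hFa : AnalyticAt ℂ (scatF₂AtInfty b σ f) 0 := by
    rw [funext hF]
    exact (analyticAt_const.div hEa (hne 0)).mul (analyticAt_of_hasSum hH)
  have h1 := taylorCoeff_mul hEa hFa k
  have h2 := taylorCoeff_eq_of_hasSum (F := fun z => conj (szegoD σ (conj z)) *
    scatF₂AtInfty b σ f z) (fun z hz => hasSum_of_eq ((hH z hz).mul_left (b : ℂ))
      (fun n => by rw [← mul_assoc]) (by
        rw [hF]; have := hne z; field_simp)) k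
  rw [h2] at h1
  have hb : (b : ℂ) * conj (b : ℂ) = 1 := by
    rw [Complex.mul_conj, Complex.normSq_eq_norm_sq, Circle.norm_coe]; simp
  have h3 := congrArg (fun w => -(b : ℂ) * conj w) h1
  simp only [map_sum, map_mul, Finset.mul_sum] at h3
  rw [Finset.sum_congr rfl (g := fun p : ℕ × ℕ => -(b : ℂ) *
    (conj (conj (taylorCoeff (szegoD σ) p.1)) * conj (taylorCoeff (scatF₂AtInfty b σ f) p.2)))]
  · simp only [taylorCoeff_eq_of_hasSum hE] at h3
    rw [← h3]
    split_ifs with hk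
    · simp
    · simp only [map_neg]
      linear_combination (conj (measureCoeff σ f (-k : ℤ))) * hb
  · intro p _
    rw [Complex.conj_conj]
    ring

/-- A convolution with a sequence that does not vanish at `0` determines the other factor. -/
theorem eq_of_sum_antidiagonal_eq {d x y : ℕ → ℂ} (hd : d 0 ≠ 0)
    (h : ∀ n, ∑ p ∈ Finset.HasAntidiagonal.antidiagonal n, d p.1 * x p.2 =
      ∑ p ∈ Finset.HasAntidiagonal.antidiagonal n, d p.1 * y p.2) (n : ℕ) : x n = y n := by
  have h1 : PowerSeries.mk d * PowerSeries.mk x = PowerSeries.mk d * PowerSeries.mk y := by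
    ext n
    simpa only [PowerSeries.coeff_mul, PowerSeries.coeff_mk] using h n
  have h2 : PowerSeries.mk d ≠ 0 := fun h0 => hd (by
    simpa using congrArg (PowerSeries.coeff 0) h0)
  simpa using congrArg (PowerSeries.coeff n) (mul_left_cancel₀ h2 h1)

/-! ### Measures and integrable functions are determined by their Fourier coefficients -/

theorem eq_of_integral_fourier_eq {μ ν : Measure UnitAddCircle} [IsFiniteMeasure μ]
    [IsFiniteMeasure ν] (h : ∀ n : ℤ, ∫ x, fourier n x ∂μ = ∫ x, fourier n x ∂ν) : μ = ν := by
  have hint : ∀ (ρ : Measure UnitAddCircle) [IsFiniteMeasure ρ] (g : C(UnitAddCircle, ℂ)),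
      Integrable g ρ := fun ρ _ g =>
    integrable_of_continuous g.continuous
  have hcont : ∀ (ρ : Measure UnitAddCircle) [IsFiniteMeasure ρ],
      Continuous fun g : C(UnitAddCircle, ℂ) => ∫ x, g x ∂ρ := fun ρ _ => by
    refine (continuous_integral.comp (ContinuousMap.toLp 1 ρ ℂ).continuous).congr fun g => ?_
    exact integral_congr_ae (ContinuousMap.coeFn_toLp ρ g)
  let L : ∀ (ρ : Measure UnitAddCircle) [IsFiniteMeasure ρ], C(UnitAddCircle, ℂ) →L[ℂ] ℂ :=
    fun ρ _ =>
    { toFun := fun g => ∫ x, g x ∂ρ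
      map_add' := fun f g => integral_add (hint ρ f) (hint ρ g)
      map_smul' := fun c g => integral_smul c g
      cont := hcont ρ }
  have hL : L μ = L ν := by
    refine ContinuousLinearMap.ext_on (s := Set.range (fourier (T := 1))) ?_ ?_
    · rw [Submodule.dense_iff_topologicalClosure_eq_top]
      exact span_fourier_closure_eq_top
    · rintro _ ⟨n, rfl⟩
      exact h n
  refine ext_of_forall_integral_eq_of_IsFiniteMeasure fun f => ?_
  have h1 := DFunLike.congr_fun hL ⟨fun x => (f x : ℂ), Complex.continuous_ofReal.comp f.continuous⟩
  have h2 : ∫ x, (f x : ℂ) ∂μ = ∫ x, (f x : ℂ) ∂ν := h1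
  rw [integral_complex_ofReal, integral_complex_ofReal] at h2
  exact_mod_cast h2

theorem conj_fourier (n : ℤ) (x : UnitAddCircle) :
    conj (fourier n x : ℂ) = fourier (-n) x := fourier_neg.symm

theorem conj_integral_fourier_mul (μ : Measure UnitAddCircle) (f : UnitAddCircle → ℂ) (n : ℤ) :
    conj (∫ x, fourier n x * f x ∂μ) = ∫ x, fourier (-n) x * conj (f x) ∂μ := by
  rw [← integral_conj]
  simp only [map_mul, conj_fourier]

/-- If the Fourier coefficients of a positive measure are those of `v dm`, then the measure
is `(Re v) dm`, stated with the positive and negative parts of `Re v`. -/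
theorem add_withDensity_eq {ν : Measure UnitAddCircle} [IsFiniteMeasure ν]
    {v : UnitAddCircle → ℂ} (hv : Integrable v m)
    (h : ∀ n : ℤ, ∫ x, fourier n x ∂ν = ∫ x, fourier n x * v x ∂m) :
    ν + m.withDensity (fun x => ENNReal.ofReal (-(v x).re)) =
      m.withDensity fun x => ENNReal.ofReal (v x).re := by
  have hr : Integrable (fun x => (v x).re) m := hv.re
  have hrn : Integrable (fun x => -(v x).re) m := hr.neg
  have := isFiniteMeasure_withDensity_ofReal hr.2
  have := isFiniteMeasure_withDensity_ofReal (f := fun x => -(v x).re) hr.neg.2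
  have hfi : ∀ (ρ : Measure UnitAddCircle) [IsFiniteMeasure ρ] (n : ℤ),
      Integrable (fun x => (fourier n x : ℂ)) ρ := fun ρ _ n =>
    integrable_of_continuous (fourier n).continuous
  have hd : ∀ (r : UnitAddCircle → ℝ), Integrable r m → ∀ n : ℤ,
      ∫ x, (fourier n x : ℂ) ∂(m.withDensity fun x => ENNReal.ofReal (r x)) =
        ∫ x, fourier n x * (max (r x) 0 : ℝ) ∂m := fun r hr n => by
    rw [integral_withDensity_eq_integral_toReal_smul₀ hr.aestronglyMeasurable.aemeasurable.ennreal_ofReal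
      (Filter.Eventually.of_forall fun x => ENNReal.ofReal_lt_top)]
    refine integral_congr_ae (Filter.Eventually.of_forall fun x => ?_)
    simp only [ENNReal.toReal_ofReal', Complex.real_smul]
    ring
  refine eq_of_integral_fourier_eq fun n => ?_
  rw [integral_add_measure (hfi _ _) (hfi _ _), hd _ hrn, hd _ hr]
  have h1 : ∫ x, fourier n x ∂ν = ∫ x, fourier n x * conj (v x) ∂m := by
    have h2 := congrArg conj (h (-n))
    rw [conj_integral_fourier_mul, neg_neg] at h2
    rw [← h2, ← integral_conj]
    simp only [conj_fourier, neg_neg]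
  have hvc : Integrable (fun x => conj (v x)) m :=
    Complex.conjCLE.toContinuousLinearMap.integrable_comp hv
  have h3 : ∫ x, fourier n x ∂ν = ∫ x, fourier n x * ((v x).re : ℂ) ∂m := by
    have h4 : ∫ x, fourier n x * v x + fourier n x * conj (v x) ∂m =
        ∫ x, 2 * (fourier n x * ((v x).re : ℂ)) ∂m := by
      refine integral_congr_ae (Filter.Eventually.of_forall fun x => ?_)
      simp only
      rw [← mul_add, Complex.add_conj]
      push_cast
      ring
    rw [integral_add (integrable_fourier_mul hv n) (integrable_fourier_mul hvc n), ← h, ← h1,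
      integral_const_mul, ← two_mul] at h4
    exact mul_left_cancel₀ two_ne_zero h4
  have hp : ∀ r : UnitAddCircle → ℝ, Integrable r m →
      Integrable (fun x => fourier n x * ((max (r x) 0 : ℝ) : ℂ)) m := fun r hr =>
    integrable_fourier_mul hr.pos_part.ofReal n
  have hri : Integrable (fun x => fourier n x * ((v x).re : ℂ)) m := integrable_fourier_mul hr.ofReal n
  have hni := hp _ hrn
  rw [h3, ← integral_add hri hni]
  refine integral_congr_ae (Filter.Eventually.of_forall fun x => ?_)
  simp only [← mul_add, ← Complex.ofReal_add]
  congr 2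
  rcases le_total (v x).re 0 with h0 | h0
  · rw [max_eq_right h0, max_eq_left (by linarith)]; ring
  · rw [max_eq_left h0, max_eq_right (by linarith)]; ring

theorem absolutelyContinuous_of_integral_fourier {ν : Measure UnitAddCircle} [IsFiniteMeasure ν]
    {v : UnitAddCircle → ℂ} (hv : Integrable v m)
    (h : ∀ n : ℤ, ∫ x, fourier n x ∂ν = ∫ x, fourier n x * v x ∂m) : ν ≪ m := by
  have h1 := add_withDensity_eq hv h
  have h2 : ν ≤ m.withDensity fun x => ENNReal.ofReal (v x).re := by
    rw [← h1]; exact Measure.le_add_right le_rfl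
  exact (Measure.absolutelyContinuous_of_le h2).trans (withDensity_absolutelyContinuous _ _)

theorem re_ae_eq_zero {v : UnitAddCircle → ℂ} (hv : Integrable v m)
    (h : ∀ n : ℤ, ∫ x, fourier n x * v x ∂m = 0) : ∀ᵐ x ∂m, (v x).re = 0 := by
  have h1 := add_withDensity_eq (ν := 0) hv fun n => by rw [h n]; simp
  have hr : Integrable (fun x => (v x).re) m := hv.re
  have := isFiniteMeasure_withDensity_ofReal (f := fun x => -(v x).re) hr.neg.2
  rw [zero_add] at h1
  have h2 := (withDensity_eq_iff hr.neg.aestronglyMeasurable.aemeasurable.ennreal_ofReal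
    hr.aestronglyMeasurable.aemeasurable.ennreal_ofReal (by
      rw [← setLIntegral_univ, ← withDensity_apply _ MeasurableSet.univ]
      exact measure_ne_top _ _)).1 h1
  filter_upwards [h2] with x hx
  have h3 := congrArg ENNReal.toReal hx
  simp only [Pi.neg_apply, ENNReal.toReal_ofReal'] at h3
  rcases le_total (v x).re 0 with h0 | h0
  · rw [max_eq_right h0, max_eq_left (by linarith)] at h3; linarith
  · rw [max_eq_left h0, max_eq_right (by linarith)] at h3; linarith

theorem ae_eq_of_fourierCoeff_eq {f g : UnitAddCircle → ℂ} (hf : Integrable f m)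
    (hg : Integrable g m) (h : ∀ n : ℤ, fourierCoeff f n = fourierCoeff g n) : f =ᵐ[m] g := by
  have hv : Integrable (fun x => f x - g x) m := hf.sub hg
  have h0 : ∀ n : ℤ, ∫ x, fourier n x * (f x - g x) ∂m = 0 := fun n => by
    have := h (-n)
    simp only [fourierCoeff, neg_neg, smul_eq_mul] at this
    simp only [mul_sub]
    rw [integral_sub (integrable_fourier_mul hf n) (integrable_fourier_mul hg n), this, sub_self]
  have h1 := re_ae_eq_zero hv h0
  have h2 := re_ae_eq_zero (hv.const_mul I) fun n => by
    simp only [mul_left_comm _ I]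
    rw [integral_const_mul, h0, mul_zero]
  filter_upwards [h1, h2] with x h3 h4
  rw [← sub_eq_zero]
  refine Complex.ext (by simpa using h3) ?_
  simpa [sub_eq_zero, eq_comm] using h4

/-! ### The orthonormal Laurent polynomials form a basis -/

theorem haar_absolutelyContinuous {σ : Measure UnitAddCircle}
    (hpos : ∀ᵐ x ∂m, 0 < density σ x) : m ≪ σ := by
  refine (withDensity_absolutelyContinuous' (Measure.measurable_rnDeriv σ m).aemeasurable ?_).trans
    (Measure.absolutelyContinuous_of_le (Measure.withDensity_rnDeriv_le σ m))
  filter_upwards [hpos] with x hx h0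
  rw [density, h0] at hx
  simp at hx

theorem exponent_injective : Function.Injective exponent := by
  intro i j h
  simp only [exponent] at h
  split_ifs at h <;> simp only [Nat.even_iff] at * <;> omega

theorem exponent_surjective : Function.Surjective exponent := by
  intro n
  rcases le_or_gt 0 n with h | h
  · refine ⟨2 * n.toNat, ?_⟩
    rw [exponent, if_pos (even_two_mul _)]
    omega
  · refine ⟨2 * (-n).toNat - 1, ?_⟩
    rw [exponent, if_neg (by rw [Nat.not_even_iff_odd, Nat.odd_iff]; omega)]
    omega

theorem linearIndependent_monomialSystem {σ : Measure UnitAddCircle} [IsFiniteMeasure σ]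
    (h : m ≪ σ) : LinearIndependent ℂ (monomialSystem σ) := by
  have := h.isOpenPosMeasure
  have h1 : LinearIndependent ℂ (fourier (T := 1)) :=
    LinearIndependent.of_comp (ContinuousMap.toLp 2 m ℂ : C(UnitAddCircle, ℂ) →L[ℂ] _).toLinearMap
      (orthonormal_fourier (T := 1)).linearIndependent
  refine (h1.comp _ exponent_injective).map'
    (ContinuousMap.toLp 2 σ ℂ : C(UnitAddCircle, ℂ) →L[ℂ] _).toLinearMap ?_
  exact LinearMap.ker_eq_bot.2 (ContinuousMap.toLp_injective σ)

theorem span_monomialSystem_closure (σ : Measure UnitAddCircle) [IsFiniteMeasure σ] :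
    (Submodule.span ℂ (Set.range (monomialSystem σ))).topologicalClosure = ⊤ := by
  have h := (ContinuousMap.toLp_denseRange ℂ σ ℂ
    (ENNReal.ofNat_ne_top (n := 2))).topologicalClosure_map_submodule
    (span_fourier_closure_eq_top (T := 1))
  rw [Submodule.map_span, ← Set.range_comp] at h
  have e : Set.range (monomialSystem σ) = Set.range
      ((ContinuousMap.toLp 2 σ ℂ : C(UnitAddCircle, ℂ) →L[ℂ] _) ∘ fourier) :=
    exponent_surjective.range_comp fun n => ContinuousMap.toLp 2 σ ℂ (fourier n)
  rw [e]
  exact h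

theorem exists_hilbertBasis (b : Circle) {σ : Measure UnitAddCircle} [IsFiniteMeasure σ]
    (h : m ≪ σ) : ∃ B : HilbertBasis ℕ ℂ (Lp ℂ 2 σ), ⇑B = laurentP b σ := by
  have hG := InnerProductSpace.gramSchmidtNormed_orthonormal (linearIndependent_monomialSystem h)
  have hc : ∀ n : ℕ, ‖(if Even n then (1 : ℂ) else -conj (b : ℂ))‖ = 1 := fun n => by
    split_ifs
    · exact norm_one
    · rw [norm_neg, RCLike.norm_conj, Circle.norm_coe]
  have hP : Orthonormal ℂ (laurentP b σ) := by
    refine ⟨fun n => ?_, fun i j hij => ?_⟩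
    · rw [laurentP, norm_smul, hc, hG.1, mul_one]
    · simp only [laurentP]
      rw [inner_smul_left, inner_smul_right, hG.2 hij, mul_zero, mul_zero]
  have hspan : ⊤ ≤ (Submodule.span ℂ (Set.range (laurentP b σ))).topologicalClosure := by
    rw [← span_monomialSystem_closure σ, ← InnerProductSpace.span_gramSchmidt,
      ← InnerProductSpace.span_gramSchmidtNormed_range]
    refine Submodule.topologicalClosure_mono (Submodule.span_le.2 ?_)
    rintro _ ⟨n, rfl⟩
    have h0 : (if Even n then (1 : ℂ) else -conj (b : ℂ)) ≠ 0 := fun h0 => by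
      have := hc n
      rw [h0, norm_zero] at this
      exact zero_ne_one this
    have h1 : InnerProductSpace.gramSchmidtNormed ℂ (monomialSystem σ) n =
        (if Even n then (1 : ℂ) else -conj (b : ℂ))⁻¹ • laurentP b σ n := by
      rw [laurentP, inv_smul_smul₀ h0]
    rw [SetLike.mem_coe, h1]
    exact Submodule.smul_mem _ _ (Submodule.subset_span ⟨n, rfl⟩)
  exact ⟨HilbertBasis.mk hP hspan, HilbertBasis.coe_mk hP hspan⟩

/-! ### Boundedness of the GLM transformation in terms of Hardy functions -/

theorem measureCoeff_eq_inner {σ : Measure UnitAddCircle} [IsFiniteMeasure σ] (f : Lp ℂ 2 σ)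
    (n : ℤ) : measureCoeff σ f n = inner ℂ (ContinuousMap.toLp 2 σ ℂ (fourier n)) f := by
  rw [L2.inner_def]
  refine integral_congr_ae ?_
  filter_upwards [ContinuousMap.coeFn_toLp (p := 2) (𝕜 := ℂ) σ (fourier n)] with x hx
  rw [hx, RCLike.inner_apply', conj_fourier]

/-- There are bounded (nonlinear) maps `f ↦ φ` and `f ↦ ψ` from `L²(dσ)` to the Hardy space such
that `u φ` carries the Fourier coefficients of `f dσ` of index `n ≥ 0`, and `u ψ` the conjugates of
those of index `n < 0`. -/
def HasHardyFactors (σ : Measure UnitAddCircle) (u : UnitAddCircle → ℂ) : Prop :=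
  ∃ C : ℝ, 0 ≤ C ∧ ∀ f : Lp ℂ 2 σ, ∃ φ ψ : Lp ℂ 2 m, IsHardy φ ∧ IsHardy ψ ∧
    ‖φ‖ ≤ C * ‖f‖ ∧ ‖ψ‖ ≤ C * ‖f‖ ∧
    (∀ k : ℕ, fourierCoeff (fun x => u x * φ x) k = measureCoeff σ f k) ∧
    ∀ k : ℕ, fourierCoeff (fun x => u x * ψ x) k =
      if k = 0 then 0 else conj (measureCoeff σ f (-k : ℤ))

/-- The image of `f ∈ L²(dσ)` under the GLM transformation: the sequence of the coefficients of
`F₁(·; f)` and `F₂(·; f)`, interlaced as in the columns of `glmMatrix`. -/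
def glmSeq (b : Circle) (σ : Measure UnitAddCircle) (f : Lp ℂ 2 σ) (i : ℕ) : ℂ :=
  if Even i then taylorCoeff (scatF₁ σ f) (i / 2)
  else taylorCoeff (scatF₂AtInfty b σ f) ((i + 1) / 2)

theorem glmSeq_even (b : Circle) (σ : Measure UnitAddCircle) (f : Lp ℂ 2 σ) (k : ℕ) :
    glmSeq b σ f (2 * k) = taylorCoeff (scatF₁ σ f) k := by
  rw [glmSeq, if_pos (even_two_mul k), Nat.mul_div_cancel_left k two_pos]

theorem glmSeq_odd (b : Circle) (σ : Measure UnitAddCircle) (f : Lp ℂ 2 σ) (k : ℕ) :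
    glmSeq b σ f (2 * k + 1) = taylorCoeff (scatF₂AtInfty b σ f) (k + 1) := by
  rw [glmSeq, if_neg (by simp)]
  congr 1
  omega

theorem glmMatrix_apply (b : Circle) (σ : Measure UnitAddCircle) [IsFiniteMeasure σ] (i n : ℕ) :
    glmMatrix b σ i n = glmSeq b σ (laurentP b σ n) i := rfl

theorem hasSum_norm_sq (x : Ell2) : HasSum (fun n => ‖x n‖ ^ 2) (‖x‖ ^ 2) := by
  simpa using lp.hasSum_norm (p := 2) (by norm_num) x

/-- Coordinate functionals of `ℓ²(ℤ₊)`. -/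
def coordCLM (n : ℕ) : Ell2 →L[ℂ] ℂ := innerSL ℂ (stdBasis n)

theorem coordCLM_apply (n : ℕ) (x : Ell2) : coordCLM n x = x n := by
  rw [coordCLM, innerSL_apply_apply, inner_stdBasis]

/-- The coordinate of index `2 k - 1`, read as `0` for `k = 0`. -/
def oddCoordCLM (k : ℕ) : Ell2 →L[ℂ] ℂ := if k = 0 then 0 else coordCLM (2 * k - 1)

theorem oddCoordCLM_zero : oddCoordCLM 0 = 0 := if_pos rfl

theorem oddCoordCLM_succ (k : ℕ) (x : Ell2) : oddCoordCLM (k + 1) x = x (2 * k + 1) := by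
  rw [oddCoordCLM, if_neg k.succ_ne_zero, coordCLM_apply]
  rfl

theorem taylorCoeff_scatF₂AtInfty_zero (b : Circle) (σ : Measure UnitAddCircle) (f : Lp ℂ 2 σ) :
    taylorCoeff (scatF₂AtInfty b σ f) 0 = 0 := by
  simp [taylorCoeff, scatF₂AtInfty]

/-- The bounded operator gives the Taylor coefficients of `φ` and `ψ`; for the `P_n` they satisfy the
convolution relations of the coefficients of `F₁` and `F₂`. -/
theorem hasHardyFactors_of_generatesBoundedOperator {b : Circle} {σ : Measure UnitAddCircle}
    [IsFiniteMeasure σ] (hl : Integrable (fun x => Real.log (density σ x)) m) (hac : m ≪ σ)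
    {u : UnitAddCircle → ℂ} (hu : IsOuter u)
    (hd : ∀ n : ℕ, fourierCoeff u n = taylorCoeff (szegoD σ) n)
    (h : GeneratesBoundedOperator (glmMatrix b σ)) : HasHardyFactors σ u := by
  obtain ⟨T, hT⟩ := h
  obtain ⟨B, hB⟩ := exists_hilbertBasis b hac
  let X : Lp ℂ 2 σ →L[ℂ] Ell2 := T ∘L B.repr.toContinuousLinearEquiv.toContinuousLinearMap
  have hXB : ∀ j i, X (B j) i = glmSeq b σ (B j) i := fun j i => by
    have : X (B j) = T (stdBasis j) := congrArg T (B.repr_self j)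
    rw [this, hT, glmMatrix_apply, hB]
  have hext : ∀ L L' : Lp ℂ 2 σ →L[ℂ] ℂ, (∀ j, L (B j) = L' (B j)) → L = L' := fun L L' hL =>
    ContinuousLinearMap.ext_on
      ((Submodule.dense_iff_topologicalClosure_eq_top).2 B.dense_span)
      (by rintro _ ⟨j, rfl⟩; exact hL j)
  -- the relations between coefficients hold for the basis vectors, hence for all `f` by continuity
  have heven : ∀ (k : ℕ) (f : Lp ℂ 2 σ), ∑ p ∈ Finset.HasAntidiagonal.antidiagonal k,
      taylorCoeff (szegoD σ) p.1 * X f (2 * p.2) = measureCoeff σ f k := by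
    intro k f
    have := hext (∑ p ∈ Finset.HasAntidiagonal.antidiagonal k,
      taylorCoeff (szegoD σ) p.1 • (coordCLM (2 * p.2) ∘L X))
      (innerSL ℂ (ContinuousMap.toLp 2 σ ℂ (fourier (k : ℤ)))) fun j => by
        simp only [_root_.sum_apply, _root_.smul_apply, ContinuousLinearMap.comp_apply,
          coordCLM_apply, hXB, glmSeq_even, smul_eq_mul, innerSL_apply_apply]
        rw [← measureCoeff_eq_inner, sum_szegoD_mul_scatF₁ hl]
    have h2 := DFunLike.congr_fun this f
    simpa only [_root_.sum_apply, _root_.smul_apply, ContinuousLinearMap.comp_apply,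
          coordCLM_apply, smul_eq_mul, innerSL_apply_apply, ← measureCoeff_eq_inner] using h2
  have hodd : ∀ (k : ℕ) (f : Lp ℂ 2 σ), ∑ p ∈ Finset.HasAntidiagonal.antidiagonal k,
      taylorCoeff (szegoD σ) p.1 * (-b * conj (oddCoordCLM p.2 (X f))) =
        if k = 0 then 0 else conj (measureCoeff σ f (-k : ℤ)) := by
    intro k f
    have := hext (∑ p ∈ Finset.HasAntidiagonal.antidiagonal k,
      (conj (taylorCoeff (szegoD σ) p.1) * -conj (b : ℂ)) • (oddCoordCLM p.2 ∘L X))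
      (if k = 0 then 0 else innerSL ℂ (ContinuousMap.toLp 2 σ ℂ (fourier (-k : ℤ)))) fun j => by
        have h1 := congrArg conj (sum_szegoD_mul_scatF₂ b hl (B j) k)
        have h3 : ∀ q, oddCoordCLM q (X (B j)) = taylorCoeff (scatF₂AtInfty b σ (B j)) q := by
          rintro (_ | q)
          · rw [oddCoordCLM_zero, taylorCoeff_scatF₂AtInfty_zero]; rfl
          · rw [oddCoordCLM_succ, hXB, glmSeq_odd]
        simp only [map_sum, map_mul, map_neg, Complex.conj_conj] at h1
        simp only [_root_.sum_apply, _root_.smul_apply, ContinuousLinearMap.comp_apply,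
          smul_eq_mul, h3]
        simp only [mul_assoc]
        rw [h1]
        split_ifs
        · simp
        · rw [Complex.conj_conj, innerSL_apply_apply, ← measureCoeff_eq_inner]
    have h2 := congrArg conj (DFunLike.congr_fun this f)
    simp only [_root_.sum_apply, _root_.smul_apply, ContinuousLinearMap.comp_apply,
      smul_eq_mul, map_sum, map_mul, map_neg, Complex.conj_conj, mul_assoc] at h2
    rw [h2]
    split_ifs
    · simp
    · rw [innerSL_apply_apply, ← measureCoeff_eq_inner]
  have hsq : ∀ (f : Lp ℂ 2 σ) (e : ℕ → ℕ), Function.Injective e →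
      Summable (fun k => ‖X f (e k)‖ ^ 2) ∧ ∑' k, ‖X f (e k)‖ ^ 2 ≤ (‖X‖ * ‖f‖) ^ 2 := by
    intro f e he
    have h1 := hasSum_norm_sq (X f)
    have h2 : Summable (fun k => ‖X f (e k)‖ ^ 2) := h1.summable.comp_injective he
    refine ⟨h2, (Summable.tsum_le_tsum_of_inj e he (fun c _ => by positivity) (fun k => le_rfl) h2
      h1.summable).trans ?_⟩
    rw [h1.tsum_eq]
    exact pow_le_pow_left₀ (norm_nonneg _) (X.le_opNorm f) 2
  refine ⟨‖X‖, norm_nonneg _, fun f => ?_⟩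
  obtain ⟨φ, hφH, hφ, hφn⟩ := exists_hardy_of_summable (hsq f (fun k => 2 * k) fun i j hij => by
    simpa using hij).1
  obtain ⟨hs, hs'⟩ := hsq f (fun k => 2 * k + 1) fun i j hij => by simpa using hij
  have hn : ∀ k, ‖-(b : ℂ) * conj (oddCoordCLM k (X f))‖ = ‖oddCoordCLM k (X f)‖ := fun k => by
    rw [norm_mul, norm_neg, Circle.norm_coe, RCLike.norm_conj, one_mul]
  have hs2 : Summable fun k => ‖-(b : ℂ) * conj (oddCoordCLM k (X f))‖ ^ 2 := by
    simp only [hn]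
    refine (summable_nat_add_iff 1).1 ?_
    simpa only [oddCoordCLM_succ] using hs
  obtain ⟨ψ, hψH, hψ, hψn⟩ := exists_hardy_of_summable hs2
  refine ⟨φ, ψ, hφH, hψH, ?_, ?_, fun k => ?_, fun k => ?_⟩
  · refine le_of_sq_le_sq ?_ (by positivity)
    rw [hφn]
    exact (hsq f (fun k => 2 * k) fun i j hij => by simpa using hij).2
  · refine le_of_sq_le_sq ?_ (by positivity)
    rw [hψn, hs2.tsum_eq_zero_add]
    simp only [hn]
    simp only [oddCoordCLM_succ]
    simpa [oddCoordCLM_zero] using hs'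
  · rw [IsHardy.fourierCoeff_mul hu.memLp (Lp.memLp φ) hu.isHardy hφH, ← heven]
    simp only [hd, hφ]
  · rw [IsHardy.fourierCoeff_mul hu.memLp (Lp.memLp ψ) hu.isHardy hψH, ← hodd]
    simp only [hd, hψ]

/-- The coefficients of `φ` and `ψ` must be those of `F₁` and `F₂`, up to conjugation and a unimodular
factor, since the convolution with the Taylor coefficients of `D` is injective. -/
theorem generatesBoundedOperator_of_hasHardyFactors {b : Circle} {σ : Measure UnitAddCircle}
    [IsFiniteMeasure σ] (hl : Integrable (fun x => Real.log (density σ x)) m) (hac : m ≪ σ)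
    {u : UnitAddCircle → ℂ} (hu : IsOuter u)
    (hd : ∀ n : ℕ, fourierCoeff u n = taylorCoeff (szegoD σ) n)
    (h : HasHardyFactors σ u) : GeneratesBoundedOperator (glmMatrix b σ) := by
  obtain ⟨C, hC, h⟩ := h
  obtain ⟨B, hB⟩ := exists_hilbertBasis b hac
  have hd0 : taylorCoeff (szegoD σ) 0 ≠ 0 := by
    rw [← hd]; exact hu.coeff_zero_ne_zero
  have hb : -(b : ℂ) ≠ 0 := neg_ne_zero.2 b.coe_ne_zero
  have hadd1 : ∀ f g k, taylorCoeff (scatF₁ σ (f + g)) k =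
      taylorCoeff (scatF₁ σ f) k + taylorCoeff (scatF₁ σ g) k := fun f g =>
    eq_of_sum_antidiagonal_eq hd0 fun n => by
      simp only [mul_add, Finset.sum_add_distrib, sum_szegoD_mul_scatF₁ hl, measureCoeff_eq_inner,
        inner_add_right]
  have hsmul1 : ∀ (c : ℂ) f k, taylorCoeff (scatF₁ σ (c • f)) k =
      c * taylorCoeff (scatF₁ σ f) k := fun c f =>
    eq_of_sum_antidiagonal_eq hd0 fun n => by
      simp only [mul_left_comm _ c, ← Finset.mul_sum, sum_szegoD_mul_scatF₁ hl,
        measureCoeff_eq_inner, inner_smul_right]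
  have hadd2 : ∀ f g k, taylorCoeff (scatF₂AtInfty b σ (f + g)) k =
      taylorCoeff (scatF₂AtInfty b σ f) k + taylorCoeff (scatF₂AtInfty b σ g) k := fun f g k => by
    have := eq_of_sum_antidiagonal_eq hd0
      (x := fun k => -b * conj (taylorCoeff (scatF₂AtInfty b σ (f + g)) k))
      (y := fun k => -b * conj (taylorCoeff (scatF₂AtInfty b σ f) k) +
        -b * conj (taylorCoeff (scatF₂AtInfty b σ g) k)) (fun n => by
      simp only [mul_add, Finset.sum_add_distrib, sum_szegoD_mul_scatF₂ b hl, measureCoeff_eq_inner,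
        inner_add_right, map_add]
      split_ifs <;> simp) k
    rw [← mul_add, ← map_add] at this
    exact (starRingEnd ℂ).injective (mul_left_cancel₀ hb this)
  have hsmul2 : ∀ (c : ℂ) f k, taylorCoeff (scatF₂AtInfty b σ (c • f)) k =
      c * taylorCoeff (scatF₂AtInfty b σ f) k := fun c f k => by
    have := eq_of_sum_antidiagonal_eq hd0
      (x := fun k => -b * conj (taylorCoeff (scatF₂AtInfty b σ (c • f)) k))
      (y := fun k => conj c * (-b * conj (taylorCoeff (scatF₂AtInfty b σ f) k))) (fun n => by
      simp only [mul_left_comm _ (conj c), ← Finset.mul_sum, sum_szegoD_mul_scatF₂ b hl,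
        measureCoeff_eq_inner, inner_smul_right, map_mul]
      split_ifs <;> simp) k
    rw [mul_left_comm, ← map_mul] at this
    exact (starRingEnd ℂ).injective (mul_left_cancel₀ hb this)
  have hsq : ∀ f : Lp ℂ 2 σ, Summable (fun i => ‖glmSeq b σ f i‖ ^ 2) ∧
      ∑' i, ‖glmSeq b σ f i‖ ^ 2 ≤ (2 * C * ‖f‖) ^ 2 := by
    intro f
    obtain ⟨φ, ψ, hφH, hψH, hφn, hψn, hφ, hψ⟩ := h f
    have e1 : ∀ k, taylorCoeff (scatF₁ σ f) k = fourierCoeff φ k :=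
      eq_of_sum_antidiagonal_eq hd0 fun n => by
        rw [sum_szegoD_mul_scatF₁ hl, ← hφ,
          IsHardy.fourierCoeff_mul hu.memLp (Lp.memLp φ) hu.isHardy hφH]
        simp only [hd]
    have e2 : ∀ k, -b * conj (taylorCoeff (scatF₂AtInfty b σ f) k) = fourierCoeff ψ k :=
      eq_of_sum_antidiagonal_eq hd0 fun n => by
        rw [sum_szegoD_mul_scatF₂ b hl, ← hψ,
          IsHardy.fourierCoeff_mul hu.memLp (Lp.memLp ψ) hu.isHardy hψH]
        simp only [hd]
    have e3 : ∀ k, ‖taylorCoeff (scatF₂AtInfty b σ f) k‖ = ‖fourierCoeff ψ k‖ := fun k => by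
      rw [← e2, norm_mul, norm_neg, Circle.norm_coe, RCLike.norm_conj, one_mul]
    have h1 := hφH.hasSum_sq (Lp.memLp φ)
    have h2 := hψH.hasSum_sq (Lp.memLp ψ)
    rw [integral_norm_sq_eq] at h1 h2
    have h3 : HasSum (fun k : ℕ => ‖fourierCoeff ψ ((k + 1 : ℕ) : ℤ)‖ ^ 2) (‖ψ‖ ^ 2) := by
      rw [← hasSum_nat_add_iff' 1] at h2
      have h4 : fourierCoeff ψ 0 = 0 := by
        rw [← Nat.cast_zero, ← e2, taylorCoeff_scatF₂AtInfty_zero]; simp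
      simpa [h4] using h2
    have h5 : HasSum (fun i => ‖glmSeq b σ f i‖ ^ 2) (‖φ‖ ^ 2 + ‖ψ‖ ^ 2) :=
      HasSum.even_add_odd (by simpa only [glmSeq_even, e1] using h1)
        (by simpa only [glmSeq_odd, e3] using h3)
    refine ⟨h5.summable, ?_⟩
    rw [h5.tsum_eq]
    have h6 := pow_le_pow_left₀ (norm_nonneg _) hφn 2
    have h7 := pow_le_pow_left₀ (norm_nonneg _) hψn 2
    nlinarith [sq_nonneg (C * ‖f‖)]
  let Z : Lp ℂ 2 σ →ₗ[ℂ] Ell2 :=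
    { toFun := fun f => ⟨glmSeq b σ f, memℓp_gen (by simpa using (hsq f).1)⟩
      map_add' := fun f g => by
        ext i
        simp only [glmSeq, lp.coeFn_add, Pi.add_apply]
        split_ifs
        · exact hadd1 f g _
        · exact hadd2 f g _
      map_smul' := fun c f => by
        ext i
        simp only [glmSeq, lp.coeFn_smul, Pi.smul_apply, RingHom.id_apply, smul_eq_mul]
        split_ifs
        · exact hsmul1 c f _
        · exact hsmul2 c f _ }
  let Y : Lp ℂ 2 σ →L[ℂ] Ell2 := Z.mkContinuous (2 * C) fun f => by
    refine le_of_sq_le_sq ?_ (by positivity)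
    rw [← (hasSum_norm_sq (Z f)).tsum_eq]
    exact (hsq f).2
  refine ⟨Y ∘L B.repr.symm.toContinuousLinearEquiv.toContinuousLinearMap, fun i j => ?_⟩
  have : (Y ∘L B.repr.symm.toContinuousLinearEquiv.toContinuousLinearMap) (stdBasis j) = Y (B j) :=
    congrArg Y (B.repr_symm_single j)
  rw [this, glmMatrix_apply, hB]
  rfl

/-! ### The weighted spaces `L²(w dm)` and `L²(w⁻¹ dm)` -/

/-- `u` is a square-integrable function with `|u|² = w ≠ 0`, so that the multiplications by `u`
and by `u⁻¹` map `L²(w dm)` and `L²(w⁻¹ dm)` isometrically onto `L²(dm)`. -/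
structure IsWeightRoot (σ : Measure UnitAddCircle) (u : UnitAddCircle → ℂ) : Prop where
  memLp : MemLp u 2 m
  ne_zero : ∀ᵐ x ∂m, u x ≠ 0
  norm_sq : ∀ᵐ x ∂m, ‖u x‖ ^ 2 = density σ x

theorem eLpNorm_withDensity {ρ : UnitAddCircle → ℝ≥0∞} {v : UnitAddCircle → ℂ} (hρ : Measurable ρ)
    (h : ∀ᵐ x ∂m, ρ x = ‖v x‖ₑ ^ (2 : ℝ)) (g : UnitAddCircle → ℂ) :
    eLpNorm g 2 (m.withDensity ρ) = eLpNorm (fun x => v x * g x) 2 m := by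
  have hfin : ∀ᵐ x ∂m, ρ x < ∞ := by
    filter_upwards [h] with x hx
    rw [hx]
    exact ENNReal.rpow_lt_top_of_nonneg (by norm_num) enorm_ne_top
  rw [eLpNorm_eq_lintegral_rpow_enorm_toReal two_ne_zero ENNReal.ofNat_ne_top,
    eLpNorm_eq_lintegral_rpow_enorm_toReal two_ne_zero ENNReal.ofNat_ne_top,
    lintegral_withDensity_eq_lintegral_mul_non_measurable _ hρ hfin]
  congr 1
  refine lintegral_congr_ae ?_
  filter_upwards [h] with x hx
  rw [Pi.mul_apply, hx, enorm_mul, ENNReal.toReal_ofNat, ENNReal.mul_rpow_of_nonneg _ _ (by norm_num)]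

theorem IsWeightRoot.rnDeriv_eq {σ : Measure UnitAddCircle} [IsFiniteMeasure σ]
    {u : UnitAddCircle → ℂ} (h : IsWeightRoot σ u) :
    ∀ᵐ x ∂m, σ.rnDeriv m x = ‖u x‖ₑ ^ (2 : ℝ) := by
  filter_upwards [h.norm_sq, Measure.rnDeriv_lt_top σ m] with x h1 h2
  rw [density] at h1
  rw [← ENNReal.ofReal_toReal h2.ne, ← h1, ← ofReal_norm,
    ENNReal.ofReal_rpow_of_nonneg (norm_nonneg _) (by norm_num)]
  norm_num

theorem IsWeightRoot.eLpNorm_eq {σ : Measure UnitAddCircle} [IsFiniteMeasure σ]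
    {u : UnitAddCircle → ℂ} (h : IsWeightRoot σ u) (hσ : σ ≪ m) (f : UnitAddCircle → ℂ) :
    eLpNorm f 2 σ = eLpNorm (fun x => u x * f x) 2 m := by
  rw [← eLpNorm_withDensity (Measure.measurable_rnDeriv σ m) h.rnDeriv_eq,
    Measure.withDensity_rnDeriv_eq σ m hσ]

theorem IsWeightRoot.eLpNorm_invWeight {σ : Measure UnitAddCircle} [IsFiniteMeasure σ]
    {u : UnitAddCircle → ℂ} (h : IsWeightRoot σ u) (g : UnitAddCircle → ℂ) :
    eLpNorm g 2 (invWeightMeasure σ) = eLpNorm (fun x => (u x)⁻¹ * g x) 2 m := by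
  refine eLpNorm_withDensity (Measure.measurable_rnDeriv σ m).inv ?_ g
  filter_upwards [h.rnDeriv_eq, h.ne_zero] with x h1 h2
  rw [Pi.inv_apply, h1, enorm_inv h2, ENNReal.inv_rpow]

theorem IsWeightRoot.haar_ac {σ : Measure UnitAddCircle} {u : UnitAddCircle → ℂ}
    (h : IsWeightRoot σ u) : m ≪ σ := by
  refine haar_absolutelyContinuous ?_
  filter_upwards [h.ne_zero, h.norm_sq] with x h1 h2
  rw [← h2]
  positivity

theorem invWeightMeasure_ac (σ : Measure UnitAddCircle) : invWeightMeasure σ ≪ m :=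
  withDensity_absolutelyContinuous _ _

theorem haar_ac_invWeightMeasure (σ : Measure UnitAddCircle) [IsFiniteMeasure σ] :
    m ≪ invWeightMeasure σ := by
  refine withDensity_absolutelyContinuous' (Measure.measurable_rnDeriv σ m).inv.aemeasurable ?_
  filter_upwards [Measure.rnDeriv_lt_top σ m] with x hx
  exact ENNReal.inv_ne_zero.2 hx.ne

theorem IsWeightRoot.aesm_inv {σ : Measure UnitAddCircle} {u : UnitAddCircle → ℂ}
    (h : IsWeightRoot σ u) : AEStronglyMeasurable (fun x => (u x)⁻¹) m :=
  h.memLp.1.aemeasurable.inv.aestronglyMeasurable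

theorem IsWeightRoot.memLp_of_Lp {σ : Measure UnitAddCircle} [IsFiniteMeasure σ]
    {u : UnitAddCircle → ℂ} (h : IsWeightRoot σ u) (hσ : σ ≪ m) (f : Lp ℂ 2 σ) :
    MemLp (fun x => u x * f x) 2 m :=
  ⟨h.memLp.1.mul ((Lp.memLp f).1.mono_ac h.haar_ac), by
    rw [← h.eLpNorm_eq hσ]; exact (Lp.memLp f).2⟩

theorem IsWeightRoot.memLp_of_Lp_invWeight {σ : Measure UnitAddCircle} [IsFiniteMeasure σ]
    {u : UnitAddCircle → ℂ} (h : IsWeightRoot σ u) (g : Lp ℂ 2 (invWeightMeasure σ)) :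
    MemLp (fun x => (u x)⁻¹ * g x) 2 m :=
  ⟨h.aesm_inv.mul ((Lp.memLp g).1.mono_ac (haar_ac_invWeightMeasure σ)), by
    rw [← h.eLpNorm_invWeight]; exact (Lp.memLp g).2⟩

theorem IsWeightRoot.integrable {σ : Measure UnitAddCircle} [IsFiniteMeasure σ]
    {u : UnitAddCircle → ℂ} (h : IsWeightRoot σ u) (g : Lp ℂ 2 (invWeightMeasure σ)) :
    Integrable g m := by
  refine (integrable_mul_of_memLp h.memLp (h.memLp_of_Lp_invWeight g)).congr ?_
  filter_upwards [h.ne_zero] with x hx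
  rw [mul_inv_cancel_left₀ hx]

theorem IsWeightRoot.exists_Lp {σ : Measure UnitAddCircle} [IsFiniteMeasure σ]
    {u : UnitAddCircle → ℂ} (h : IsWeightRoot σ u) (hσ : σ ≪ m) {φ : UnitAddCircle → ℂ}
    (hφ : MemLp φ 2 m) : ∃ f : Lp ℂ 2 σ, (∀ᵐ x ∂m, f x = (u x)⁻¹ * φ x) ∧
      ‖f‖ = (eLpNorm φ 2 m).toReal := by
  have e : eLpNorm (fun x => (u x)⁻¹ * φ x) 2 σ = eLpNorm φ 2 m := by
    rw [h.eLpNorm_eq hσ]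
    refine eLpNorm_congr_ae ?_
    filter_upwards [h.ne_zero] with x hx
    rw [mul_inv_cancel_left₀ hx]
  have hm : MemLp (fun x => (u x)⁻¹ * φ x) 2 σ :=
    ⟨(h.aesm_inv.mul hφ.1).mono_ac hσ, by rw [e]; exact hφ.2⟩
  exact ⟨hm.toLp _, h.haar_ac.ae_le hm.coeFn_toLp, by rw [Lp.norm_toLp, e]⟩

theorem IsWeightRoot.exists_Lp_invWeight {σ : Measure UnitAddCircle} [IsFiniteMeasure σ]
    {u : UnitAddCircle → ℂ} (h : IsWeightRoot σ u) {φ : UnitAddCircle → ℂ}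
    (hφ : MemLp φ 2 m) : ∃ g : Lp ℂ 2 (invWeightMeasure σ), (∀ᵐ x ∂m, g x = u x * φ x) ∧
      ‖g‖ = (eLpNorm φ 2 m).toReal := by
  have e : eLpNorm (fun x => u x * φ x) 2 (invWeightMeasure σ) = eLpNorm φ 2 m := by
    rw [h.eLpNorm_invWeight]
    refine eLpNorm_congr_ae ?_
    filter_upwards [h.ne_zero] with x hx
    rw [inv_mul_cancel_left₀ hx]
  have hm : MemLp (fun x => u x * φ x) 2 (invWeightMeasure σ) :=
    ⟨(h.memLp.1.mul hφ.1).mono_ac (invWeightMeasure_ac σ), by rw [e]; exact hφ.2⟩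
  exact ⟨hm.toLp _, (haar_ac_invWeightMeasure σ).ae_le hm.coeFn_toLp, by rw [Lp.norm_toLp, e]⟩

theorem IsWeightRoot.measureCoeff_eq {σ : Measure UnitAddCircle} [IsFiniteMeasure σ]
    {u : UnitAddCircle → ℂ} (h : IsWeightRoot σ u) (hσ : σ ≪ m) (f : UnitAddCircle → ℂ) (n : ℤ) :
    measureCoeff σ f n = fourierCoeff (fun x => u x * (conj (u x) * f x)) n := by
  rw [measureCoeff, ← integral_rnDeriv_smul hσ, fourierCoeff]
  refine integral_congr_ae ?_
  filter_upwards [h.norm_sq] with x hx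
  rw [density] at hx
  rw [← hx, ← mul_assoc (u x), Complex.mul_conj, Complex.normSq_eq_norm_sq, Complex.real_smul,
    smul_eq_mul]
  ring

theorem fourierCoeff_conj (f : UnitAddCircle → ℂ) (n : ℤ) :
    fourierCoeff (fun x => conj (f x)) n = conj (fourierCoeff f (-n)) := by
  simp only [fourierCoeff, smul_eq_mul]
  rw [conj_integral_fourier_mul, neg_neg]

/-- `g ↦ h` is linear because functions are determined by their Fourier coefficients. -/
theorem IsWeightRoot.fourierProjectionBounded {σ : Measure UnitAddCircle} [IsFiniteMeasure σ]
    {u : UnitAddCircle → ℂ} (hu : IsWeightRoot σ u) (S : Set ℤ) (C : ℝ)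
    (H : ∀ g : Lp ℂ 2 (invWeightMeasure σ), ∃ h : Lp ℂ 2 (invWeightMeasure σ), ‖h‖ ≤ C * ‖g‖ ∧
      ∀ n : ℤ, (n ∈ S → fourierCoeff h n = fourierCoeff g n) ∧ (n ∉ S → fourierCoeff h n = 0)) :
    FourierProjectionBounded σ S := by
  choose P hP hPc using H
  have heq : ∀ g h : Lp ℂ 2 (invWeightMeasure σ), (∀ n, fourierCoeff g n = fourierCoeff h n) →
      g = h := fun g h hgh =>
    Lp.ext ((invWeightMeasure_ac σ).ae_le
      (ae_eq_of_fourierCoeff_eq (hu.integrable g) (hu.integrable h) hgh))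
  have hadd : ∀ (g h : Lp ℂ 2 (invWeightMeasure σ)) n,
      fourierCoeff (g + h : Lp ℂ 2 (invWeightMeasure σ)) n =
        fourierCoeff g n + fourierCoeff h n := fun g h n => by
    rw [fourierCoeff_congr_ae ((haar_ac_invWeightMeasure σ).ae_le (Lp.coeFn_add g h))]
    simp only [fourierCoeff, Pi.add_apply, smul_eq_mul, mul_add]
    exact integral_add (integrable_fourier_mul (hu.integrable g) _)
      (integrable_fourier_mul (hu.integrable h) _)
  have hsmul : ∀ (c : ℂ) (g : Lp ℂ 2 (invWeightMeasure σ)) n,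
      fourierCoeff (c • g : Lp ℂ 2 (invWeightMeasure σ)) n = c * fourierCoeff g n := fun c g n => by
    rw [fourierCoeff_congr_ae ((haar_ac_invWeightMeasure σ).ae_le (Lp.coeFn_smul c g))]
    simp only [fourierCoeff, Pi.smul_apply, smul_eq_mul, mul_left_comm _ c]
    exact integral_const_mul _ _
  let T : Lp ℂ 2 (invWeightMeasure σ) →ₗ[ℂ] Lp ℂ 2 (invWeightMeasure σ) :=
    { toFun := P
      map_add' := fun g h => heq _ _ fun n => by
        rw [hadd]
        by_cases hn : n ∈ S
        · rw [(hPc _ n).1 hn, (hPc _ n).1 hn, (hPc _ n).1 hn, hadd]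
        · rw [(hPc _ n).2 hn, (hPc _ n).2 hn, (hPc _ n).2 hn, add_zero]
      map_smul' := fun c g => heq _ _ fun n => by
        rw [RingHom.id_apply, hsmul]
        by_cases hn : n ∈ S
        · rw [(hPc _ n).1 hn, (hPc _ n).1 hn, hsmul]
        · rw [(hPc _ n).2 hn, (hPc _ n).2 hn, mul_zero] }
  exact ⟨T.mkContinuous C hP, hPc⟩

/-! ### Hardy factors and the Riesz projections -/

/-- The Fourier coefficients of `u φ` and of the complex conjugate of `u ψ`. -/
theorem fourierCoeff_hardyFactors {σ : Measure UnitAddCircle} {f : UnitAddCircle → ℂ}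
    {u : UnitAddCircle → ℂ} (hu : IsOuter u) {φ ψ : Lp ℂ 2 m} (hφH : IsHardy φ) (hψH : IsHardy ψ)
    (hφ : ∀ k : ℕ, fourierCoeff (fun x => u x * φ x) k = measureCoeff σ f k)
    (hψ : ∀ k : ℕ, fourierCoeff (fun x => u x * ψ x) k =
      if k = 0 then 0 else conj (measureCoeff σ f (-k : ℤ))) (n : ℤ) :
    fourierCoeff (fun x => u x * φ x) n = (if 0 ≤ n then measureCoeff σ f n else 0) ∧
    fourierCoeff (fun x => conj (u x * ψ x)) n = if n < 0 then measureCoeff σ f n else 0 := by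
  rw [fourierCoeff_conj]
  rcases le_or_gt 0 n with hn | hn
  · rw [if_pos hn, if_neg (by omega)]
    obtain ⟨k, rfl⟩ := Int.eq_ofNat_of_zero_le hn
    refine ⟨hφ k, ?_⟩
    rcases k with _ | k
    · have := hψ 0
      simp only [if_true, Nat.cast_zero] at this
      rw [Nat.cast_zero, neg_zero, this, map_zero]
    · rw [hu.isHardy.mul hu.memLp (Lp.memLp ψ) hψH _ (by omega), map_zero]
  · rw [if_neg (by omega), if_pos hn]
    obtain ⟨k, hk, rfl⟩ : ∃ k : ℕ, k ≠ 0 ∧ n = -k := ⟨n.natAbs, by omega, by omega⟩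
    refine ⟨hu.isHardy.mul hu.memLp (Lp.memLp φ) hφH _ hn, ?_⟩
    rw [neg_neg, hψ, if_neg hk, Complex.conj_conj]

/-- For `f = 1` the Hardy factors exhibit `σ` as a measure with the Fourier coefficients of an
integrable function. -/
theorem HasHardyFactors.absolutelyContinuous {σ : Measure UnitAddCircle} [IsFiniteMeasure σ]
    {u : UnitAddCircle → ℂ} (hu : IsOuter u) (h : HasHardyFactors σ u) : σ ≪ m := by
  obtain ⟨C, -, h⟩ := h
  obtain ⟨φ, ψ, hφH, hψH, -, -, hφ, hψ⟩ := h (ContinuousMap.toLp 2 σ ℂ (fourier 0))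
  have hi1 := integrable_mul_of_memLp hu.memLp (Lp.memLp φ)
  have hi2 : Integrable (fun x => conj (u x * ψ x)) m :=
    Complex.conjCLE.toContinuousLinearMap.integrable_comp
      (integrable_mul_of_memLp hu.memLp (Lp.memLp ψ))
  refine absolutelyContinuous_of_integral_fourier (hi1.add hi2) fun n => ?_
  have h1 := fourierCoeff_hardyFactors hu hφH hψH hφ hψ (-n)
  have h2 : measureCoeff σ (ContinuousMap.toLp 2 σ ℂ (fourier 0)) (-n) = ∫ x, fourier n x ∂σ := by
    rw [measureCoeff, neg_neg]
    refine integral_congr_ae ?_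
    filter_upwards [ContinuousMap.coeFn_toLp (p := 2) (𝕜 := ℂ) σ (fourier 0)] with x hx
    rw [hx, fourier_zero, mul_one]
  have h3 : fourierCoeff (fun x => u x * φ x) (-n) + fourierCoeff (fun x => conj (u x * ψ x)) (-n) =
      ∫ x, fourier n x * ((fun x => u x * φ x) + fun x => conj (u x * ψ x)) x ∂m := by
    simp only [fourierCoeff, neg_neg, smul_eq_mul, Pi.add_apply, mul_add]
    exact (integral_add (integrable_fourier_mul hi1 n) (integrable_fourier_mul hi2 n)).symm
  rw [← h3, h1.1, h1.2, h2]
  by_cases hn : 0 ≤ -n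
  · rw [if_pos hn, if_neg (by omega), add_zero]
  · rw [if_neg hn, if_pos (by omega), zero_add]

theorem HasHardyFactors.riesz {σ : Measure UnitAddCircle} [IsFiniteMeasure σ]
    {u : UnitAddCircle → ℂ} (hu : IsOuter u) (hw : IsWeightRoot σ u) (h : HasHardyFactors σ u) :
    RieszPlusBounded σ ∧ RieszMinusBounded σ := by
  have hσ := h.absolutelyContinuous hu
  obtain ⟨C, hC, h⟩ := h
  have key : ∀ g : Lp ℂ 2 (invWeightMeasure σ), ∃ φ ψ : Lp ℂ 2 m, ‖φ‖ ≤ C * ‖g‖ ∧ ‖ψ‖ ≤ C * ‖g‖ ∧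
      ∀ n : ℤ, fourierCoeff (fun x => u x * φ x) n = (if 0 ≤ n then fourierCoeff g n else 0) ∧
        fourierCoeff (fun x => conj (u x * ψ x)) n = if n < 0 then fourierCoeff g n else 0 := by
    intro g
    have hg := hw.memLp_of_Lp_invWeight g
    have hn : ∀ᵐ x ∂m, ‖(conj (u x))⁻¹ * g x‖ = ‖(u x)⁻¹ * g x‖ :=
      Filter.Eventually.of_forall fun x => by simp
    have hg' : MemLp (fun x => (conj (u x))⁻¹ * g x) 2 m := by
      refine hg.of_le (AEStronglyMeasurable.mul ?_
        ((Lp.memLp g).1.mono_ac (haar_ac_invWeightMeasure σ))) (hn.mono fun x hx => hx.le)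
      exact (memLp_conj hw.memLp).1.aemeasurable.inv.aestronglyMeasurable
    -- the function `f = g / w`
    obtain ⟨f, hf, hfn⟩ := hw.exists_Lp hσ hg'
    have hfg : ‖f‖ = ‖g‖ := by
      rw [hfn, Lp.norm_def, hw.eLpNorm_invWeight, eLpNorm_congr_norm_ae hn]
    obtain ⟨φ, ψ, hφH, hψH, hφn, hψn, hφ, hψ⟩ := h f
    have hc : ∀ n, measureCoeff σ f n = fourierCoeff g n := fun n => by
      rw [hw.measureCoeff_eq hσ]
      refine congrFun (fourierCoeff_congr_ae ?_) n
      filter_upwards [hf, hw.ne_zero] with x h1 h2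
      have h3 : conj (u x) ≠ 0 := by simpa using h2
      rw [h1]
      field_simp
    refine ⟨φ, ψ, hfg ▸ hφn, hfg ▸ hψn, fun n => ?_⟩
    simpa only [hc] using fourierCoeff_hardyFactors hu hφH hψH hφ hψ n
  constructor
  · refine hw.fourierProjectionBounded _ C fun g => ?_
    obtain ⟨φ, ψ, hφn, -, hc⟩ := key g
    obtain ⟨p, hp, hpn⟩ := hw.exists_Lp_invWeight (Lp.memLp φ)
    refine ⟨p, by rwa [hpn, ← Lp.norm_def], fun n => ?_⟩
    rw [fourierCoeff_congr_ae hp, (hc n).1]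
    exact ⟨fun hn => if_pos hn, fun hn => if_neg hn⟩
  · refine hw.fourierProjectionBounded _ C fun g => ?_
    obtain ⟨φ, ψ, -, hψn, hc⟩ := key g
    -- the complex conjugate of `u ψ` is `u` times `(ū / u) ψ̄`
    have hn : ∀ᵐ x ∂m, ‖(u x)⁻¹ * conj (u x * ψ x)‖ = ‖ψ x‖ := by
      filter_upwards [hw.ne_zero] with x hx
      rw [norm_mul, RCLike.norm_conj, ← norm_mul, inv_mul_cancel_left₀ hx]
    have hm : MemLp (fun x => (u x)⁻¹ * conj (u x * ψ x)) 2 m := by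
      refine (Lp.memLp ψ).of_le (hw.aesm_inv.mul ?_) (hn.mono fun x hx => hx.le)
      exact Complex.continuous_conj.comp_aestronglyMeasurable (hw.memLp.1.mul (Lp.memLp ψ).1)
    obtain ⟨p, hp, hpn⟩ := hw.exists_Lp_invWeight hm
    refine ⟨p, by rwa [hpn, eLpNorm_congr_norm_ae hn, ← Lp.norm_def], fun n => ?_⟩
    have hp' : p =ᵐ[m] fun x => conj (u x * ψ x) := by
      filter_upwards [hp, hw.ne_zero] with x h1 h2
      rw [h1, mul_inv_cancel_left₀ h2]
    rw [fourierCoeff_congr_ae hp', (hc n).2]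
    exact ⟨fun hn => if_pos hn, fun hn => if_neg hn⟩

/-- `φ = P₊ g / u` and `ψ` is the conjugate of `P₋ g` divided by `u`, where `g = f w`. -/
theorem hasHardyFactors_of_riesz {σ : Measure UnitAddCircle} [IsFiniteMeasure σ]
    {u : UnitAddCircle → ℂ} (hu : IsOuter u) (hw : IsWeightRoot σ u) (hσ : σ ≪ m)
    (hp : RieszPlusBounded σ) (hm : RieszMinusBounded σ) : HasHardyFactors σ u := by
  obtain ⟨T, hT⟩ := hp
  obtain ⟨S, hS⟩ := hm
  refine ⟨max ‖T‖ ‖S‖, le_max_of_le_left (norm_nonneg _), fun f => ?_⟩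
  have hf := hw.memLp_of_Lp hσ f
  have hn : ∀ᵐ x ∂m, ‖conj (u x) * f x‖ = ‖u x * f x‖ :=
    Filter.Eventually.of_forall fun x => by simp
  have hf' : MemLp (fun x => conj (u x) * f x) 2 m :=
    hf.of_le ((memLp_conj hw.memLp).1.mul ((Lp.memLp f).1.mono_ac hw.haar_ac))
      (hn.mono fun x hx => hx.le)
  -- the function `g = f w`
  obtain ⟨g, hg, hgn⟩ := hw.exists_Lp_invWeight hf'
  have hgf : ‖g‖ = ‖f‖ := by
    rw [hgn, Lp.norm_def, hw.eLpNorm_eq hσ, eLpNorm_congr_norm_ae hn]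
  have hc : ∀ n, measureCoeff σ f n = fourierCoeff g n := fun n => by
    rw [hw.measureCoeff_eq hσ, fourierCoeff_congr_ae hg]
  have h1 := hw.memLp_of_Lp_invWeight (T g)
  have hSm : AEStronglyMeasurable (S g) m := (hw.integrable (S g)).1
  have hn2 : ∀ᵐ x ∂m, ‖(u x)⁻¹ * conj (S g x)‖ = ‖(u x)⁻¹ * S g x‖ :=
    Filter.Eventually.of_forall fun x => by simp
  have h2 : MemLp (fun x => (u x)⁻¹ * conj (S g x)) 2 m :=
    (hw.memLp_of_Lp_invWeight (S g)).of_le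
      (hw.aesm_inv.mul (Complex.continuous_conj.comp_aestronglyMeasurable hSm))
      (hn2.mono fun x hx => hx.le)
  have e1 : (fun x => u x * h1.toLp _ x) =ᵐ[m] T g := by
    filter_upwards [h1.coeFn_toLp, hw.ne_zero] with x h3 h4
    rw [h3, mul_inv_cancel_left₀ h4]
  have e2 : (fun x => u x * h2.toLp _ x) =ᵐ[m] fun x => conj (S g x) := by
    filter_upwards [h2.coeFn_toLp, hw.ne_zero] with x h3 h4
    rw [h3, mul_inv_cancel_left₀ h4]
  refine ⟨h1.toLp _, h2.toLp _, ?_, ?_, ?_, ?_, fun k => ?_, fun k => ?_⟩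
  · refine hu.isHardy_of_mul (Lp.memLp _) fun n hn => ?_
    rw [fourierCoeff_congr_ae e1]
    exact (hT g n).2 (not_le.2 hn)
  · refine hu.isHardy_of_mul (Lp.memLp _) fun n hn => ?_
    rw [fourierCoeff_congr_ae e2, fourierCoeff_conj, (hS g (-n)).2 (by simpa using hn.le), map_zero]
  · rw [Lp.norm_toLp, ← hw.eLpNorm_invWeight, ← Lp.norm_def, ← hgf]
    exact (T.le_opNorm g).trans (mul_le_mul_of_nonneg_right (le_max_left _ _) (norm_nonneg _))
  · rw [Lp.norm_toLp, eLpNorm_congr_norm_ae hn2, ← hw.eLpNorm_invWeight, ← Lp.norm_def, ← hgf]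
    exact (S.le_opNorm g).trans (mul_le_mul_of_nonneg_right (le_max_right _ _) (norm_nonneg _))
  · rw [fourierCoeff_congr_ae e1, hc]
    exact (hT g k).1 (Int.natCast_nonneg k)
  · rw [fourierCoeff_congr_ae e2, fourierCoeff_conj, hc]
    rcases eq_or_ne k 0 with hk | hk
    · rw [if_pos hk, (hS g (-k)).2 (by simp [hk]), map_zero]
    · rw [if_neg hk, (hS g (-k)).1 (show (-k : ℤ) < 0 by omega)]

end CMV

end

theorem proposition4p5 (b : Circle) (a : ℕ → Complex.UnitDisc) (hSz : CMV.IsSzego a)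
    (σ : MeasureTheory.Measure UnitAddCircle) [MeasureTheory.IsProbabilityMeasure σ]
    (hσ : CMV.IsSpectralMeasure (CMV.cmvOperator b a) (CMV.stdBasis 0) σ) :
    CMV.GeneratesBoundedOperator (CMV.glmMatrix b σ) ↔
      MeasureTheory.Measure.AbsolutelyContinuous σ CMV.m ∧
        CMV.RieszPlusBounded σ ∧ CMV.RieszMinusBounded σ := by
  obtain ⟨c, hc, hcb⟩ := CMV.exists_le_integral_norm_sq_eval hSz hσ
  obtain ⟨hpos, hl⟩ := CMV.IsEvalBound.ae_pos_and_integrable hc hcb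
  obtain ⟨u, hu, hw, hd⟩ := CMV.exists_outer hpos hl
  have hwr : CMV.IsWeightRoot σ u := ⟨Lp.memLp u, by
    filter_upwards [hw, hpos] with x h1 h2 h3
    rw [← h1, h3] at h2
    simp at h2, hw⟩
  constructor
  · intro h
    have hF := CMV.hasHardyFactors_of_generatesBoundedOperator hl hwr.haar_ac hu hd h
    exact ⟨hF.absolutelyContinuous hu, hF.riesz hu hwr⟩
  · rintro ⟨hac, hp, hm⟩
    exact CMV.generatesBoundedOperator_of_hasHardyFactors hl hwr.haar_ac hu hd
      (CMV.hasHardyFactors_of_riesz hu hwr hac hp hm)
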